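/- Let $k$ be an algebraically closed field of characteristic different from $2$ and $3$. Let ${\mathcal H}ilb_6^{aG,0}(\mathbb P^4)$ be the set of closed subschemes $X\subseteq\mathbb P^4_k$ with Hilbert polynomial $6$ (i.e. of dimension $0$ and degree $6$) which are arithmetically Gorenstein (the projective coordinate ring $S_X=k[x_0,\dots,x_4]/I_X$, $I_X$ being the saturated homogeneous ideal of $X$, is a Gorenstein ring) and which are not contained in any hyperplane of $\mathbb P^4$. We say that $X\subseteq\mathbb P^4$ can be obtained via the Scandinavian construction if there is a $3\times3$ matrix $M$ whose entries are linear forms in $k[x_0,\dots,x_4]$ (possibly zero) such that the ideal $F_2(M)\subseteq k[x_0,\dots,x_4]$ generated by the $2\times 2$ minors of $M$ has depth $4$ and $I_X=F_2(M)$. For $1\le n\le d-2$ let $$A_{n,d}:=k[x_1,\dots,x_n]/\bigl(x_ix_j-\delta_{i,j}x_1^{d-n},\;x_1^{d-n+1}\bigr)_{1\le i\le j\le n,\ (i,j)\ne(1,1)},$$ and for an Artinian Gorenstein $k$-algebra $A$ of dimension $6$ over $k$ let $O(A)\subseteq{\mathcal H}ilb_6^{aG,0}(\mathbb P^4)$ be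 the orbit, under the action of $\operatorname{PGL}_5(k)$, of the embeddings of $\operatorname{Spec}(A)$ in $\mathbb P^4$ as a member of ${\mathcal H}ilb_6^{aG,0}(\mathbb P^4)$. Then $X\in{\mathcal H}ilb_6^{aG,0}(\mathbb P^4)$ can be obtained via the Scandinavian construction if and only if $X\notin O(A_{3,5}\oplus k)\cup O(A_{3,6})$. -/

import Mathlib

open MvPolynomial CategoryTheory AlgebraicGeometry

attribute [local instance] MvPolynomial.gradedAlgebra

universe u

noncomputable section

/-! ### The grading of a quotient by a homogeneous ideal -/

section QuotientGrading

variable {k A : Type*} [CommRing k] [CommRing A] [Algebra k A]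

/-- The degree `n` part of `A ⧸ I`: the classes of the elements of degree `n`. -/
def quotientGrading (𝒜 : ℕ → Submodule k A) (I : Ideal A) (n : ℕ) : Submodule k (A ⧸ I) :=
  (𝒜 n).map (Ideal.Quotient.mkₐ k I).toLinearMap

variable (𝒜 : ℕ → Submodule k A) [GradedAlgebra 𝒜] (I : Ideal A)

instance quotientGrading.gradedMonoid : SetLike.GradedMonoid (quotientGrading 𝒜 I) where
  one_mem := ⟨1, SetLike.GradedOne.one_mem, map_one (Ideal.Quotient.mkₐ k I)⟩
  mul_mem := by
    rintro i j _ _ ⟨a, ha, rfl⟩ ⟨b, hb, rfl⟩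
    exact ⟨a * b, SetLike.GradedMul.mul_mem ha hb, map_mul (Ideal.Quotient.mkₐ k I) a b⟩

/-- The reduction map from degree `n` elements of `A` to degree `n` elements of `A ⧸ I`. -/
def quotientGrading.mkPiece (n : ℕ) : 𝒜 n →ₗ[k] quotientGrading 𝒜 I n :=
  ((Ideal.Quotient.mkₐ k I).toLinearMap.restrict
    (fun x hx => ⟨x, hx, rfl⟩ : ∀ x ∈ 𝒜 n, _ ∈ quotientGrading 𝒜 I n))

/-- The map sending an element of `A` to the family of classes of its components. -/
def quotientGrading.split : A →ₐ[k] DirectSum ℕ fun n => quotientGrading 𝒜 I n :=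
  (DirectSum.toAlgebra k (fun n => 𝒜 n)
    (fun n => (DirectSum.lof k ℕ (fun n => quotientGrading 𝒜 I n) n).comp
      (quotientGrading.mkPiece 𝒜 I n))
    rfl
    (fun {i j} a b => by
      change DirectSum.of _ _ _ = DirectSum.of _ _ _ * DirectSum.of _ _ _
      rw [DirectSum.of_mul_of]
      rfl)).comp (DirectSum.decomposeAlgEquiv 𝒜).toAlgHom

lemma quotientGrading.split_of_mem {n : ℕ} (x : A) (hx : x ∈ 𝒜 n) :
    quotientGrading.split 𝒜 I x =
      DirectSum.of (fun n => quotientGrading 𝒜 I n) n (quotientGrading.mkPiece 𝒜 I n ⟨x, hx⟩) := by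
  simp only [quotientGrading.split, AlgHom.comp_apply]
  have : (DirectSum.decomposeAlgEquiv 𝒜).toAlgHom x = DirectSum.of (fun n => 𝒜 n) n ⟨x, hx⟩ :=
    DirectSum.decompose_of_mem 𝒜 hx
  rw [this]
  exact DirectSum.toAddMonoid_of _ _ _

/-- The quotient of a graded algebra by a homogeneous ideal is a graded algebra. -/
@[reducible]
def quotientGrading.gradedAlgebra (hI : I.IsHomogeneous 𝒜) :
    GradedAlgebra (quotientGrading 𝒜 I) :=
  GradedAlgebra.ofAlgHom (quotientGrading 𝒜 I)
    (Ideal.Quotient.liftₐ I (quotientGrading.split 𝒜 I) (by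
      classical
      intro a ha
      rw [← DirectSum.sum_support_decompose 𝒜 a, map_sum]
      refine Finset.sum_eq_zero fun i _ => ?_
      rw [quotientGrading.split_of_mem 𝒜 I _ (SetLike.coe_mem _)]
      have : quotientGrading.mkPiece 𝒜 I i ⟨_, SetLike.coe_mem (DirectSum.decompose 𝒜 a i)⟩ = 0 :=
        Subtype.ext (Ideal.Quotient.eq_zero_iff_mem.mpr (hI i ha))
      rw [this, map_zero]))
    (by
      classical
      refine Ideal.Quotient.algHom_ext _ (AlgHom.ext fun a => ?_)
      rw [← DirectSum.sum_support_decompose 𝒜 a, map_sum, map_sum]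
      refine Finset.sum_congr rfl fun i _ => ?_
      change DirectSum.coeAlgHom _ (quotientGrading.split 𝒜 I _) = _
      rw [quotientGrading.split_of_mem 𝒜 I _ (SetLike.coe_mem _)]
      exact DirectSum.coeAlgHom_of _ _ _)
    (by
      rintro i ⟨_, ⟨x, hx, rfl⟩⟩
      exact quotientGrading.split_of_mem 𝒜 I x hx)

end QuotientGrading

/-! ### Depth, Cohen-Macaulay and Gorenstein rings -/

/-- The depth of an ideal `I` of `R`: the supremum of the lengths of the `R`-regular sequences
contained in `I`. -/
def idealDepth {R : Type*} [CommRing R] (I : Ideal R) : ℕ∞ :=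
  ⨆ (rs : List R) (_ : RingTheory.Sequence.IsRegular R rs) (_ : ∀ r ∈ rs, r ∈ I), (rs.length : ℕ∞)

/-- A Cohen-Macaulay local ring: a Noetherian local ring whose depth is its dimension. -/
def IsCMLocal (R : Type*) [CommRing R] [IsLocalRing R] : Prop :=
  IsNoetherianRing R ∧ (idealDepth (IsLocalRing.maximalIdeal R) : WithBot ℕ∞) = ringKrullDim R

/-- A Gorenstein local ring: a Cohen-Macaulay local ring of finite injective dimension
over itself. -/
def IsGorensteinLocal (R : Type u) [CommRing R] [IsLocalRing R] : Prop :=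
  IsCMLocal R ∧ ∃ n : ℕ, HasInjectiveDimensionLT (ModuleCat.of R R) n

/-- A Gorenstein ring: all localizations at maximal ideals are Gorenstein local rings. -/
def IsGorenstein (R : Type u) [CommRing R] : Prop :=
  ∀ (m : Ideal R) [m.IsMaximal], IsGorensteinLocal (Localization.AtPrime m)

/-! ### Closed subschemes of projective space -/

/-- A closed subscheme `X` of `ℙⁿ` over a field `k`, given by its homogeneous ideal `I_X`, i.e.
by a saturated homogeneous ideal of `k[x_0, …, x_n]`. -/
structure ProjSubscheme (k : Type u) [Field k] (n : ℕ) where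
  /-- The homogeneous ideal `I_X`. -/
  ideal : Ideal (MvPolynomial (Fin (n + 1)) k)
  isHomogeneous : ideal.IsHomogeneous (homogeneousSubmodule (Fin (n + 1)) k)
  saturated : ∀ f : MvPolynomial (Fin (n + 1)) k, (∀ i, X i * f ∈ ideal) → f ∈ ideal

namespace ProjSubscheme

variable {k : Type u} [Field k] {n : ℕ} (X : ProjSubscheme k n)

/-- The projective coordinate ring `S_X = S / I_X`. -/
abbrev CoordRing : Type u := MvPolynomial (Fin (n + 1)) k ⧸ X.ideal

/-- The grading of `S_X`. -/
def grading : ℕ → Submodule k X.CoordRing :=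
  quotientGrading (homogeneousSubmodule (Fin (n + 1)) k) X.ideal

instance : GradedAlgebra X.grading :=
  quotientGrading.gradedAlgebra (homogeneousSubmodule (Fin (n + 1)) k) X.ideal X.isHomogeneous

/-- The scheme `X = Proj S_X`. -/
def toScheme : Scheme.{u} := Proj X.grading

/-- The structure morphism `X ⟶ Spec k`. -/
def structureMorphism : X.toScheme ⟶ Spec (CommRingCat.of k) :=
  Proj.toSpecZero X.grading ≫ Spec.map (CommRingCat.ofHom (algebraMap k (X.grading 0)))

/-- `X` is isomorphic, as an abstract scheme over `k`, to `Spec A`. -/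
def IsIsoSpec (A : Type u) [CommRing A] [Algebra k A] : Prop :=
  Nonempty (Over.mk X.structureMorphism ≅
    Over.mk (Spec.map (CommRingCat.ofHom (algebraMap k A))))

/-- `X` has Hilbert polynomial `p`. -/
def HasHilbertPolynomial (p : Polynomial ℚ) : Prop :=
  ∀ᶠ t : ℕ in Filter.atTop, (Module.finrank k (X.grading t) : ℚ) = p.eval (t : ℚ)

/-- The codimension in `ℙⁿ` of the linear subspace generated by `X`, i.e. the dimension of the
space of linear forms vanishing on `X`. -/
def spanCodim : ℕ :=
  Module.finrank k
    (X.ideal.restrictScalars k ⊓ homogeneousSubmodule (Fin (n + 1)) k 1 : Submodule k _)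

/-- The linear change of coordinates `x_i ↦ ∑ j, g i j x_j`. -/
def linearSubst (g : Matrix (Fin (n + 1)) (Fin (n + 1)) k) :
    MvPolynomial (Fin (n + 1)) k →ₐ[k] MvPolynomial (Fin (n + 1)) k :=
  aeval fun i => ∑ j, C (g i j) * MvPolynomial.X j

/-- `X` and `Y` are projectively equivalent, i.e. in the same orbit of the projective linear
group (whose action is induced by that of the general linear group). -/
def ProjEquiv (Y : ProjSubscheme k n) : Prop :=
  ∃ g : GL (Fin (n + 1)) k, X.ideal = Y.ideal.map (linearSubst (g : Matrix _ _ k))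

end ProjSubscheme

/-- The points of the locus `Hilb_d^{aG,r}(ℙⁿ)`: the subschemes of `ℙⁿ` with constant Hilbert
polynomial `d`, with Gorenstein coordinate ring, generating a subspace of codimension `r`. -/
def hilbAG (k : Type u) [Field k] (n d r : ℕ) : Set (ProjSubscheme k n) :=
  {X | X.HasHilbertPolynomial (Polynomial.C (d : ℚ)) ∧ IsGorenstein X.CoordRing ∧ X.spanCodim = r}

/-- `O(A)`: the orbit in `Hilb_d^{aG,0}(ℙⁿ)` of the non-degenerate arithmetically Gorenstein
embeddings of `Spec A` under the projective linear group. -/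
def orbitO {k : Type u} [Field k] (n d : ℕ) (A : Type u) [CommRing A] [Algebra k A] :
    Set (ProjSubscheme k n) :=
  {X | ∃ Y ∈ hilbAG k n d 0, Y.IsIsoSpec A ∧ X.ProjEquiv Y}

/-! ### The local algebras `A_{n,d}` -/

/-- The ideal of `k[x_1, …, x_n]` generated by `x_i x_j - δ_{i,j} x_1^{d-n}` for `i ≤ j`,
`(i,j) ≠ (1,1)`, and by `x_1^{d-n+1}`. The index `0 : Fin n` stands for the index `1`. -/
def idealA (k : Type u) [Field k] (n d : ℕ) [NeZero n] : Ideal (MvPolynomial (Fin n) k) :=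
  Ideal.span
    ({p | ∃ i j : Fin n, i ≤ j ∧ (i, j) ≠ (0, 0) ∧
        p = X i * X j - if i = j then X 0 ^ (d - n) else 0} ∪ {X 0 ^ (d - n + 1)})

/-- The algebra `A_{n,d}`. -/
abbrev AlgA (k : Type u) [Field k] (n d : ℕ) [NeZero n] : Type u :=
  MvPolynomial (Fin n) k ⧸ idealA k n d

/-! ### The Scandinavian construction -/

/-- The ideal `F_2(M)` generated by the `2 × 2` minors of `M`. -/
def minorsIdeal {R : Type*} [CommRing R] (M : Matrix (Fin 3) (Fin 3) R) : Ideal R :=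
  Ideal.span {p | ∃ i i' j j' : Fin 3, i < i' ∧ j < j' ∧
    p = (M.submatrix ![i, i'] ![j, j']).det}

/-- `X ⊆ ℙ⁴` is obtained via the Scandinavian construction: there is a `3 × 3` matrix `M` of
linear forms in `k[x_0, …, x_4]` such that `F_2(M)` has depth `4` and is the homogeneous ideal
of `X`. -/
def ProjSubscheme.IsScandinavian {k : Type u} [Field k] (X : ProjSubscheme k 4) : Prop :=
  ∃ M : Matrix (Fin 3) (Fin 3) (MvPolynomial (Fin 5) k),
    (∀ i j, (M i j).IsHomogeneous 1) ∧ idealDepth (minorsIdeal M) = 4 ∧ X.ideal = minorsIdeal M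

end

/-! ### Gale duality: subspaces `U` with `U · U = A` and the minors they produce. -/

section Gale

open Module

variable {k A : Type*} [Field k] [CommRing A] [Algebra k A]

lemma exists_linearMap_mul_eq {Q : Type*} [AddCommGroup Q] [Module k Q] (hA : finrank k A = 6)
    {u : Fin 3 → A}
    (hu : Submodule.span k (Set.range fun p : Fin 3 × Fin 3 => u p.1 * u p.2) = ⊤)
    (q : Fin 3 → Fin 3 → Q) (hq : ∀ i j, q i j = q j i) :
    ∃ γ : A →ₗ[k] Q, ∀ i j, γ (u i * u j) = q i j := by
  -- Up to symmetry there are six products, as many as the dimension, so spanning makes them a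
  -- basis: Sym²U → A is bijective, and any symmetric family of values is attained.
  let e : Fin 6 → A := ![u 0 * u 0, u 1 * u 1, u 2 * u 2, u 1 * u 2, u 0 * u 2, u 0 * u 1]
  have hspan : ⊤ ≤ Submodule.span k (Set.range e) := by
    rw [← hu, Submodule.span_le]
    rintro _ ⟨⟨i, j⟩, rfl⟩
    apply Submodule.subset_span
    fin_cases i <;> fin_cases j
    exacts [⟨0, rfl⟩, ⟨5, rfl⟩, ⟨4, rfl⟩, ⟨5, mul_comm _ _⟩, ⟨1, rfl⟩, ⟨3, rfl⟩, ⟨4, mul_comm _ _⟩,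
      ⟨3, mul_comm _ _⟩, ⟨2, rfl⟩]
  let b := basisOfTopLeSpanOfCardEqFinrank e hspan (by simp [hA])
  have hb : ∀ i, b i = e i := fun i => by simp [b]
  refine ⟨b.constr k ![q 0 0, q 1 1, q 2 2, q 1 2, q 0 2, q 0 1], fun i j => ?_⟩
  have key : ∀ n, b.constr k ![q 0 0, q 1 1, q 2 2, q 1 2, q 0 2, q 0 1] (e n) =
      ![q 0 0, q 1 1, q 2 2, q 1 2, q 0 2, q 0 1] n := fun n => by
    rw [← hb, Basis.constr_basis]
  fin_cases i <;> fin_cases j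
  · exact key 0
  · exact key 5
  · exact key 4
  · exact (congrArg _ (mul_comm _ _)).trans ((key 5).trans (hq _ _))
  · exact key 1
  · exact key 3
  · exact (congrArg _ (mul_comm _ _)).trans ((key 4).trans (hq _ _))
  · exact (congrArg _ (mul_comm _ _)).trans ((key 3).trans (hq _ _))
  · exact key 2

/-- Injectivity of Sym²U → A in coordinates. The diagonal is treated apart so that no factor 2
appears. -/
lemma add_swap_eq_zero_of_sum_mul (hA : finrank k A = 6) {u : Fin 3 → A}
    (hu : Submodule.span k (Set.range fun p : Fin 3 × Fin 3 => u p.1 * u p.2) = ⊤)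
    {c : Fin 3 → Fin 3 → k} (hc : ∑ l, ∑ i, c l i • (u l * u i) = 0) (l i : Fin 3) :
    (if l = i then c l i else c l i + c i l) = 0 := by
  by_cases hli : l = i
  · subst hli
    obtain ⟨γ, hγ⟩ := exists_linearMap_mul_eq (Q := k) hA hu
      (fun a b => if a = l then if b = l then 1 else 0 else 0)
      (fun a b => by split_ifs <;> rfl)
    have := congrArg γ hc
    simp only [map_sum, map_smul] at this
    simp only [hγ, map_zero] at this
    simpa using this
  · obtain ⟨γ, hγ⟩ := exists_linearMap_mul_eq (Q := k) hA hu
      (fun a b => (if a = l then if b = i then 1 else 0 else 0) +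
        if a = i then if b = l then 1 else 0 else 0)
      (fun a b => by rw [add_comm]; congr 1 <;> split_ifs <;> rfl)
    have := congrArg γ hc
    simp only [map_sum, map_smul] at this
    simp only [hγ, map_zero] at this
    simpa [hli, mul_add, Finset.sum_add_distrib] using this

/-- A relation among the `u l`, multiplied by a single `u i`, becomes a relation among products. -/
lemma linearIndependent_of_span_mul (hA : finrank k A = 6) {u : Fin 3 → A}
    (hu : Submodule.span k (Set.range fun p : Fin 3 × Fin 3 => u p.1 * u p.2) = ⊤) :
    LinearIndependent k u := by
  rw [Fintype.linearIndependent_iff]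
  intro c hc i
  have : ∑ l, ∑ j, (if j = i then c l else 0) • (u l * u j) = 0 := by
    calc _ = ∑ l, c l • (u l * u i) := by simp
      _ = (∑ l, c l • u l) * u i := by simp [Finset.sum_mul]
      _ = 0 := by rw [hc, zero_mul]
  simpa using add_swap_eq_zero_of_sum_mul hA hu (c := fun l j => if j = i then c l else 0) this i i

/-- The product of two nonzero elements of `U` is nonzero if `Sym² U → A` is injective. -/
lemma eq_zero_or_eq_zero_of_mul_eq_zero (hA : finrank k A = 6) {u : Fin 3 → A}
    (hu : Submodule.span k (Set.range fun p : Fin 3 × Fin 3 => u p.1 * u p.2) = ⊤)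
    {a b : Fin 3 → k} (h : (∑ i, a i • u i) * ∑ i, b i • u i = 0) : a = 0 ∨ b = 0 := by
  have h' : ∑ l, ∑ i, (a l * b i) • (u l * u i) = 0 := by
    rw [← h, Finset.sum_mul]
    refine Finset.sum_congr rfl fun l _ => ?_
    rw [Finset.mul_sum]
    refine Finset.sum_congr rfl fun i _ => ?_
    rw [smul_mul_smul_comm]
  have key := fun l i => add_swap_eq_zero_of_sum_mul hA hu h' l i
  by_contra! hab
  obtain ⟨i, hi⟩ := Function.ne_iff.mp hab.1
  obtain ⟨j, hj⟩ := Function.ne_iff.mp hab.2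
  simp only [Pi.zero_apply] at hi hj
  have h1 := key i i
  have h2 := key j j
  simp only [if_true, mul_eq_zero, hi, hj, false_or, or_false] at h1 h2
  have h3 := key i j
  rcases eq_or_ne i j with rfl | hij
  · exact hj h1
  · simp only [hij, if_false, h1, mul_zero, add_zero, h2, mul_eq_zero, hi, hj, or_self] at h3

/-- The bilinear form `(x, y) ↦ ψ (x y)`. -/
def mulForm (ψ : A →ₗ[k] k) : LinearMap.BilinForm k A := (LinearMap.mul k A).compr₂ ψ

lemma mulForm_apply (ψ : A →ₗ[k] k) (x y : A) : mulForm ψ x y = ψ (x * y) := rfl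

lemma mulForm_isRefl (ψ : A →ₗ[k] k) : (mulForm ψ).IsRefl := fun x y h => by
  rw [mulForm_apply, mul_comm]; exact h

lemma mulForm_nondegenerate {ψ : A →ₗ[k] k} (hψ : ∀ a, (∀ b, ψ (a * b) = 0) → a = 0) :
    (mulForm ψ).Nondegenerate :=
  (mulForm_isRefl ψ).nondegenerate_iff_separatingLeft.mpr hψ

/-- `w` is a basis of the orthogonal `W` of `U`. If `W` generated a proper ideal, its orthogonal
would be a nonzero ideal contained in `U`; multiplication by one of its nonzero elements e would map
`U` bijectively to itself, and then `A = U · U = eU · U` would lie in `U`. -/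
lemma exists_gale_dual (hA : finrank k A = 6) {ψ : A →ₗ[k] k}
    (hψ : ∀ a, (∀ b, ψ (a * b) = 0) → a = 0) {u : Fin 3 → A}
    (hu : Submodule.span k (Set.range fun p : Fin 3 × Fin 3 => u p.1 * u p.2) = ⊤) :
    ∃ w : Fin 3 → A, LinearIndependent k w ∧ (∀ i j, ψ (u i * w j) = 0) ∧
      ∃ d : Fin 3 → A, ∑ j, d j * w j = 1 := by
  have : FiniteDimensional k A := .of_finrank_pos (by omega)
  set U := Submodule.span k (Set.range u)
  have hU : finrank k U = 3 := by
    simpa using finrank_span_eq_card (linearIndependent_of_span_mul hA hu)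
  have hnd := mulForm_nondegenerate hψ
  set W := (mulForm ψ).orthogonal U
  have hW : finrank k W = 3 := by
    rw [LinearMap.BilinForm.finrank_orthogonal hnd, hA, hU]
  let bw := finBasisOfFinrankEq k W hW
  have hmemW : ∀ x, x ∈ W ↔ ∀ y ∈ U, ψ (y * x) = 0 := fun x => by
    rw [LinearMap.BilinForm.mem_orthogonal_iff]; rfl
  have hspanW : Submodule.span k (Set.range fun j => (bw j : A)) = W := by
    have := congrArg (Submodule.map W.subtype) bw.span_eq
    rw [Submodule.map_span, ← Set.range_comp, Submodule.map_top, Submodule.range_subtype] at this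
    exact this
  refine ⟨fun j => bw j, ?_, fun i j => ?_, ?_⟩
  · exact bw.linearIndependent.map' W.subtype (Submodule.ker_subtype W)
  · exact (hmemW _).mp (bw j).2 _ (Submodule.subset_span ⟨i, rfl⟩)
  set J : Ideal A := Ideal.span (Set.range fun j => (bw j : A))
  suffices hJ : J = ⊤ by
    have h1 : (1 : A) ∈ J := hJ ▸ Submodule.mem_top
    obtain ⟨d, hd⟩ := (Submodule.mem_span_range_iff_exists_fun A).mp h1
    exact ⟨d, hd⟩
  by_contra hJ
  have horth : finrank k ((mulForm ψ).orthogonal (J.restrictScalars k)) ≠ 0 := by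
    rw [LinearMap.BilinForm.finrank_orthogonal hnd]
    have : finrank k (J.restrictScalars k) < finrank k A := Submodule.finrank_lt (by
      intro h
      exact hJ ((Submodule.restrictScalars_eq_top_iff _ _ _).mp h))
    omega
  obtain ⟨e, he, he0⟩ := Submodule.exists_mem_ne_zero_of_ne_bot
    (p := (mulForm ψ).orthogonal (J.restrictScalars k))
    (fun h => horth (by rw [h]; exact finrank_bot k A))
  -- e annihilates `J` under the form, so all its multiples are orthogonal to `W`, and the double
  -- orthogonal of `U` is `U`.
  have heU : ∀ a, e * a ∈ U := by
    intro a
    rw [← LinearMap.BilinForm.orthogonal_orthogonal hnd (mulForm_isRefl ψ) U,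
      LinearMap.BilinForm.mem_orthogonal_iff]
    intro x hx
    change ψ (x * (e * a)) = 0
    have hx' : x * a ∈ J := by
      refine Ideal.mul_mem_right _ _ ?_
      have : x ∈ W := hx
      rw [← hspanW] at this
      exact Submodule.span_le_restrictScalars k A _ this
    have := (LinearMap.BilinForm.mem_orthogonal_iff.mp he) _ hx'
    change ψ (x * a * e) = 0 at this
    rwa [show x * (e * a) = x * a * e by ring]
  have hmem : ∀ x ∈ U, ∃ c : Fin 3 → k, ∑ i, c i • u i = x := fun x hx =>
    (Submodule.mem_span_range_iff_exists_fun k).mp hx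
  have heU' : e ∈ U := by simpa using heU 1
  let T : U →ₗ[k] U := (LinearMap.mulLeft k e).restrict (fun x _ => heU x)
  have hT : Function.Injective T := by
    rw [injective_iff_map_eq_zero]
    intro x hx
    obtain ⟨c, hc⟩ := hmem _ x.2
    obtain ⟨d, hd⟩ := hmem _ heU'
    have h0 : e * (x : A) = 0 := congrArg Subtype.val hx
    rw [← hc, ← hd] at h0
    rcases eq_zero_or_eq_zero_of_mul_eq_zero hA hu h0 with h | h
    · exact absurd (by rw [← hd, h]; simp) he0
    · exact Subtype.ext (by rw [← hc, h]; simp)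
  have hT' := LinearMap.injective_iff_surjective.mp hT
  have : (⊤ : Submodule k A) ≤ U := by
    rw [← hu, Submodule.span_le]
    rintro _ ⟨⟨i, j⟩, rfl⟩
    obtain ⟨y, hy⟩ := hT' ⟨u i, Submodule.subset_span ⟨i, rfl⟩⟩
    have hy' : e * (y : A) = u i := congrArg Subtype.val hy
    change u i * u j ∈ U
    rw [← hy', mul_assoc]
    exact heU _
  have := Submodule.finrank_mono this
  rw [finrank_top, hA, hU] at this
  omega

/-- By `ht`, each `t · · j` is alternating in its first two indices, so y = Σ t w is an alternating
3 × 3 matrix, that is a vector z. The relations `hrel` say that the cross product of u and z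
vanishes. As u generates the unit ideal, z = e u for some e; since ψ kills `U · W`, ψ(e · U · U) =
0, and nondegeneracy gives e = 0. -/
lemma koszul_injective (hA : finrank k A = 6) {ψ : A →ₗ[k] k}
    (hψ : ∀ a, (∀ b, ψ (a * b) = 0) → a = 0) {u w : Fin 3 → A}
    (hu : Submodule.span k (Set.range fun p : Fin 3 × Fin 3 => u p.1 * u p.2) = ⊤)
    (hw : LinearIndependent k w) (huw : ∀ i j, ψ (u i * w j) = 0)
    {t : Fin 3 → Fin 3 → Fin 3 → k} (hrel : ∀ l, ∑ i, ∑ j, t l i j • (u i * w j) = 0)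
    (ht : ∀ j, ∑ l, ∑ i, t l i j • (u l * u i) = 0) (l i j : Fin 3) : t l i j = 0 := by
  obtain ⟨c, hc⟩ : ∃ c : Fin 3 → A, ∑ i, c i * u i = 1 := by
    have h1 : (1 : A) ∈ Ideal.span (Set.range u) := by
      have h2 : (1 : A) ∈ Submodule.span k (Set.range fun p : Fin 3 × Fin 3 => u p.1 * u p.2) :=
        hu ▸ Submodule.mem_top
      have h3 : Submodule.span k (Set.range fun p : Fin 3 × Fin 3 => u p.1 * u p.2) ≤
          (Ideal.span (Set.range u)).restrictScalars k := by
        rw [Submodule.span_le]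
        rintro _ ⟨p, rfl⟩
        exact Ideal.mul_mem_right _ _ (Ideal.subset_span ⟨p.1, rfl⟩)
      exact h3 h2
    exact (Submodule.mem_span_range_iff_exists_fun A).mp h1
  have hdiag : ∀ l j, t l l j = 0 := fun l j => by
    simpa using add_swap_eq_zero_of_sum_mul hA hu (c := fun l i => t l i j) (ht j) l l
  have hanti : ∀ l i j, t l i j = -t i l j := by
    intro l i j
    have h1 := add_swap_eq_zero_of_sum_mul hA hu (c := fun l i => t l i j) (ht j) l i
    by_cases hli : l = i
    · subst hli; rw [hdiag, neg_zero]
    · rw [if_neg hli] at h1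
      exact eq_neg_of_add_eq_zero_left h1
  let y : Fin 3 → Fin 3 → A := fun l i => ∑ j, t l i j • w j
  have hy0 : ∀ l, y l l = 0 := fun l => by simp [y, hdiag]
  have hya : ∀ l i, y l i = -y i l := fun l i => by
    simp only [y, ← Finset.sum_neg_distrib, ← neg_smul, ← hanti l i]
  have hyr : ∀ l, u 0 * y l 0 + u 1 * y l 1 + u 2 * y l 2 = 0 := fun l => by
    rw [← hrel l, Fin.sum_univ_three]
    simp only [y, Finset.mul_sum, mul_smul_comm]
  -- The vector dual to the alternating matrix y.
  let z : Fin 3 → A := ![y 1 2, y 2 0, y 0 1]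
  have hz : ∀ i j, u i * z j = u j * z i := by
    have h01 : u 0 * z 1 = u 1 * z 0 := by
      change u 0 * y 2 0 = u 1 * y 1 2
      linear_combination hyr 2 - u 2 * hy0 2 - u 1 * hya 2 1
    have h02 : u 0 * z 2 = u 2 * z 0 := by
      change u 0 * y 0 1 = u 2 * y 1 2
      linear_combination -hyr 1 + u 1 * hy0 1 + u 0 * hya 0 1
    have h12 : u 1 * z 2 = u 2 * z 1 := by
      change u 1 * y 0 1 = u 2 * y 2 0
      linear_combination hyr 0 - u 0 * hy0 0 - u 2 * hya 0 2
    intro i j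
    fin_cases i <;> fin_cases j
    exacts [rfl, h01, h02, h01.symm, rfl, h12, h02.symm, h12.symm, rfl]
  -- Since Σ c_i u_i = 1, the proportionality of z and u has this element as factor.
  set e := ∑ i, c i * z i
  have hze : ∀ m, z m = u m * e := by
    intro m
    calc z m = (∑ i, c i * u i) * z m := by rw [hc, one_mul]
      _ = ∑ i, c i * (u i * z m) := by rw [Finset.sum_mul]; simp only [mul_assoc]
      _ = ∑ i, c i * (u m * z i) := by simp_rw [hz _ m]
      _ = u m * e := by rw [Finset.mul_sum]; exact Finset.sum_congr rfl fun i _ => by ring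
  have hψy : ∀ m l i, ψ (u m * y l i) = 0 := by
    intro m l i
    simp [y, Finset.mul_sum, huw]
  have hψz : ∀ l m, ψ (u l * z m) = 0 := by
    intro l m
    fin_cases m <;> exact hψy _ _ _
  have he : e = 0 := by
    refine hψ e fun b => ?_
    have hb : b ∈ Submodule.span k (Set.range fun p : Fin 3 × Fin 3 => u p.1 * u p.2) :=
      hu ▸ Submodule.mem_top
    induction hb using Submodule.span_induction with
    | mem x hx =>
      obtain ⟨p, rfl⟩ := hx
      have := hψz p.1 p.2
      rw [hze] at this
      rwa [show e * (u p.1 * u p.2) = u p.1 * (u p.2 * e) by ring]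
    | zero => simp
    | add x y _ _ hx hy => rw [mul_add, map_add, hx, hy, add_zero]
    | smul r x _ hx => rw [mul_smul_comm, map_smul, hx, smul_zero]
  have hz0 : ∀ m, z m = 0 := fun m => by rw [hze, he, mul_zero]
  have hwi := Fintype.linearIndependent_iff.mp hw
  have h12 : ∀ j, t 1 2 j = 0 := hwi _ (hz0 0)
  have h20 : ∀ j, t 2 0 j = 0 := hwi _ (hz0 1)
  have h01 : ∀ j, t 0 1 j = 0 := hwi _ (hz0 2)
  fin_cases l <;> fin_cases i
  exacts [hdiag 0 j, h01 j, (hanti 0 2 j).trans (by rw [h20 j, neg_zero]),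
    (hanti 1 0 j).trans (by rw [h01 j, neg_zero]), hdiag 1 j, h12 j, h20 j,
    (hanti 2 1 j).trans (by rw [h12 j, neg_zero]), hdiag 2 j]

variable {Q : Type*} [AddCommGroup Q] [Module k Q]

/-- The syzygies among the products `a * w j` are generated by the bilinear relations between
`u` and `w`. -/
lemma span_mul_gale_dual (hA : finrank k A = 6) {ψ : A →ₗ[k] k}
    (hψ : ∀ a, (∀ b, ψ (a * b) = 0) → a = 0) {u w : Fin 3 → A}
    (hu : Submodule.span k (Set.range fun p : Fin 3 × Fin 3 => u p.1 * u p.2) = ⊤)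
    (hw : LinearIndependent k w) (huw : ∀ i j, ψ (u i * w j) = 0)
    {d : Fin 3 → A} (hd : ∑ j, d j * w j = 1) :
    (∀ x, ψ x = 0 → ∃ t : Fin 3 → Fin 3 → k, x = ∑ i, ∑ j, t i j • (u i * w j)) ∧
    ∀ a : Fin 3 → A, ∑ j, a j * w j = 0 → ∃ t : Fin 3 → Fin 3 → Fin 3 → k,
      (∀ l, ∑ i, ∑ j, t l i j • (u i * w j) = 0) ∧ ∀ j, a j = ∑ l, ∑ i, t l i j • (u l * u i) := by
  have : FiniteDimensional k A := .of_finrank_pos (by omega)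
  let κ : (Fin 3 → Fin 3 → k) →ₗ[k] A :=
    { toFun := fun t => ∑ i, ∑ j, t i j • (u i * w j)
      map_add' := fun s t => by simp [add_smul, Finset.sum_add_distrib]
      map_smul' := fun c t => by simp [mul_smul, Finset.smul_sum] }
  have hκ : ∀ t, κ t = ∑ i, ∑ j, t i j • (u i * w j) := fun t => rfl
  let K := LinearMap.ker κ
  have hψ0 : ψ ≠ 0 := by
    rintro rfl
    have h1 : (1 : A) = 0 := hψ 1 (by simp)
    have : Subsingleton A := ⟨fun x y => by rw [← mul_one x, ← mul_one y, h1, mul_zero, mul_zero]⟩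
    rw [finrank_zero_of_subsingleton] at hA
    omega
  have hker : finrank k (LinearMap.ker ψ) = 5 := by
    have := Module.Dual.finrank_ker_add_one_of_ne_zero (f := ψ) hψ0
    omega
  have hrange : LinearMap.range κ ≤ LinearMap.ker ψ := by
    rintro _ ⟨t, rfl⟩
    simp [hκ, huw]
  have hrn : finrank k (LinearMap.range κ) + finrank k K = _ := κ.finrank_range_add_finrank_ker
  have hdim : finrank k (Fin 3 → Fin 3 → k) = 9 := by
    rw [finrank_pi_fintype]; simp
  have hr5 := Submodule.finrank_mono hrange
  let Φ : (Fin 3 → A) →ₗ[k] A :=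
    { toFun := fun a => ∑ j, a j * w j
      map_add' := fun s t => by simp [add_mul, Finset.sum_add_distrib]
      map_smul' := fun c t => by simp [Finset.smul_sum] }
  have hΦ : ∀ a, Φ a = ∑ j, a j * w j := fun a => rfl
  have hΦs : Function.Surjective Φ := fun x => ⟨fun j => x * d j, by
    rw [hΦ]; simp only [mul_assoc]; rw [← Finset.mul_sum, hd, mul_one]⟩
  have hΦk : finrank k (LinearMap.ker Φ) = 12 := by
    have h1 := Φ.finrank_range_add_finrank_ker
    rw [LinearMap.range_eq_top.mpr hΦs, finrank_top, hA, finrank_pi_fintype, hA] at h1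
    simp only [Finset.sum_const, Finset.card_univ, Fintype.card_fin, smul_eq_mul] at h1
    omega
  -- Multiplies a bilinear relation Σ t_ij u_i w_j = 0 by `u l`, giving a syzygy of w with
  -- coefficients in `U · U`.
  let Ψ : (Fin 3 → K) →ₗ[k] (Fin 3 → A) :=
    { toFun := fun t j => ∑ l, ∑ i, (t l : Fin 3 → Fin 3 → k) i j • (u l * u i)
      map_add' := fun s t => by ext j; simp [add_smul, Finset.sum_add_distrib]
      map_smul' := fun c t => by ext j; simp [mul_smul, Finset.smul_sum] }
  have hΨ : ∀ t j, Ψ t j = ∑ l, ∑ i, (t l : Fin 3 → Fin 3 → k) i j • (u l * u i) := fun t j => rfl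
  have hΨr : LinearMap.range Ψ ≤ LinearMap.ker Φ := by
    rintro _ ⟨t, rfl⟩
    rw [LinearMap.mem_ker, hΦ]
    have : ∀ l, ∑ i, ∑ j, (t l : Fin 3 → Fin 3 → k) i j • (u i * w j) = 0 := fun l => (t l).2
    calc ∑ j, Ψ t j * w j = ∑ l, u l * ∑ i, ∑ j, (t l : Fin 3 → Fin 3 → k) i j • (u i * w j) := by
          simp only [hΨ, Fin.sum_univ_three, Algebra.smul_def]
          ring
      _ = 0 := by simp [this]
  have hΨi : Function.Injective Ψ := by
    rw [injective_iff_map_eq_zero]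
    intro t ht
    ext l i j
    exact koszul_injective hA hψ hu hw huw (t := fun l => t l) (fun l => (t l).2) (congrFun ht) l i j
  have hdimK : finrank k (Fin 3 → K) = 3 * finrank k K := by
    rw [finrank_pi_fintype]; simp
  have hrΨ : finrank k (LinearMap.range Ψ) = 3 * finrank k K := by
    rw [LinearMap.finrank_range_of_inj hΨi, hdimK]
  have hle := Submodule.finrank_mono hΨr
  -- `κ` maps a space of dimension 9 into one of dimension 5, so dim K ≥ 4; `Ψ` embeds K³ in a space
  -- of dimension 12, so dim K ≤ 4. Both inclusions are therefore equalities.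
  have heq : LinearMap.range Ψ = LinearMap.ker Φ :=
    Submodule.eq_of_le_of_finrank_le hΨr (by omega)
  have heqκ : LinearMap.range κ = LinearMap.ker ψ :=
    Submodule.eq_of_le_of_finrank_le hrange (by omega)
  refine ⟨fun x hx => ?_, fun a ha => ?_⟩
  · have : x ∈ LinearMap.range κ := heqκ ▸ hx
    obtain ⟨t, ht⟩ := this
    exact ⟨t, ht.symm⟩
  · have : a ∈ LinearMap.range Ψ := heq ▸ ha
    obtain ⟨t, ht⟩ := this
    exact ⟨fun l => t l, fun l => (t l).2, fun j => (congrFun ht j).symm⟩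

/-- A symmetric bilinear map which vanishes on the `2 × 2` minors of `(u i * w j)` factors through
the multiplication of `A` on the kernel of `ψ`. -/
theorem exists_factor_mul_of_minors (hA : finrank k A = 6) {ψ : A →ₗ[k] k}
    (hψ : ∀ a, (∀ b, ψ (a * b) = 0) → a = 0) {u w : Fin 3 → A}
    (hu : Submodule.span k (Set.range fun p : Fin 3 × Fin 3 => u p.1 * u p.2) = ⊤)
    (hw : LinearIndependent k w) (huw : ∀ i j, ψ (u i * w j) = 0)
    {d : Fin 3 → A} (hd : ∑ j, d j * w j = 1) (β : A →ₗ[k] A →ₗ[k] Q)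
    (hs : ∀ i j i' j', β (u i * w j) (u i' * w j') = β (u i' * w j') (u i * w j))
    (hm : ∀ i j i' j', β (u i * w j) (u i' * w j') = β (u i' * w j) (u i * w j')) :
    ∃ φ : A →ₗ[k] Q, ∀ x y, ψ x = 0 → ψ y = 0 → β x y = φ (x * y) := by
  obtain ⟨hV, hsyz⟩ := span_mul_gale_dual hA hψ hu hw huw hd
  -- For fixed j and j' the values are symmetric in i and i' by the vanishing of the minors, so they
  -- define a linear map on `A = Sym²U`.
  have hγ : ∀ j j', ∃ γ : A →ₗ[k] Q, ∀ i i', γ (u i * u i') = β (u i * w j) (u i' * w j') :=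
    fun j j' => exists_linearMap_mul_eq hA hu _ (fun i i' => hm i j i' j')
  choose γ hγ using hγ
  have hext : ∀ f g : A →ₗ[k] Q, (∀ i i', f (u i * u i') = g (u i * u i')) → f = g := by
    intro f g h
    refine LinearMap.ext_on_range hu fun p => h p.1 p.2
  have hγs : ∀ j j', γ j j' = γ j' j := fun j j' => hext _ _ fun i i' => by
    rw [hγ, hγ, hs, hm]
  let Φ : (Fin 3 → A) →ₗ[k] A :=
    { toFun := fun a => ∑ j, a j * w j
      map_add' := fun s t => by simp [add_mul, Finset.sum_add_distrib]
      map_smul' := fun c t => by simp [Finset.smul_sum] }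
  have hΦ : ∀ a, Φ a = ∑ j, a j * w j := fun a => rfl
  -- A map on A³ killing the syzygies of w descends to A along `Φ`; a ↦ (a d_j) is a section of `Φ`.
  have hfac : ∀ G : Fin 3 → A →ₗ[k] Q,
      (∀ a : Fin 3 → A, ∑ j, a j * w j = 0 → ∑ j, G j (a j) = 0) →
      ∃ φ : A →ₗ[k] Q, ∀ j a, φ (a * w j) = G j a := by
    intro G hG
    let F : A →ₗ[k] (Fin 3 → A) := LinearMap.pi fun j => LinearMap.mulRight k (d j)
    refine ⟨(∑ j, (G j).comp (LinearMap.proj j)).comp F, fun j a => ?_⟩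
    have := hG (fun i => a * w j * d i - Pi.single (M := fun _ => A) j a i) (by
      simp only [sub_mul, Finset.sum_sub_distrib, mul_assoc]
      rw [← Finset.mul_sum, ← Finset.mul_sum, hd, mul_one, sub_eq_zero]
      simp [Pi.single_apply, ite_mul])
    simp only [map_sub, Finset.sum_sub_distrib, sub_eq_zero] at this
    have h2 : ∑ i, G i (Pi.single (M := fun _ => A) j a i) = G j a := by
      rw [Finset.sum_eq_single j]
      · simp
      · intro b _ hb; simp [hb]
      · simp
    rw [h2] at this
    simpa [F] using this
  -- Descent in the first index: by `hsyz` it is enough to test syzygies coming from bilinear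
  -- relations, where the sum is β applied to 0.
  have hφ' : ∀ j', ∃ φ : A →ₗ[k] Q, ∀ j a, φ (a * w j) = γ j j' a := by
    intro j'
    refine hfac (fun j => γ j j') fun a ha => ?_
    obtain ⟨t, ht, hta⟩ := hsyz a ha
    calc ∑ j, γ j j' (a j) = ∑ l, β (∑ i, ∑ j, t l i j • (u i * w j)) (u l * w j') := by
          simp only [hta, map_sum, map_smul, hγ, LinearMap.sum_apply, LinearMap.smul_apply]
          rw [Finset.sum_comm]
          refine Finset.sum_congr rfl fun l _ => ?_
          rw [Finset.sum_comm]
          refine Finset.sum_congr rfl fun i _ => Finset.sum_congr rfl fun j _ => ?_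
          rw [hm l j i j']
      _ = 0 := by simp [ht]
  choose φ' hφ' using hφ'
  -- Descent in the second index: insert 1 = Σ d_i w_i and exchange the two indices by the symmetry
  -- of γ.
  obtain ⟨φ, hφ⟩ := hfac φ' fun a ha => by
    have hsw : ∀ j i x, φ' j (x * w i) = φ' i (x * w j) := fun j i x => by
      rw [hφ', hφ', hγs]
    calc ∑ j, φ' j (a j) = ∑ j, φ' j (a j * ∑ i, d i * w i) := by simp [hd]
      _ = ∑ j, ∑ i, φ' j ((a j * d i) * w i) := by
          simp [Finset.mul_sum, mul_assoc]
      _ = ∑ j, ∑ i, φ' i (d i * (a j * w j)) := by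
          refine Finset.sum_congr rfl fun j _ => Finset.sum_congr rfl fun i _ => ?_
          rw [hsw]
          congr 1; ring
      _ = ∑ i, φ' i (d i * ∑ j, a j * w j) := by
          rw [Finset.sum_comm]; simp [Finset.mul_sum]
      _ = 0 := by simp [ha]
  refine ⟨φ, fun x y hx hy => ?_⟩
  obtain ⟨s, rfl⟩ := hV x hx
  obtain ⟨t, rfl⟩ := hV y hy
  simp only [map_sum, map_smul, LinearMap.sum_apply, LinearMap.smul_apply, Finset.sum_mul,
    Finset.mul_sum, smul_mul_smul_comm, mul_smul]
  have key : ∀ i j i' j', φ (u i * w j * (u i' * w j')) = β (u i * w j) (u i' * w j') := by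
    intro i j i' j'
    rw [show u i * w j * (u i' * w j') = (u i * u i' * w j) * w j' by ring, hφ, hφ', hγ]
  simp only [key, ← mul_smul, Finset.smul_sum, mul_comm (t _ _)]

end Gale

/-! ### Algebras with small tangent spaces are generated by one element. -/

section Curvilinear

open Module

variable {k A : Type*} [Field k] [IsAlgClosed k] [CommRing A] [Algebra k A]

lemma exists_sub_algebraMap_mem [FiniteDimensional k A] (M : Ideal A) [M.IsMaximal] (a : A) :
    ∃ c : k, a - algebraMap k A c ∈ M := by
  let := Ideal.Quotient.field M
  have hbij : Function.Bijective (algebraMap k (A ⧸ M)) :=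
    IsAlgClosed.algebraMap_bijective_of_isIntegral
  obtain ⟨c, hc⟩ := hbij.2 (Ideal.Quotient.mk M a)
  exact ⟨c, Ideal.Quotient.eq.mp hc.symm⟩

/-- Substitute the hypothesis into itself: each round raises the order of the error term by one. -/
lemma le_sup_pow_of_le_sup_sq {I M : Ideal A} (h : M ≤ I ⊔ M ^ 2) (n : ℕ) : M ≤ I ⊔ M ^ (n + 1) := by
  induction n with
  | zero => simp
  | succ n ih =>
    refine ih.trans (sup_le le_sup_left ?_)
    calc M ^ (n + 1) = M ^ n * M := pow_succ _ _
      _ ≤ M ^ n * (I ⊔ M ^ 2) := Ideal.mul_mono_right h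
      _ = M ^ n * I ⊔ M ^ (n + 2) := by rw [Ideal.mul_sup, ← pow_add]
      _ ≤ I ⊔ M ^ (n + 2) := sup_le_sup_right Ideal.mul_le_right _

lemma prod_le_sup_prod {ι : Type*} {I : Ideal A} (s : Finset ι) {M M' : ι → Ideal A}
    (h : ∀ i ∈ s, M i ≤ I ⊔ M' i) : ∏ i ∈ s, M i ≤ I ⊔ ∏ i ∈ s, M' i := by
  classical
  induction s using Finset.induction_on with
  | empty => simp
  | insert a s ha ih =>
    rw [Finset.prod_insert ha, Finset.prod_insert ha]
    refine (Ideal.mul_mono (h a (Finset.mem_insert_self _ _))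
      (ih fun i hi => h i (Finset.mem_insert_of_mem hi))).trans ?_
    rw [Ideal.sup_mul, Ideal.mul_sup (M' a)]
    exact sup_le (le_sup_of_le_left Ideal.mul_le_left)
      (sup_le_sup_right Ideal.mul_le_right _)

/-- A finite algebra all of whose tangent spaces have dimension at most one is generated by one
element. -/
theorem exists_adjoin_eq_top_of_curvilinear [FiniteDimensional k A]
    (h : ∀ M : Ideal A, M.IsMaximal → ∃ t, M = Ideal.span {t} ⊔ M ^ 2) :
    ∃ x : A, Algebra.adjoin k {x} = ⊤ := by
  classical
  have : IsArtinianRing A := IsArtinianRing.of_finite k A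
  cases nonempty_fintype (MaximalSpectrum A)
  have hcop : Pairwise (Function.onFun IsCoprime fun M : MaximalSpectrum A => M.asIdeal) :=
    fun M N hMN => Ideal.isCoprime_iff_sup_eq.mpr
      (Ideal.IsMaximal.coprime_of_ne M.2 N.2 fun h => hMN (MaximalSpectrum.ext h))
  obtain ⟨c⟩ : Nonempty (MaximalSpectrum A ↪ k) :=
    have : Infinite k := IsAlgClosed.instInfinite
    ⟨(Fintype.equivFin _).toEmbedding.trans (Fin.valEmbedding.trans (Infinite.natEmbedding k))⟩
  choose t ht using fun M : MaximalSpectrum A => h M.asIdeal M.2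
  -- By the Chinese remainder theorem x takes distinct values `c M` at the points and has
  -- first-order part `t M` at each, so it separates both points and tangent vectors.
  obtain ⟨x, hx⟩ := Ideal.exists_forall_sub_mem_ideal (I := fun M : MaximalSpectrum A => M.asIdeal ^ 2)
    (fun M N hMN => (hcop hMN).pow) (fun M => algebraMap k A (c M) + t M)
  have htM : ∀ M, t M ∈ M.asIdeal := fun M => by
    have : Ideal.span {t M} ≤ M.asIdeal := le_sup_left.trans (ht M).ge
    exact this (Ideal.mem_span_singleton_self _)
  have hxM : ∀ M : MaximalSpectrum A, x - algebraMap k A (c M) ∈ M.asIdeal := fun M => by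
    have := add_mem (Ideal.pow_le_self two_ne_zero (hx M)) (htM M)
    convert this using 1
    ring
  -- y vanishes at every point, and at each M its other factors are units, so it generates M modulo
  -- M².
  set y := ∏ M, (x - algebraMap k A (c M)) with hy
  have hMy : ∀ M : MaximalSpectrum A, M.asIdeal ≤ Ideal.span {y} ⊔ M.asIdeal ^ 2 := by
    intro M
    set I := Ideal.span {y} ⊔ M.asIdeal ^ 2
    have hM2 : M.asIdeal ^ 2 ≤ I := le_sup_right
    set g := ∏ N ∈ Finset.univ.erase M, (x - algebraMap k A (c N))
    have hyg : y = (x - algebraMap k A (c M)) * g :=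
      (Finset.mul_prod_erase _ _ (Finset.mem_univ M)).symm
    have hg : g ∉ M.asIdeal := by
      intro hg
      obtain ⟨N, hN, hNM⟩ := (Ideal.IsPrime.prod_mem_iff (hp := M.2.isPrime)).mp hg
      have h1 := sub_mem (hxM M) hNM
      rw [sub_sub_sub_cancel_left, ← map_sub] at h1
      have h2 : c N - c M ≠ 0 := sub_ne_zero.mpr fun h => (Finset.ne_of_mem_erase hN) (c.injective h)
      exact M.2.ne_top (Ideal.eq_top_of_isUnit_mem _ h1 ((isUnit_iff_ne_zero.mpr h2).map _))
    obtain ⟨v, μ, hμ, hv⟩ := M.2.exists_inv hg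
    have h1 : x - algebraMap k A (c M) ∈ I := by
      have : x - algebraMap k A (c M) = v * y + (x - algebraMap k A (c M)) * μ := by
        rw [hyg]; linear_combination -(x - algebraMap k A (c M)) * hv
      rw [this]
      refine add_mem (Ideal.mul_mem_left _ _ (Ideal.mem_sup_left (Ideal.mem_span_singleton_self _)))
        (hM2 ?_)
      rw [pow_two]
      exact Ideal.mul_mem_mul (hxM M) hμ
    refine (ht M).le.trans (sup_le ?_ hM2)
    rw [Ideal.span_singleton_le_iff_mem]
    have := sub_mem h1 (hM2 (hx M))
    convert this using 1
    ring
  have hJnil : IsNilpotent (∏ M : MaximalSpectrum A, M.asIdeal) := by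
    obtain ⟨n, hn⟩ := IsArtinianRing.isNilpotent_jacobson_bot (R := A)
    refine ⟨n, le_bot_iff.mp ?_⟩
    rw [Ideal.zero_eq_bot] at hn
    rw [← hn]
    refine Ideal.pow_right_mono ?_ n
    rw [Ideal.jacobson]
    refine le_sInf fun M hM => ?_
    exact (Ideal.prod_le_inf.trans (Finset.inf_le (Finset.mem_univ (⟨M, hM.2⟩ : MaximalSpectrum A))))
  -- Taking the exponent past the nilpotency index of the product of the maximal ideals removes the
  -- error term.
  have hprod : ∏ M : MaximalSpectrum A, M.asIdeal ≤ Ideal.span {y} := by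
    obtain ⟨n, hn⟩ := hJnil
    have := prod_le_sup_prod Finset.univ fun M _ => le_sup_pow_of_le_sup_sq (hMy M) n
    rwa [Finset.prod_pow, pow_succ, hn, zero_mul, Ideal.zero_eq_bot, sup_bot_eq] at this
  set S := Algebra.adjoin k {x}
  have hxS : x ∈ S := Algebra.self_mem_adjoin_singleton k x
  have hyS : y ∈ S := Subalgebra.prod_mem _ fun M _ => sub_mem hxS (S.algebraMap_mem _)
  have hstep : ∀ a : A, ∃ s ∈ S, a - s ∈ Ideal.span {y} := by
    intro a
    choose r hr using fun M : MaximalSpectrum A => exists_sub_algebraMap_mem (k := k) M.asIdeal a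
    -- A polynomial in x with the same value as a at every point; the difference lies in all maximal
    -- ideals, hence in (y).
    set p := Lagrange.interpolate Finset.univ c r
    refine ⟨Polynomial.aeval x p, Polynomial.aeval_mem_adjoin_singleton k x, hprod ?_⟩
    rw [Ideal.prod_eq_iInf_of_pairwise_isCoprime (fun M _ N _ h => hcop h)]
    simp only [Finset.mem_univ, iInf_true, Ideal.mem_iInf]
    intro M
    have h1 : Polynomial.aeval x p - algebraMap k A (r M) ∈ M.asIdeal := by
      have h2 : p.eval (c M) = r M :=
        Lagrange.eval_interpolate_at_node _ c.injective.injOn (Finset.mem_univ M)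
      have h3 : (Polynomial.X - Polynomial.C (c M)) ∣ p - Polynomial.C (r M) := by
        rw [Polynomial.dvd_iff_isRoot]; simp [h2]
      obtain ⟨q, hq⟩ := h3
      have h4 := congrArg (Polynomial.aeval x) hq
      simp only [map_sub, map_mul, Polynomial.aeval_X, Polynomial.aeval_C] at h4
      rw [h4]
      exact Ideal.mul_mem_right _ _ (hxM M)
    have := sub_mem (hr M) h1
    convert this using 1
    ring
  -- Successive approximation in powers of y, which ends because y is nilpotent.
  have hiter : ∀ (n : ℕ) (a : A), ∃ s ∈ S, a - s ∈ Ideal.span {y ^ n} := by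
    intro n
    induction n with
    | zero => exact fun a => ⟨0, S.zero_mem, by simp⟩
    | succ n ih =>
      intro a
      obtain ⟨s, hs, has⟩ := ih a
      obtain ⟨b, hb⟩ := Ideal.mem_span_singleton'.mp has
      obtain ⟨s', hs', hbs⟩ := hstep b
      obtain ⟨e, he⟩ := Ideal.mem_span_singleton'.mp hbs
      refine ⟨s + s' * y ^ n, add_mem hs (mul_mem hs' (pow_mem hyS n)), ?_⟩
      rw [Ideal.mem_span_singleton']
      refine ⟨e, ?_⟩
      rw [pow_succ']
      linear_combination hb + y ^ n * he
  have hynil : IsNilpotent y := by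
    have h1 : y ∈ (⊥ : Ideal A).jacobson := by
      rw [Ideal.jacobson, Submodule.mem_sInf]
      intro M hM
      exact Ideal.mem_of_dvd _ (Finset.dvd_prod_of_mem _ (Finset.mem_univ (⟨M, hM.2⟩ : MaximalSpectrum A)))
        (hxM ⟨M, hM.2⟩)
    obtain ⟨n, hn⟩ := IsArtinianRing.isNilpotent_jacobson_bot (R := A)
    refine ⟨n, ?_⟩
    have := Ideal.pow_mem_pow h1 n
    rwa [hn] at this
  obtain ⟨n, hn⟩ := hynil
  refine ⟨x, Algebra.eq_top_iff.mpr fun a => ?_⟩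
  obtain ⟨s, hs, has⟩ := hiter n a
  rw [hn, Ideal.span_singleton_eq_bot.mpr rfl, Ideal.mem_bot, sub_eq_zero] at has
  exact has ▸ hs

/-- In characteristic prime to six, a monogenic algebra of dimension six has a three dimensional
subspace `U` with `U² = A`. -/
theorem exists_span_mul_eq_top_of_adjoin {k A : Type*} [Field k] [CommRing A] [Algebra k A]
    (h6 : (6 : k) ≠ 0) (hA : finrank k A = 6) {x : A} (hx : Algebra.adjoin k {x} = ⊤) :
    ∃ u : Fin 3 → A,
      Submodule.span k (Set.range fun p : Fin 3 × Fin 3 => u p.1 * u p.2) = ⊤ := by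
  have : FiniteDimensional k A := .of_finrank_pos (by omega)
  have hint : IsIntegral k x := Algebra.IsIntegral.isIntegral x
  let pb := Algebra.adjoin.powerBasis hint
  let pb' := pb.map ((Subalgebra.equivOfEq _ _ hx).trans Subalgebra.topEquiv)
  have hgen : pb'.gen = x := by simp [pb', pb]
  have hdim : pb'.dim = 6 := by rw [← pb'.finrank, hA]
  have hspan : ⊤ ≤ Submodule.span k (Set.range fun i : Fin 6 => x ^ (i : ℕ)) := by
    rw [← pb'.basis.span_eq, Submodule.span_le]
    rintro _ ⟨i, rfl⟩
    rw [pb'.basis_eq_pow, hgen]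
    exact Submodule.subset_span ⟨⟨i, hdim ▸ i.2⟩, rfl⟩
  obtain ⟨c, hc⟩ := (Submodule.mem_span_range_iff_exists_fun k).mp (hspan (Submodule.mem_top (x := x ^ 6)))
  replace hc : c 0 • 1 + c 1 • x + c 2 • x ^ 2 + c 3 • x ^ 3 + c 4 • x ^ 4 + c 5 • x ^ 5 = x ^ 6 := by
    rw [← hc, Fin.sum_univ_six]
    simp
  -- U = ⟨1, s, s³⟩ has products 1, s, s², s³, s⁴, s⁶; only the fifth power is missing, and it must
  -- be recovered from s⁶.
  have main : ∀ s : A, (∀ P : Submodule k A, 1 ∈ P → s ∈ P → s ^ 2 ∈ P → s ^ 3 ∈ P → s ^ 4 ∈ P →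
      s ^ 6 ∈ P → P = ⊤) → ∃ u : Fin 3 → A,
      Submodule.span k (Set.range fun p : Fin 3 × Fin 3 => u p.1 * u p.2) = ⊤ := by
    intro s hP
    refine ⟨![1, s, s ^ 3], hP _ ?_ ?_ ?_ ?_ ?_ ?_⟩
    · exact Submodule.subset_span ⟨(0, 0), by simp⟩
    · exact Submodule.subset_span ⟨(0, 1), by simp⟩
    · exact Submodule.subset_span ⟨(1, 1), by simp [pow_two]⟩
    · exact Submodule.subset_span ⟨(0, 2), by simp⟩
    · exact Submodule.subset_span ⟨(1, 2), by simp; ring⟩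
    · exact Submodule.subset_span ⟨(2, 2), by simp; ring⟩
  have htop : ∀ P : Submodule k A, 1 ∈ P → x ∈ P → x ^ 2 ∈ P → x ^ 3 ∈ P → x ^ 4 ∈ P →
      x ^ 5 ∈ P → P = ⊤ := by
    intro P h0 h1 h2 h3 h4 h5
    refine top_le_iff.mp (hspan.trans (Submodule.span_le.mpr ?_))
    rintro _ ⟨i, rfl⟩
    fin_cases i
    exacts [by simpa using h0, by simpa using h1, h2, h3, h4, h5]
  -- If x⁶ has no x⁵ term, replace x by x + 1: then (x + 1)⁶ contributes 6x⁵, and 6 is invertible.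
  by_cases h5 : c 5 = 0
  · refine main (x + 1) fun P h0 h1 h2 h3 h4 h6' => ?_
    have g1 : x ∈ P := by have := sub_mem h1 h0; simpa using this
    have g2 : x ^ 2 ∈ P := by
      have : x ^ 2 = (x + 1) ^ 2 - (2 : k) • x - 1 := by
        rw [ofNat_smul_eq_nsmul, nsmul_eq_mul]; push_cast; ring
      rw [this]; exact sub_mem (sub_mem h2 (P.smul_mem _ g1)) h0
    have g3 : x ^ 3 ∈ P := by
      have : x ^ 3 = (x + 1) ^ 3 - (3 : k) • x ^ 2 - (3 : k) • x - 1 := by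
        simp only [ofNat_smul_eq_nsmul, nsmul_eq_mul]; push_cast; ring
      rw [this]; exact sub_mem (sub_mem (sub_mem h3 (P.smul_mem _ g2)) (P.smul_mem _ g1)) h0
    have g4 : x ^ 4 ∈ P := by
      have : x ^ 4 = (x + 1) ^ 4 - (4 : k) • x ^ 3 - (6 : k) • x ^ 2 - (4 : k) • x - 1 := by
        simp only [ofNat_smul_eq_nsmul, nsmul_eq_mul]; push_cast; ring
      rw [this]
      exact sub_mem (sub_mem (sub_mem (sub_mem h4 (P.smul_mem _ g3)) (P.smul_mem _ g2))
        (P.smul_mem _ g1)) h0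
    have g6 : x ^ 6 ∈ P := by
      rw [← hc, h5]
      simp only [zero_smul, add_zero]
      exact add_mem (add_mem (add_mem (add_mem (P.smul_mem _ h0) (P.smul_mem _ g1))
        (P.smul_mem _ g2)) (P.smul_mem _ g3)) (P.smul_mem _ g4)
    refine htop P h0 g1 g2 g3 g4 ?_
    have : x ^ 5 = (6 : k)⁻¹ • ((x + 1) ^ 6 - x ^ 6 - (15 : k) • x ^ 4 - (20 : k) • x ^ 3 -
        (15 : k) • x ^ 2 - (6 : k) • x - 1) := by
      rw [eq_inv_smul_iff₀ h6]
      simp only [ofNat_smul_eq_nsmul, nsmul_eq_mul]; push_cast; ring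
    rw [this]
    exact P.smul_mem _ (sub_mem (sub_mem (sub_mem (sub_mem (sub_mem (sub_mem h6' g6)
      (P.smul_mem _ g4)) (P.smul_mem _ g3)) (P.smul_mem _ g2)) (P.smul_mem _ g1)) h0)
  · refine main x fun P h0 h1 h2 h3 h4 h6' => ?_
    refine htop P h0 h1 h2 h3 h4 ?_
    have : x ^ 5 = (c 5)⁻¹ • (x ^ 6 - c 0 • 1 - c 1 • x - c 2 • x ^ 2 - c 3 • x ^ 3 - c 4 • x ^ 4) := by
      rw [eq_inv_smul_iff₀ h5, ← hc]
      abel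
    rw [this]
    exact P.smul_mem _ (sub_mem (sub_mem (sub_mem (sub_mem (sub_mem h6' (P.smul_mem _ h0))
      (P.smul_mem _ h1)) (P.smul_mem _ h2)) (P.smul_mem _ h3)) (P.smul_mem _ h4))

end Curvilinear

/-! ### Stretched local algebras, where m² is principal modulo m³. -/

section Stretched

open Module IsLocalRing

/-- `B` has a basis `1, a, …, a ^ s, b 0, …, b (n - 1)` with the multiplication table of
`A_{n + 1, n + 1 + s}`. -/
structure IsStretched (k : Type*) {B : Type*} [Field k] [CommRing B] [Algebra k B] (n s : ℕ)
    (a : B) (b : Fin n → B) : Prop where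
  mul_left : ∀ i, a * b i = 0
  mul_mul : ∀ i j, b i * b j = if i = j then a ^ s else 0
  pow_eq_zero : a ^ (s + 1) = 0
  span_eq_top : Submodule.span k (Set.range (fun i : Fin (s + 1) => a ^ (i : ℕ)) ∪ Set.range b) = ⊤
  finrank_eq : finrank k B = s + 1 + n
  two_le : 2 ≤ s

variable {k B : Type*} [Field k] [CommRing B] [Algebra k B] [IsLocalRing B]

section Socle

variable [IsAlgClosed k] [FiniteDimensional k B] {ψ : B →ₗ[k] k}
  (hψ : ∀ a, (∀ b, ψ (a * b) = 0) → a = 0)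

include hψ

/-- The residue field is k, so the ideal generated by a socle element s is the line k s;
nondegeneracy forbids ψ to vanish on it. -/
lemma apply_ne_zero_of_socle {s : B} (hs : ∀ r ∈ maximalIdeal B, r * s = 0) (hs0 : s ≠ 0) :
    ψ s ≠ 0 := by
  intro h
  refine hs0 (hψ s fun b => ?_)
  obtain ⟨c, hc⟩ := exists_sub_algebraMap_mem (k := k) (maximalIdeal B) b
  have : s * b = c • s := by
    rw [Algebra.smul_def]
    linear_combination hs _ hc
  rw [this, map_smul, h, smul_zero]

/-- ψ is injective on the socle, which therefore has dimension at most one. -/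
lemma eq_smul_of_socle {s t : B} (hs : ∀ r ∈ maximalIdeal B, r * s = 0) (hs0 : s ≠ 0)
    (ht : ∀ r ∈ maximalIdeal B, r * t = 0) : t = (ψ t / ψ s) • s := by
  have h := apply_ne_zero_of_socle hψ hs hs0
  rw [← sub_eq_zero]
  by_contra hne
  refine apply_ne_zero_of_socle hψ (s := t - (ψ t / ψ s) • s) (fun r hr => ?_) hne ?_
  · rw [mul_sub, mul_smul_comm, hs r hr, ht r hr, smul_zero, sub_zero]
  · rw [map_sub, map_smul, smul_eq_mul, div_mul_cancel₀ _ h, sub_self]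

end Socle

lemma exists_maximalIdeal_pow_eq_bot (k : Type*) {B : Type*} [Field k] [CommRing B] [Algebra k B]
    [IsLocalRing B] [FiniteDimensional k B] : ∃ N, maximalIdeal B ^ N = ⊥ := by
  have : IsArtinianRing B := IsArtinianRing.of_finite k B
  obtain ⟨n, hn⟩ := IsArtinianRing.isNilpotent_jacobson_bot (R := B)
  exact ⟨n, by rwa [jacobson_eq_maximalIdeal _ bot_ne_top] at hn⟩

lemma pow_eq_bot_of_le_succ [IsNoetherianRing B] {n : ℕ}
    (h : maximalIdeal B ^ n ≤ maximalIdeal B ^ (n + 1)) : maximalIdeal B ^ n = ⊥ := by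
  refine Submodule.eq_bot_of_le_smul_of_le_jacobson_bot (maximalIdeal B) _
    (IsNoetherian.noetherian _) ?_ (maximalIdeal_le_jacobson _)
  rw [smul_eq_mul, ← pow_succ']
  exact h

/-- Reduction of a multiplication by an element with square generating `m²`. -/
lemma exists_sq_eq_span [IsAlgClosed k] (h2 : (2 : k) ≠ 0) [FiniteDimensional k B]
    (h0 : maximalIdeal B ^ 2 ≠ ⊥)
    {z : B} (hz : maximalIdeal B ^ 2 = Ideal.span {z} ⊔ maximalIdeal B ^ 3) :
    ∃ a ∈ maximalIdeal B, a ^ 2 ≠ 0 ∧ maximalIdeal B ^ 2 = Ideal.span {a ^ 2} := by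
  have : IsNoetherianRing B := IsNoetherianRing.of_finite k B
  set m := maximalIdeal B
  -- Polarization: if all squares of elements of m lay in m³, so would 2xy, hence m² = m³ and m² =
  -- 0.
  obtain ⟨a, ha, ha2⟩ : ∃ a ∈ m, a ^ 2 ∉ m ^ 3 := by
    by_contra! hcon
    refine h0 (pow_eq_bot_of_le_succ ?_)
    rw [pow_two, Ideal.mul_le]
    intro x hx y hy
    have h1 := sub_mem (sub_mem (hcon _ (add_mem hx hy)) (hcon x hx)) (hcon y hy)
    have h3 : x * y = algebraMap k B 2⁻¹ * ((x + y) ^ 2 - x ^ 2 - y ^ 2) := by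
      have : algebraMap k B 2⁻¹ * 2 = 1 := by
        rw [← map_ofNat (algebraMap k B) 2, ← map_mul, inv_mul_cancel₀ h2, map_one]
      linear_combination -(x * y) * this
    rw [h3]
    exact Ideal.mul_mem_left _ _ h1
  have ham : a ^ 2 ∈ m ^ 2 := Ideal.pow_mem_pow ha 2
  refine ⟨a, ha, fun h => ha2 (h ▸ zero_mem _), le_antisymm ?_
    ((Ideal.span_singleton_le_iff_mem _).mpr ham)⟩
  have hle : m ^ 2 ≤ Ideal.span {a ^ 2} ⊔ m • m ^ 2 := by
    rw [smul_eq_mul, ← pow_succ']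
    refine hz.le.trans (sup_le ?_ le_sup_right)
    rw [Ideal.span_singleton_le_iff_mem]
    rw [hz] at ham
    obtain ⟨y, hy, w, hw, hyw⟩ := Submodule.mem_sup.mp ham
    obtain ⟨r, rfl⟩ := Ideal.mem_span_singleton'.mp hy
    have hzm : z ∈ m ^ 2 := hz ▸ Ideal.mem_sup_left (Ideal.mem_span_singleton_self z)
    have hr : IsUnit r := by
      by_contra hr
      refine ha2 (hyw ▸ add_mem ?_ hw)
      rw [pow_succ']
      exact Ideal.mul_mem_mul ((mem_maximalIdeal r).mpr hr) hzm
    obtain ⟨r, rfl⟩ := hr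
    have : z = (r⁻¹ : Bˣ) * a ^ 2 - (r⁻¹ : Bˣ) * w := by
      rw [← hyw, mul_add, add_sub_cancel_right, ← mul_assoc, Units.inv_mul, one_mul]
    rw [this]
    exact sub_mem (Ideal.mem_sup_left (Ideal.mul_mem_left _ _ (Ideal.mem_span_singleton_self _)))
      (Ideal.mem_sup_right (Ideal.mul_mem_left _ _ hw))
  exact Submodule.le_of_le_smul_of_le_jacobson_bot (IsNoetherian.noetherian _)
    (maximalIdeal_le_jacobson _) hle

/-- Choose a with m² = (a²). Each y in m splits as ac + b with ab = 0. The last nonzero power a^s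
spans the socle. On the elements b of m with ab = 0 and ψ(b) = 0, products land in the socle and
ψ(bb') is a nondegenerate symmetric form; over an algebraically closed field of characteristic not 2
it has an orthogonal basis, scaled so that every square is a^s. -/
theorem exists_isStretched [IsAlgClosed k] (h2 : (2 : k) ≠ 0) [FiniteDimensional k B]
    {ψ : B →ₗ[k] k} (hψ : ∀ a, (∀ b, ψ (a * b) = 0) → a = 0)
    (h0 : maximalIdeal B ^ 2 ≠ ⊥)
    {z : B} (hz : maximalIdeal B ^ 2 = Ideal.span {z} ⊔ maximalIdeal B ^ 3) :
    ∃ (n s : ℕ) (a : B) (b : Fin n → B), IsStretched k n s a b ∧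
      (n = 0 → maximalIdeal B = Ideal.span {a}) := by
  obtain ⟨a, ham, ha0, ha⟩ := exists_sq_eq_span h2 h0 hz
  set m := maximalIdeal B
  have hnil : ∃ n, a ^ (n + 1) = 0 := by
    obtain ⟨N, hN⟩ := exists_maximalIdeal_pow_eq_bot k (B := B)
    have h1 := Ideal.pow_mem_pow ham N
    rw [hN, Ideal.mem_bot] at h1
    exact ⟨N, by rw [pow_succ, h1, zero_mul]⟩
  obtain ⟨s, hs1, hsmin⟩ : ∃ s, a ^ (s + 1) = 0 ∧ a ^ s ≠ 0 := by
    classical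
    refine ⟨Nat.find hnil, Nat.find_spec hnil, fun h => ?_⟩
    rcases Nat.eq_zero_or_pos (Nat.find hnil) with h' | h'
    · rw [h', pow_zero] at h
      exact one_ne_zero h
    · refine Nat.find_min hnil (m := Nat.find hnil - 1) (by omega) ?_
      rwa [Nat.sub_add_cancel h']
  have hs2 : 2 ≤ s := by
    by_contra! hs
    apply ha0
    rw [show 2 = s + 1 + (1 - s) by omega, pow_add, hs1, zero_mul]
  have hdec : ∀ y ∈ m, ∃ c b, y = a * c + b ∧ b ∈ m ∧ a * b = 0 := by
    intro y hy
    have h1 : a * y ∈ m ^ 2 := by rw [pow_two]; exact Ideal.mul_mem_mul ham hy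
    rw [ha] at h1
    obtain ⟨c, hc⟩ := Ideal.mem_span_singleton'.mp h1
    refine ⟨c, y - a * c, by ring, sub_mem hy (Ideal.mul_mem_right _ _ ham), ?_⟩
    linear_combination -hc
  have hsoc : ∀ y ∈ m, y * a ^ s = 0 := by
    intro y hy
    obtain ⟨c, b, rfl, -, hb⟩ := hdec y hy
    obtain ⟨t, rfl⟩ : ∃ t, s = t + 1 := ⟨s - 1, by omega⟩
    linear_combination c * hs1 + a ^ t * hb
  have hψs := apply_ne_zero_of_socle hψ hsoc hsmin
  have hasm : a ^ s ∈ m := Ideal.pow_mem_of_mem _ ham _ (by omega)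
  let N : Submodule k B := m.restrictScalars k ⊓ LinearMap.ker (LinearMap.mulLeft k a) ⊓
    LinearMap.ker ψ
  have hN : ∀ b, b ∈ N ↔ (b ∈ m ∧ a * b = 0) ∧ ψ b = 0 := fun b => Iff.rfl
  -- A multiple of a^s is split off from b to achieve ψ(b) = 0, which is possible since ψ(a^s) ≠ 0.
  have hdec' : ∀ y ∈ m, ∃ c, ∃ b ∈ N, ∃ t : k, y = a * c + b + t • a ^ s := by
    intro y hy
    obtain ⟨c, b, rfl, hbm, hb⟩ := hdec y hy
    refine ⟨c, b - (ψ b / ψ (a ^ s)) • a ^ s, (hN _).mpr ⟨⟨sub_mem hbm ?_, ?_⟩, ?_⟩,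
      ψ b / ψ (a ^ s), by ring⟩
    · rw [Algebra.smul_def]; exact Ideal.mul_mem_left _ _ hasm
    · rw [mul_sub, hb, mul_smul_comm, ← pow_succ', hs1, smul_zero, sub_zero]
    · rw [map_sub, map_smul, smul_eq_mul, div_mul_cancel₀ _ hψs, sub_self]
  have hmul : ∀ b ∈ N, ∀ b' ∈ N, b * b' = (ψ (b * b') / ψ (a ^ s)) • a ^ s := by
    intro b hb b' hb'
    refine eq_smul_of_socle hψ hsoc hsmin fun y hy => ?_
    obtain ⟨c, b'', rfl, -, hb''⟩ := hdec y hy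
    have h1 : b * b' ∈ m ^ 2 := by rw [pow_two]; exact Ideal.mul_mem_mul hb.1.1 hb'.1.1
    rw [ha] at h1
    obtain ⟨e, he⟩ := Ideal.mem_span_singleton'.mp h1
    have hab : a * b = 0 := hb.1.2
    linear_combination c * b' * hab - b'' * he + e * a * hb''
  let β : LinearMap.BilinForm k N := (mulForm ψ).restrict N
  have hβ : ∀ x y : N, β x y = ψ (x * y) := fun x y => rfl
  have hβs : β.IsSymm := ⟨fun x y => by rw [hβ, hβ, mul_comm]⟩
  -- An element of the radical is killed by a, by N and by a^s, hence by m; a socle element on which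
  -- ψ vanishes is zero.
  have hβn : ∀ x : N, (∀ y, β x y = 0) → x = 0 := by
    intro x hx
    have hax : a * (x : B) = 0 := x.2.1.2
    have hsx : ∀ y ∈ m, y * (x : B) = 0 := by
      intro y hy
      obtain ⟨c, b, hb, t, rfl⟩ := hdec' y hy
      have h1 := hmul b hb x x.2
      have h3 : ψ (b * x) = 0 := by rw [mul_comm]; exact hx ⟨b, hb⟩
      rw [h3, zero_div, zero_smul] at h1
      obtain ⟨t', rfl⟩ : ∃ t', s = t' + 1 := ⟨s - 1, by omega⟩
      rw [Algebra.smul_def]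
      linear_combination c * hax + h1 + algebraMap k B t * a ^ t' * hax
    by_contra hx0
    exact apply_ne_zero_of_socle hψ hsx (fun h => hx0 (Subtype.ext h)) x.2.2
  have : Invertible (2 : k) := invertibleOfNonzero h2
  obtain ⟨v, hv⟩ := LinearMap.BilinForm.exists_orthogonal_basis
    (LinearMap.BilinForm.isSymm_iff.mp hβs)
  have hvv : ∀ i, ψ (v i * v i) ≠ 0 := by
    intro i h
    refine v.ne_zero i (hβn _ fun y => ?_)
    rw [← v.sum_repr y, map_sum]
    refine Finset.sum_eq_zero fun j _ => ?_
    rw [map_smul]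
    by_cases hij : i = j
    · subst hij; rw [hβ, h, smul_zero]
    · rw [show β (v i) (v j) = 0 from hv hij, smul_zero]
  -- Square roots normalizing the squares of the orthogonal basis to a^s.
  have hr : ∀ i, ∃ r : k, ψ (a ^ s) / ψ (v i * v i) = r * r := fun i => IsAlgClosed.exists_eq_mul_self _
  choose r hr using hr
  have hr0 : ∀ i, r i ≠ 0 := fun i h => by
    have := hr i
    rw [h, zero_mul, div_eq_zero_iff] at this
    exact this.elim hψs (hvv i)
  set b : Fin (finrank k N) → B := fun i => r i • (v i : B) with hb
  have hbN : ∀ i, b i ∈ N := fun i => N.smul_mem _ (v i).2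
  have hab : ∀ i, a * b i = 0 := fun i => (hbN i).1.2
  have hNspan : N ≤ Submodule.span k (Set.range b) := by
    intro y hy
    have := congrArg Subtype.val (v.sum_repr ⟨y, hy⟩)
    rw [← show _ = y from this, AddSubmonoidClass.coe_finsetSum]
    refine Submodule.sum_mem _ fun i _ => ?_
    have h1 : ((v.repr ⟨y, hy⟩ i • v i : N) : B) = (v.repr ⟨y, hy⟩ i * (r i)⁻¹) • b i := by
      rw [hb, smul_smul, mul_assoc, inv_mul_cancel₀ (hr0 i), mul_one]; rfl
    rw [h1]
    exact Submodule.smul_mem _ _ (Submodule.subset_span ⟨i, rfl⟩)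
  set P := Submodule.span k (Set.range (fun i : Fin (s + 1) => a ^ (i : ℕ)) ∪ Set.range b)
  have hPa : ∀ j, a ^ j ∈ P := by
    intro j
    by_cases hj : j < s + 1
    · exact Submodule.subset_span (Or.inl ⟨⟨j, hj⟩, rfl⟩)
    · rw [show j = s + 1 + (j - (s + 1)) by omega, pow_add, hs1, zero_mul]
      exact P.zero_mem
  have hPN : N ≤ P := hNspan.trans (Submodule.span_mono Set.subset_union_right)
  -- Descending induction on the exponent j, with t bounding the distance to s + 1, where the power
  -- vanishes.
  have hPmul : ∀ t j, 1 ≤ j → s + 1 ≤ j + t → ∀ x, a ^ j * x ∈ P := by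
    intro t
    induction t with
    | zero =>
      intro j _ hj x
      rw [show j = s + 1 + (j - (s + 1)) by omega, pow_add, hs1, zero_mul, zero_mul]
      exact P.zero_mem
    | succ t ih =>
      intro j hj1 hj x
      obtain ⟨c, hc⟩ := exists_sub_algebraMap_mem (k := k) m x
      obtain ⟨e, y, hy, -, hay⟩ := hdec _ hc
      obtain ⟨i, rfl⟩ : ∃ i, j = i + 1 := ⟨j - 1, by omega⟩
      have : a ^ (i + 1) * x = c • a ^ (i + 1) + a ^ (i + 1 + 1) * e := by
        rw [Algebra.smul_def]
        linear_combination a ^ (i + 1) * hy + a ^ i * hay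
      rw [this]
      exact add_mem (P.smul_mem _ (hPa _)) (ih _ (by omega) (by omega) _)
  have hPtop : P = ⊤ := by
    refine top_le_iff.mp fun x _ => ?_
    obtain ⟨c, hc⟩ := exists_sub_algebraMap_mem (k := k) m x
    obtain ⟨e, y, hy, t, hxy⟩ := hdec' _ hc
    have : x = c • a ^ 0 + (a ^ 1 * e + y + t • a ^ s) := by
      rw [pow_zero, pow_one, ← hxy, ← Algebra.algebraMap_eq_smul_one]; ring
    rw [this]
    exact add_mem (P.smul_mem _ (hPa _)) (add_mem (add_mem (hPmul s 1 le_rfl (by omega) _) (hPN hy))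
      (P.smul_mem _ (hPa _)))
  have hbmul : ∀ i j, b i * b j = if i = j then a ^ s else 0 := by
    intro i j
    rw [hmul _ (hbN i) _ (hbN j)]
    have h1 : ψ (b i * b j) = r i * (r j * ψ (v i * v j)) := by
      simp only [hb, smul_mul_assoc, mul_smul_comm, map_smul, smul_eq_mul]; ring
    by_cases hij : i = j
    · subst hij
      rw [if_pos rfl, h1, ← mul_assoc, ← hr, div_mul_cancel₀ _ (hvv i), div_self hψs, one_smul]
    · rw [if_neg hij, h1, show ψ (v i * v j) = 0 from hv hij, mul_zero, mul_zero, zero_div, zero_smul]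
  have hli : LinearIndependent k (Sum.elim (fun i : Fin (s + 1) => a ^ (i : ℕ)) b) := by
    rw [Fintype.linearIndependent_iff]
    intro g hg
    rw [Fintype.sum_sum_type] at hg
    simp only [Sum.elim_inl, Sum.elim_inr] at hg
    have hψb : ∀ i, ψ (b i) = 0 := fun i => (hbN i).2
    -- Lower coefficients are already zero; multiplying by a^(s-i) kills the higher powers, and ψ
    -- kills the b part, leaving the i-th coefficient times ψ(a^s).
    have hc : ∀ (i : ℕ) (hi : i < s + 1), g (Sum.inl ⟨i, hi⟩) = 0 := by
      intro i
      induction i using Nat.strong_induction_on with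
      | _ i ih =>
        intro hi
        have h1 : ∑ j : Fin (s + 1), g (Sum.inl j) • (a ^ (s - i) * a ^ (j : ℕ)) =
            g (Sum.inl ⟨i, hi⟩) • a ^ s := by
          rw [Finset.sum_eq_single ⟨i, hi⟩]
          · rw [← pow_add, Nat.sub_add_cancel (by omega)]
          · intro j _ hj
            have hj' : (j : ℕ) ≠ i := fun h => hj (Fin.ext h)
            rcases lt_or_gt_of_ne hj' with h | h
            · rw [ih j h j.2, zero_smul]
            · rw [← pow_add, show s - i + (j : ℕ) = s + 1 + (j - i - 1) by omega, pow_add, hs1,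
                zero_mul, smul_zero]
          · simp
        have h3 : ψ (∑ j, g (Sum.inr j) • (a ^ (s - i) * b j)) = 0 := by
          rw [map_sum]
          refine Finset.sum_eq_zero fun j _ => ?_
          rw [map_smul]
          rcases Nat.eq_zero_or_pos (s - i) with h | h
          · rw [h, pow_zero, one_mul, hψb, smul_zero]
          · obtain ⟨t, ht⟩ : ∃ t, s - i = t + 1 := ⟨s - i - 1, by omega⟩
            rw [ht, pow_succ, mul_assoc, hab, mul_zero, map_zero, smul_zero]
        have h4 := congrArg (fun x => ψ (a ^ (s - i) * x)) hg
        simp only [mul_add, Finset.mul_sum, mul_smul_comm, mul_zero, map_zero] at h4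
        rw [h1, map_add, h3, add_zero, map_smul, smul_eq_mul] at h4
        exact (mul_eq_zero.mp h4).resolve_right hψs
    have hd : ∀ j, g (Sum.inr j) = 0 := by
      intro j
      have h1 := congrArg (fun x => ψ (b j * x)) hg
      have h3 : ∑ x : Fin (s + 1), g (Sum.inl x) • a ^ (x : ℕ) = 0 :=
        Finset.sum_eq_zero fun x _ => by rw [hc x x.2, zero_smul]
      simp only [h3, zero_add, Finset.mul_sum, mul_smul_comm, hbmul, mul_zero, map_zero] at h1
      simp only [smul_ite, smul_zero, Finset.sum_ite_eq, Finset.mem_univ, if_true, map_smul,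
        smul_eq_mul, mul_eq_zero, hψs, or_false] at h1
      exact h1
    rintro (i | j)
    · exact hc i i.2
    · exact hd j
  refine ⟨_, s, a, b, ⟨hab, hbmul, hs1, hPtop, ?_, hs2⟩, fun hn => ?_⟩
  · refine le_antisymm ?_ (by simpa using hli.fintype_card_le_finrank)
    have hPe : P = Submodule.span k
        (Set.range (Sum.elim (fun i : Fin (s + 1) => a ^ (i : ℕ)) b)) := by
      rw [Set.Sum.elim_range]
    rw [← finrank_top k B, ← hPtop, hPe]
    exact (finrank_range_le_card _).trans (by simp)
  · refine le_antisymm (fun y hy => ?_) ((Ideal.span_singleton_le_iff_mem _).mpr ham)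
    obtain ⟨c, b', hb', t, rfl⟩ := hdec' y hy
    have hb0 : b' = 0 := by
      have : Module.finrank k N = 0 := hn
      have := Submodule.finrank_eq_zero.mp this
      rw [this] at hb'
      exact hb'
    rw [hb0, Ideal.mem_span_singleton]
    obtain ⟨t', rfl⟩ : ∃ t', s = t' + 1 := ⟨s - 1, by omega⟩
    exact ⟨c + algebraMap k B t * a ^ t', by rw [Algebra.smul_def]; ring⟩

end Stretched

/-! ### The multiplication table characterizes A_{n,d}. -/

section AlgA

open Module

variable {k B : Type*} [Field k] [CommRing B] [Algebra k B]

lemma algA_mul_eq (k : Type*) [Field k] (n s : ℕ) (i j : Fin (n + 1)) (hne : (i, j) ≠ (0, 0)) :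
    Ideal.Quotient.mk (idealA k (n + 1) (n + 1 + s)) (X i) * Ideal.Quotient.mk _ (X j) =
      if i = j then (Ideal.Quotient.mk (idealA k (n + 1) (n + 1 + s)) (X 0)) ^ s else 0 := by
  set q := Ideal.Quotient.mk (idealA k (n + 1) (n + 1 + s))
  set x := q (X 0)
  have hle : ∀ i j : Fin (n + 1), i ≤ j → (i, j) ≠ (0, 0) →
      q (X i) * q (X j) = if i = j then x ^ s else 0 := by
    intro i j hij hne
    have h1 : q (X i * X j - if i = j then X 0 ^ (n + 1 + s - (n + 1)) else 0) = 0 :=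
      Ideal.Quotient.eq_zero_iff_mem.mpr (Ideal.subset_span (Or.inl ⟨i, j, hij, hne, rfl⟩))
    rw [map_sub, sub_eq_zero, map_mul, apply_ite q, map_pow, map_zero,
      show n + 1 + s - (n + 1) = s by omega] at h1
    exact h1
  rcases le_total i j with h | h
  · exact hle i j h hne
  · rw [mul_comm, hle j i h (fun h' => hne (by
      rw [Prod.mk.injEq] at h' ⊢; exact ⟨h'.2, h'.1⟩))]
    simp only [eq_comm]

lemma algA_pow_eq_zero (k : Type*) [Field k] (n s : ℕ) :
    (Ideal.Quotient.mk (idealA k (n + 1) (n + 1 + s)) (X 0)) ^ (s + 1) = 0 := by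
  have h1 : Ideal.Quotient.mk (idealA k (n + 1) (n + 1 + s)) (X 0 ^ (n + 1 + s - (n + 1) + 1)) = 0 :=
    Ideal.Quotient.eq_zero_iff_mem.mpr (Ideal.subset_span (Or.inr rfl))
  rwa [map_pow, show n + 1 + s - (n + 1) = s by omega] at h1

/-- By the defining relations this span contains 1 and is stable under multiplication by each
variable. -/
lemma span_algA_eq_top (k : Type*) [Field k] (n s : ℕ) :
    Submodule.span k (Set.range (fun i : Fin (s + 1) =>
      (Ideal.Quotient.mk (idealA k (n + 1) (n + 1 + s)) (X 0)) ^ (i : ℕ)) ∪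
      Set.range fun j : Fin n => Ideal.Quotient.mk (idealA k (n + 1) (n + 1 + s)) (X j.succ)) =
      ⊤ := by
  set q := Ideal.Quotient.mk (idealA k (n + 1) (n + 1 + s))
  set x := q (X 0)
  set P := Submodule.span k (Set.range (fun i : Fin (s + 1) => x ^ (i : ℕ)) ∪
      Set.range fun j : Fin n => q (X j.succ))
  have hrel := algA_mul_eq k n s
  have hpow : x ^ (s + 1) = 0 := algA_pow_eq_zero k n s
  have hPx : ∀ i, x ^ i ∈ P := by
    intro j
    by_cases hj : j < s + 1
    · exact Submodule.subset_span (Or.inl ⟨⟨j, hj⟩, rfl⟩)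
    · rw [show j = s + 1 + (j - (s + 1)) by omega, pow_add, hpow, zero_mul]
      exact P.zero_mem
  have hPX : ∀ j, q (X j) ∈ P := by
    intro j
    refine Fin.cases ?_ (fun j => ?_) j
    · simpa using hPx 1
    · exact Submodule.subset_span (Or.inr ⟨j, rfl⟩)
  have hmulX : ∀ j, ∀ y ∈ P, y * q (X j) ∈ P := by
    intro j y hy
    induction hy using Submodule.span_induction with
    | mem y hy =>
      rcases hy with ⟨i, rfl⟩ | ⟨i, rfl⟩
      · refine Fin.cases ?_ (fun j => ?_) j
        · change x ^ (i : ℕ) * x ∈ P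
          rw [← pow_succ]
          exact hPx _
        · rcases Nat.eq_zero_or_pos i with h | h
          · simp only [h, pow_zero, one_mul]; exact hPX _
          · obtain ⟨t, ht⟩ : ∃ t, (i : ℕ) = t + 1 := ⟨i - 1, by omega⟩
            have := hrel 0 j.succ (by simp [Fin.succ_ne_zero])
            rw [if_neg (Fin.succ_ne_zero j).symm] at this
            simp only [ht, pow_succ, mul_assoc]
            rw [this, mul_zero]
            exact P.zero_mem
      · simp only
        rw [hrel _ _ (by simp [Fin.succ_ne_zero])]
        split_ifs
        · exact hPx _
        · exact P.zero_mem
    | zero => rw [zero_mul]; exact P.zero_mem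
    | add a b _ _ ha hb => rw [add_mul]; exact add_mem ha hb
    | smul c a _ ha => rw [smul_mul_assoc]; exact P.smul_mem _ ha
  refine top_le_iff.mp fun y hy => ?_
  obtain ⟨p, rfl⟩ := Ideal.Quotient.mk_surjective y
  clear hy
  change q p ∈ P
  induction p using MvPolynomial.induction_on with
  | C c =>
    have : q (C c) = c • x ^ 0 := by
      rw [pow_zero, ← Algebra.algebraMap_eq_smul_one]; rfl
    rw [this]
    exact P.smul_mem _ (hPx 0)
  | add f g hf hg => rw [map_add]; exact add_mem hf hg
  | mul_X f j hf => rw [map_mul]; exact hmulX j _ hf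

/-- The relations give a surjection from A_{n+1,n+1+s}, whose spanning set of s + 1 + n elements
bounds its dimension by that of `B`. -/
theorem IsStretched.nonempty_algEquiv {n s : ℕ} {a : B} {b : Fin n → B}
    (h : IsStretched k n s a b) : Nonempty (B ≃ₐ[k] AlgA k (n + 1) (n + 1 + s)) := by
  let f : MvPolynomial (Fin (n + 1)) k →ₐ[k] B := aeval (Fin.cons a b)
  have hf0 : f (X 0) = a := by simp [f]
  have hfs : ∀ j : Fin n, f (X j.succ) = b j := fun j => by simp [f]
  have hker : ∀ p ∈ idealA k (n + 1) (n + 1 + s), f p = 0 := by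
    have : idealA k (n + 1) (n + 1 + s) ≤ RingHom.ker f := by
      rw [idealA, Ideal.span_le]
      rintro p (⟨i, j, hij, hne, rfl⟩ | rfl)
      · rw [SetLike.mem_coe, RingHom.mem_ker, map_sub, map_mul, apply_ite f, map_pow, map_zero,
          show n + 1 + s - (n + 1) = s by omega, hf0]
        revert hij hne
        refine Fin.cases ?_ (fun i => ?_) i <;> refine Fin.cases ?_ (fun j => ?_) j <;> intro hij hne
        · exact absurd rfl hne
        · rw [hf0, hfs, h.mul_left, if_neg (Fin.succ_ne_zero j).symm, sub_zero]
        · simp at hij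
        · rw [hfs, hfs, h.mul_mul]
          simp only [Fin.succ_inj, sub_self]
      · rw [SetLike.mem_coe, RingHom.mem_ker, map_pow, hf0,
          show n + 1 + s - (n + 1) = s by omega, h.pow_eq_zero]
    exact this
  let g : AlgA k (n + 1) (n + 1 + s) →ₐ[k] B := Ideal.Quotient.liftₐ _ f hker
  have hg : ∀ p, g (Ideal.Quotient.mk _ p) = f p := fun p => rfl
  have hsurj : Function.Surjective g := by
    have : LinearMap.range g.toLinearMap = ⊤ := by
      rw [← top_le_iff, ← h.span_eq_top, Submodule.span_le]
      rintro _ (⟨i, rfl⟩ | ⟨i, rfl⟩)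
      · exact ⟨Ideal.Quotient.mk _ (X 0) ^ (i : ℕ), by
          simp only [AlgHom.toLinearMap_apply, map_pow, hg, hf0]⟩
      · exact ⟨Ideal.Quotient.mk _ (X i.succ), by simp only [AlgHom.toLinearMap_apply, hg, hfs]⟩
    exact LinearMap.range_eq_top.mp this
  have hspan := span_algA_eq_top k n s
  have hfin : Module.Finite k (AlgA k (n + 1) (n + 1 + s)) :=
    ⟨⟨((Set.finite_range _).union (Set.finite_range _)).toFinset, by
      rw [Set.Finite.coe_toFinset]; exact hspan⟩⟩
  have hle : finrank k (AlgA k (n + 1) (n + 1 + s)) ≤ s + 1 + n := by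
    rw [← finrank_top, ← hspan, ← Set.Sum.elim_range]
    exact (finrank_range_le_card _).trans (by simp)
  have hinj : Function.Injective g.toLinearMap := by
    have hB : Module.Finite k B := Module.Finite.of_surjective g.toLinearMap hsurj
    have h1 := g.toLinearMap.finrank_range_add_finrank_ker
    rw [LinearMap.range_eq_top.mpr hsurj, finrank_top, h.finrank_eq] at h1
    rw [← LinearMap.ker_eq_bot, ← Submodule.finrank_eq_zero (R := k)]
    omega
  exact ⟨(AlgEquiv.ofBijective g ⟨hinj, hsurj⟩).symm⟩

end AlgA

/-! ### Local algebras with Hilbert function (1,2,2,1). -/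

section NonStretched

open Module IsLocalRing

variable {k B : Type*} [Field k] [CommRing B] [Algebra k B] [IsLocalRing B] [IsAlgClosed k]

/-- A local Gorenstein algebra of dimension at most six which is neither curvilinear nor stretched
has Hilbert function `(1, 2, 2, 1)` and contains a subspace `U` with `U² = B`. -/
theorem exists_span_mul_eq_top_of_not_stretched (h2 : (2 : k) ≠ 0) [FiniteDimensional k B]
    {ψ : B →ₗ[k] k} (hψ : ∀ a, (∀ b, ψ (a * b) = 0) → a = 0)
    (hcurv : ∀ t, maximalIdeal B ≠ Ideal.span {t} ⊔ maximalIdeal B ^ 2)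
    (hst : ∀ z, maximalIdeal B ^ 2 ≠ Ideal.span {z} ⊔ maximalIdeal B ^ 3)
    (hB : finrank k B ≤ 6) : finrank k B = 6 ∧ ∃ u : Fin 3 → B,
      Submodule.span k (Set.range fun p : Fin 3 × Fin 3 => u p.1 * u p.2) = ⊤ := by
  have : IsNoetherianRing B := IsNoetherianRing.of_finite k B
  set m := maximalIdeal B
  have h21 : m ^ 2 ≤ m := Ideal.pow_le_self two_ne_zero
  have h32 : m ^ 3 ≤ m ^ 2 := Ideal.pow_le_pow_right (by norm_num)
  have hpick1 : ∀ t ∈ m, ∃ y ∈ m, y ∉ Ideal.span {t} ⊔ m ^ 2 := fun t ht => by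
    have hle : Ideal.span {t} ⊔ m ^ 2 ≤ m := sup_le ((Ideal.span_singleton_le_iff_mem _).mpr ht) h21
    exact SetLike.exists_of_lt (lt_of_le_of_ne hle (hcurv t).symm)
  have hpick2 : ∀ t ∈ m ^ 2, ∃ y ∈ m ^ 2, y ∉ Ideal.span {t} ⊔ m ^ 3 := fun t ht => by
    have hle : Ideal.span {t} ⊔ m ^ 3 ≤ m ^ 2 :=
      sup_le ((Ideal.span_singleton_le_iff_mem _).mpr ht) h32
    exact SetLike.exists_of_lt (lt_of_le_of_ne hle (hst t).symm)
  obtain ⟨x, hx, hx'⟩ := hpick1 0 (zero_mem _)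
  obtain ⟨y, hy, hy'⟩ := hpick1 x hx
  obtain ⟨z₁, hz₁, hz₁'⟩ := hpick2 0 (zero_mem _)
  obtain ⟨z₂, hz₂, hz₂'⟩ := hpick2 z₁ hz₁
  have hx2 : x ∉ m ^ 2 := fun h => hx' (Ideal.mem_sup_right h)
  have hz13 : z₁ ∉ m ^ 3 := fun h => hz₁' (Ideal.mem_sup_right h)
  have hsoc : ∀ z, (∀ r ∈ m, r * z = 0) → z ≠ 0 → ∀ w, (∀ r ∈ m, r * w = 0) →
      w = (ψ w / ψ z) • z := fun z hz hz0 w hw => eq_smul_of_socle hψ hz hz0 hw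
  -- Otherwise m² would lie in the socle, which is too small to hold z₁ and z₂.
  have h3 : m ^ 3 ≠ ⊥ := by
    intro h3
    have hm2 : ∀ z ∈ m ^ 2, ∀ r ∈ m, r * z = 0 := by
      intro z hz r hr
      have : r * z ∈ m ^ 3 := by rw [pow_succ' m 2]; exact Ideal.mul_mem_mul hr hz
      rwa [h3, Ideal.mem_bot] at this
    refine hz₂' (Ideal.mem_sup_left ?_)
    rw [hsoc z₁ (hm2 _ hz₁) (fun h => hz13 (h ▸ zero_mem _)) z₂ (hm2 _ hz₂), Algebra.smul_def]
    exact Ideal.mul_mem_left _ _ (Ideal.mem_span_singleton_self _)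
  obtain ⟨z₃, hz₃, hz₃0⟩ := Submodule.exists_mem_ne_zero_of_ne_bot h3
  have hcm : ∀ c : k, algebraMap k B c ∈ m → c = 0 := by
    intro c hc
    by_contra h0
    exact ((mem_maximalIdeal _).mp hc) ((isUnit_iff_ne_zero.mpr h0).map _)
  have hsmulm : ∀ (I : Ideal B) (c : k) (w : B), c • w ∈ I → c ≠ 0 → w ∈ I := by
    intro I c w h h0
    have := I.mul_mem_left (algebraMap k B c⁻¹) h
    rwa [← Algebra.smul_def, smul_smul, inv_mul_cancel₀ h0, one_smul] at this
  have hsm : ∀ (I : Ideal B) (c : k) (w : B), w ∈ I → c • w ∈ I := by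
    intro I c w h
    rw [Algebra.smul_def]; exact I.mul_mem_left _ h
  have hxy : ∀ c d : k, c • x + d • y ∈ m ^ 2 → c = 0 ∧ d = 0 := by
    intro c d h
    have hd : d = 0 := by
      by_contra hd
      refine hy' (hsmulm _ d y ?_ hd)
      have : d • y = (c • x + d • y) - c • x := by ring
      rw [this]
      exact sub_mem (Ideal.mem_sup_right h)
        (hsm _ _ _ (Ideal.mem_sup_left (Ideal.mem_span_singleton_self _)))
    refine ⟨?_, hd⟩
    by_contra hc
    rw [hd, zero_smul, add_zero] at h
    exact hx2 (hsmulm _ c x h hc)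
  have hzz : ∀ c d : k, c • z₁ + d • z₂ ∈ m ^ 3 → c = 0 ∧ d = 0 := by
    intro c d h
    have hd : d = 0 := by
      by_contra hd
      refine hz₂' (hsmulm _ d z₂ ?_ hd)
      have : d • z₂ = (c • z₁ + d • z₂) - c • z₁ := by ring
      rw [this]
      exact sub_mem (Ideal.mem_sup_right h)
        (hsm _ _ _ (Ideal.mem_sup_left (Ideal.mem_span_singleton_self _)))
    refine ⟨?_, hd⟩
    by_contra hc
    rw [hd, zero_smul, add_zero] at h
    exact hz13 (hsmulm _ c z₁ h hc)
  have hcoef1 : ∀ (c : Fin 6 → k), c 0 • 1 + c 1 • x + c 2 • y + c 3 • z₁ + c 4 • z₂ + c 5 • z₃ ∈ m →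
      c 0 = 0 := by
    intro c hc
    apply hcm
    have : algebraMap k B (c 0) = (c 0 • 1 + c 1 • x + c 2 • y + c 3 • z₁ + c 4 • z₂ + c 5 • z₃) -
        (c 1 • x + c 2 • y + c 3 • z₁ + c 4 • z₂ + c 5 • z₃) := by
      rw [Algebra.algebraMap_eq_smul_one]; ring
    rw [this]
    exact sub_mem hc (add_mem (add_mem (add_mem (add_mem (hsm _ _ _ hx) (hsm _ _ _ hy))
      (hsm _ _ _ (h21 hz₁))) (hsm _ _ _ (h21 hz₂))) (hsm _ _ _ (h21 (h32 hz₃))))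
  have hcoef2 : ∀ (c : Fin 6 → k), c 0 • 1 + c 1 • x + c 2 • y + c 3 • z₁ + c 4 • z₂ + c 5 • z₃ ∈ m ^ 2 →
      c 0 = 0 ∧ c 1 = 0 ∧ c 2 = 0 := by
    intro c hc
    have h0 := hcoef1 c (h21 hc)
    refine ⟨h0, hxy _ _ ?_⟩
    have : c 1 • x + c 2 • y = (c 0 • 1 + c 1 • x + c 2 • y + c 3 • z₁ + c 4 • z₂ + c 5 • z₃) -
        (c 3 • z₁ + c 4 • z₂ + c 5 • z₃) := by
      rw [h0, zero_smul]; ring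
    rw [this]
    exact sub_mem hc (add_mem (add_mem (hsm _ _ _ hz₁) (hsm _ _ _ hz₂)) (hsm _ _ _ (h32 hz₃)))
  have hcoef3 : ∀ (c : Fin 6 → k), c 0 • 1 + c 1 • x + c 2 • y + c 3 • z₁ + c 4 • z₂ + c 5 • z₃ ∈ m ^ 3 →
      c 0 = 0 ∧ c 1 = 0 ∧ c 2 = 0 ∧ c 3 = 0 ∧ c 4 = 0 := by
    intro c hc
    obtain ⟨h0, h1, h2'⟩ := hcoef2 c (h32 hc)
    refine ⟨h0, h1, h2', hzz _ _ ?_⟩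
    have : c 3 • z₁ + c 4 • z₂ = (c 0 • 1 + c 1 • x + c 2 • y + c 3 • z₁ + c 4 • z₂ + c 5 • z₃) -
        c 5 • z₃ := by
      rw [h0, h1, h2']; simp only [zero_smul]; ring
    rw [this]
    exact sub_mem hc (hsm _ _ _ hz₃)
  -- Two independent elements of m/m², two of m²/m³, one nonzero element of m³ and 1 already exhaust
  -- the dimension six.
  set e : Fin 6 → B := ![1, x, y, z₁, z₂, z₃]
  have hsum : ∀ c : Fin 6 → k, ∑ i, c i • e i =
      c 0 • 1 + c 1 • x + c 2 • y + c 3 • z₁ + c 4 • z₂ + c 5 • z₃ := fun c => Fin.sum_univ_six _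
  have hli : LinearIndependent k e := by
    rw [Fintype.linearIndependent_iff]
    intro c hc
    rw [hsum] at hc
    obtain ⟨h0, h1, h2', h3', h4⟩ := hcoef3 c (hc ▸ zero_mem _)
    have h5 : c 5 = 0 := by
      by_contra h5
      rw [h0, h1, h2', h3', h4] at hc
      simp only [zero_smul, zero_add] at hc
      exact hz₃0 ((smul_eq_zero_iff_right h5).mp hc)
    intro i
    fin_cases i
    exacts [h0, h1, h2', h3', h4, h5]
  have hfin : finrank k B = 6 := le_antisymm hB (by simpa using hli.fintype_card_le_finrank)
  refine ⟨hfin, ?_⟩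
  have hcomb : ∀ w : B, ∃ c : Fin 6 → k,
      w = c 0 • 1 + c 1 • x + c 2 • y + c 3 • z₁ + c 4 • z₂ + c 5 • z₃ := by
    intro w
    have h1 := hli.span_eq_top_of_card_eq_finrank' (by simp [hfin])
    obtain ⟨c, hc⟩ := (Submodule.mem_span_range_iff_exists_fun k).mp (h1 ▸ Submodule.mem_top (x := w))
    exact ⟨c, by rw [← hc, hsum]⟩
  have hm3 : ∀ w ∈ m ^ 3, ∃ c : k, w = c • z₃ := by
    intro w hw
    obtain ⟨c, rfl⟩ := hcomb w
    obtain ⟨h0, h1, h2', h3', h4⟩ := hcoef3 c hw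
    exact ⟨c 5, by rw [h0, h1, h2', h3', h4]; simp only [zero_smul, zero_add]⟩
  have hm2 : ∀ w ∈ m ^ 2, ∃ c d e : k, w = c • z₁ + d • z₂ + e • z₃ := by
    intro w hw
    obtain ⟨c, rfl⟩ := hcomb w
    obtain ⟨h0, h1, h2'⟩ := hcoef2 c hw
    exact ⟨c 3, c 4, c 5, by rw [h0, h1, h2']; simp only [zero_smul, zero_add]⟩
  have hm1 : ∀ w ∈ m, ∃ c d : k, ∃ p ∈ m ^ 2, w = c • x + d • y + p := by
    intro w hw
    obtain ⟨c, rfl⟩ := hcomb w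
    have h0 := hcoef1 c hw
    exact ⟨c 1, c 2, c 3 • z₁ + c 4 • z₂ + c 5 • z₃,
      add_mem (add_mem (hsm _ _ _ hz₁) (hsm _ _ _ hz₂)) (hsm _ _ _ (h32 hz₃)), by
        rw [h0, zero_smul]; ring⟩
  have hz₃m : ∀ r ∈ m, r * z₃ = 0 := by
    intro r hr
    have h1 : r * z₃ ∈ m ^ 3 := Ideal.mul_mem_left _ _ hz₃
    obtain ⟨c, hc⟩ := hm3 _ h1
    by_cases hc0 : c = 0
    · rw [hc, hc0, zero_smul]
    · exfalso
      have hu : IsUnit (r - algebraMap k B c) := by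
        by_contra hu
        exact hc0 (hcm c (by simpa using sub_mem hr ((mem_maximalIdeal _).mpr hu)))
      refine hz₃0 (hu.mul_right_eq_zero.mp ?_)
      rw [sub_mul, hc, ← Algebra.smul_def, sub_self]
  have hm4 : ∀ p ∈ m ^ 2, ∀ r ∈ m ^ 2, p * r = 0 := by
    intro p hp r hr
    have h1 : p * r ∈ m * m ^ 3 := by
      rw [← pow_succ', show 3 + 1 = 2 + 2 by rfl, pow_add]; exact Ideal.mul_mem_mul hp hr
    refine Submodule.mul_induction_on h1 (fun a ha b hb => ?_) (fun a b ha hb => by rw [ha, hb, add_zero])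
    obtain ⟨c, rfl⟩ := hm3 b hb
    rw [mul_smul_comm, hz₃m a ha, smul_zero]
  -- m² has dimension 3 and square zero, so it is its own orthogonal for ψ; an element annihilating
  -- m² must belong to it.
  have hann : ∀ L ∈ m, L ∉ m ^ 2 → ∃ p ∈ m ^ 2, L * p ≠ 0 := by
    intro L _ hL
    by_contra! hcon
    refine hL ?_
    have hnd := mulForm_nondegenerate hψ
    set M2 := (m ^ 2).restrictScalars k
    have hM2 : finrank k M2 = 3 := by
      have h1 : LinearIndependent k ![z₁, z₂, z₃] :=
        hli.comp (![3, 4, 5] : Fin 3 → Fin 6) (by decide) |> fun h => by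
          convert h using 1
          ext i; fin_cases i <;> rfl
      have h4 : M2 = Submodule.span k (Set.range ![z₁, z₂, z₃]) := by
        refine le_antisymm (fun w hw => ?_) (Submodule.span_le.mpr ?_)
        · obtain ⟨c, d, e, rfl⟩ := hm2 w hw
          refine (Submodule.mem_span_range_iff_exists_fun k).mpr ⟨![c, d, e], ?_⟩
          simp [Fin.sum_univ_three]
        · rintro _ ⟨i, rfl⟩
          fin_cases i
          exacts [hz₁, hz₂, h32 hz₃]
      rw [h4, finrank_span_eq_card h1, Fintype.card_fin]
    have hle : M2 ≤ (mulForm ψ).orthogonal M2 := by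
      intro w hw
      rw [LinearMap.BilinForm.mem_orthogonal_iff]
      intro v hv
      change ψ (v * w) = 0
      rw [hm4 v hv w hw, map_zero]
    have heq := Submodule.eq_of_le_of_finrank_le hle (by
      rw [LinearMap.BilinForm.finrank_orthogonal hnd, hM2, hfin])
    change L ∈ M2
    rw [heq, LinearMap.BilinForm.mem_orthogonal_iff]
    intro v hv
    change ψ (v * L) = 0
    rw [mul_comm, hcon v hv, map_zero]
  have hmm : ∀ a ∈ m, ∀ b ∈ m, a * b ∈ m ^ 2 := fun a ha b hb => by
    rw [pow_two]; exact Ideal.mul_mem_mul ha hb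
  have hmm3 : ∀ a ∈ m, ∀ b ∈ m ^ 2, a * b ∈ m ^ 3 := fun a ha b hb => by
    rw [pow_succ' m 2]; exact Ideal.mul_mem_mul ha hb
  -- Three products of x and y in the two-dimensional m²/m³ satisfy a linear relation, up to a
  -- multiple of z₃.
  obtain ⟨α, β, γ, δ, hne, hrel⟩ : ∃ α β γ δ : k, (α, β, γ) ≠ (0, 0, 0) ∧
      α • x ^ 2 + β • (x * y) + γ • y ^ 2 = δ • z₃ := by
    obtain ⟨a₁, a₂, a₃, ha⟩ := hm2 _ (hmm x hx x hx)
    obtain ⟨b₁, b₂, b₃, hb⟩ := hm2 _ (hmm x hx y hy)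
    obtain ⟨c₁, c₂, c₃, hc⟩ := hm2 _ (hmm y hy y hy)
    have hdep : ¬ LinearIndependent k ![![a₁, a₂], ![b₁, b₂], ![c₁, c₂]] := by
      intro h
      have := h.fintype_card_le_finrank
      simp at this
    rw [Fintype.linearIndependent_iff] at hdep
    push Not at hdep
    obtain ⟨g, hg, i, hi⟩ := hdep
    rw [Fin.sum_univ_three] at hg
    have g1 : g 0 * a₁ + g 1 * b₁ + g 2 * c₁ = 0 := by simpa using congrFun hg 0
    have g2 : g 0 * a₂ + g 1 * b₂ + g 2 * c₂ = 0 := by simpa using congrFun hg 1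
    refine ⟨g 0, g 1, g 2, g 0 * a₃ + g 1 * b₃ + g 2 * c₃, fun h => hi ?_, ?_⟩
    · simp only [Prod.mk.injEq] at h
      fin_cases i
      exacts [h.1, h.2.1, h.2.2]
    · rw [pow_two, pow_two, ha, hb, hc]
      have g1' := congrArg (fun t => t • z₁) g1
      have g2' := congrArg (fun t => t • z₂) g2
      simp only [add_smul, mul_smul, zero_smul] at g1' g2' ⊢
      simp only [smul_add]
      linear_combination (exp := 1) g1' + g2'
  -- The error term must be nonzero for z₃ to lie in U · U. If it vanishes, perturb x and y by
  -- elements of m²: the change is given by the partial derivatives of the quadratic form. As 2 is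
  -- invertible, one of these is outside m², and `hann` applies to it.
  obtain ⟨p, hp, r, hr, δ', hδ', hrel'⟩ : ∃ p ∈ m ^ 2, ∃ r ∈ m ^ 2, ∃ δ' : k, δ' ≠ 0 ∧
      α • (x + p) ^ 2 + β • ((x + p) * (y + r)) + γ • (y + r) ^ 2 = δ' • z₃ := by
    by_cases hδ : δ = 0
    swap
    · exact ⟨0, zero_mem _, 0, zero_mem _, δ, hδ, by simpa using hrel⟩
    have hexp : ∀ p ∈ m ^ 2, ∀ r ∈ m ^ 2,
        α • (x + p) ^ 2 + β • ((x + p) * (y + r)) + γ • (y + r) ^ 2 =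
          ((2 * α) • x + β • y) * p + (β • x + (2 * γ) • y) * r := by
      intro p hp r hr
      rw [hδ, zero_smul] at hrel
      have e1 := hm4 p hp r hr
      have e2 := hm4 p hp p hp
      have e3 := hm4 r hr r hr
      simp only [Algebra.smul_def, map_mul, map_ofNat] at hrel ⊢
      linear_combination hrel + algebraMap k B α * e2 + algebraMap k B β * e1 + algebraMap k B γ * e3
    have hL1 : (2 * α) • x + β • y ∈ m := add_mem (hsm _ _ _ hx) (hsm _ _ _ hy)
    have hL2 : β • x + (2 * γ) • y ∈ m := add_mem (hsm _ _ _ hx) (hsm _ _ _ hy)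
    have hor : (2 * α) • x + β • y ∉ m ^ 2 ∨ β • x + (2 * γ) • y ∉ m ^ 2 := by
      by_contra! hcon
      have e1 := hxy _ _ hcon.1
      have e2 := hxy _ _ hcon.2
      apply hne
      rw [(mul_eq_zero.mp e1.1).resolve_left h2, e1.2, (mul_eq_zero.mp e2.2).resolve_left h2]
    rcases hor with h | h
    · obtain ⟨p, hp, hpL⟩ := hann _ hL1 h
      obtain ⟨c, hc⟩ := hm3 _ (hmm3 _ hL1 _ hp)
      refine ⟨p, hp, 0, zero_mem _, c, ?_, ?_⟩
      · rintro rfl; exact hpL (by rw [hc, zero_smul])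
      · rw [hexp p hp 0 (zero_mem _), mul_zero, add_zero, hc]
    · obtain ⟨p, hp, hpL⟩ := hann _ hL2 h
      obtain ⟨c, hc⟩ := hm3 _ (hmm3 _ hL2 _ hp)
      refine ⟨0, zero_mem _, p, hp, c, ?_, ?_⟩
      · rintro rfl; exact hpL (by rw [hc, zero_smul])
      · rw [hexp 0 (zero_mem _) p hp, mul_zero, zero_add, hc]
  refine ⟨![1, x + p, y + r], ?_⟩
  set P := Submodule.span k (Set.range fun q : Fin 3 × Fin 3 =>
    (![1, x + p, y + r] : Fin 3 → B) q.1 * (![1, x + p, y + r] : Fin 3 → B) q.2)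
  have p1 : (1 : B) ∈ P := Submodule.subset_span ⟨(0, 0), by simp⟩
  have px : x + p ∈ P := Submodule.subset_span ⟨(0, 1), by simp⟩
  have py : y + r ∈ P := Submodule.subset_span ⟨(0, 2), by simp⟩
  have pxx : (x + p) ^ 2 ∈ P := Submodule.subset_span ⟨(1, 1), by simp [pow_two]⟩
  have pxy : (x + p) * (y + r) ∈ P := Submodule.subset_span ⟨(1, 2), by simp⟩
  have pyy : (y + r) ^ 2 ∈ P := Submodule.subset_span ⟨(2, 2), by simp [pow_two]⟩
  have pz : z₃ ∈ P := by
    have : z₃ = δ'⁻¹ • (α • (x + p) ^ 2 + β • ((x + p) * (y + r)) + γ • (y + r) ^ 2) := by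
      rw [hrel', smul_smul, inv_mul_cancel₀ hδ', one_smul]
    rw [this]
    exact P.smul_mem _ (add_mem (add_mem (P.smul_mem _ pxx) (P.smul_mem _ pxy)) (P.smul_mem _ pyy))
  have pm3 : ∀ w ∈ m ^ 3, w ∈ P := by
    intro w hw
    obtain ⟨c, rfl⟩ := hm3 w hw
    exact P.smul_mem _ pz
  have pxx' : x * x ∈ P := by
    have : x * x = (x + p) ^ 2 - (2 * (x * p) + p * p) := by ring
    rw [this]
    exact sub_mem pxx (pm3 _ (add_mem (Ideal.mul_mem_left _ _ (hmm3 _ hx _ hp))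
      (by rw [hm4 p hp p hp]; exact zero_mem _)))
  have pxy' : x * y ∈ P := by
    have : x * y = (x + p) * (y + r) - (y * p + x * r + p * r) := by ring
    rw [this]
    exact sub_mem pxy (pm3 _ (add_mem (add_mem (hmm3 _ hy _ hp) (hmm3 _ hx _ hr))
      (by rw [hm4 p hp r hr]; exact zero_mem _)))
  have pyy' : y * y ∈ P := by
    have : y * y = (y + r) ^ 2 - (2 * (y * r) + r * r) := by ring
    rw [this]
    exact sub_mem pyy (pm3 _ (add_mem (Ideal.mul_mem_left _ _ (hmm3 _ hy _ hr))
      (by rw [hm4 r hr r hr]; exact zero_mem _)))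
  have pm2 : ∀ w ∈ m ^ 2, w ∈ P := by
    intro w hw
    rw [pow_two] at hw
    refine Submodule.mul_induction_on hw (fun a ha b hb => ?_) (fun a b ha hb => add_mem ha hb)
    obtain ⟨c, d, s, hs, rfl⟩ := hm1 a ha
    obtain ⟨c', d', s', hs', rfl⟩ := hm1 b hb
    have : (c • x + d • y + s) * (c' • x + d' • y + s') = (c * c') • (x * x) +
        (c * d' + d * c') • (x * y) + (d * d') • (y * y) +
        ((c • x + d • y) * s' + (c' • x + d' • y) * s + s * s') := by
      simp only [Algebra.smul_def, map_mul, map_add]; ring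
    rw [this]
    refine add_mem (add_mem (add_mem (P.smul_mem _ pxx') (P.smul_mem _ pxy')) (P.smul_mem _ pyy'))
      (pm3 _ (add_mem (add_mem (hmm3 _ ?_ _ hs') (hmm3 _ ?_ _ hs)) ?_))
    · exact add_mem (hsm _ _ _ hx) (hsm _ _ _ hy)
    · exact add_mem (hsm _ _ _ hx) (hsm _ _ _ hy)
    · rw [hm4 s hs s' hs']; exact zero_mem _
  have px' : x ∈ P := by simpa using sub_mem px (pm2 p hp)
  have py' : y ∈ P := by simpa using sub_mem py (pm2 r hr)
  refine top_le_iff.mp fun w _ => ?_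
  obtain ⟨c, rfl⟩ := hcomb w
  exact add_mem (add_mem (add_mem (add_mem (add_mem (P.smul_mem _ p1) (P.smul_mem _ px'))
    (P.smul_mem _ py')) (P.smul_mem _ (pm2 _ hz₁))) (P.smul_mem _ (pm2 _ hz₂))) (P.smul_mem _ pz)

end NonStretched

/-! ### Classification of the six-dimensional algebras with a nondegenerate ψ. -/

section Structure

open Module IsLocalRing

variable {k : Type*} [Field k]

/-- The three elements `u i` have the property that their products span the algebra. -/
def HasSpanningProducts (k A : Type*) [Field k] [CommRing A] [Algebra k A] : Prop :=
  ∃ u : Fin 3 → A, Submodule.span k (Set.range fun p : Fin 3 × Fin 3 => u p.1 * u p.2) = ⊤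

lemma HasSpanningProducts.of_surjective {A A' : Type*} [CommRing A] [Algebra k A] [CommRing A']
    [Algebra k A'] (h : HasSpanningProducts k A) (f : A →ₐ[k] A') (hf : Function.Surjective f) :
    HasSpanningProducts k A' := by
  obtain ⟨u, hu⟩ := h
  refine ⟨fun i => f (u i), ?_⟩
  have := congrArg (Submodule.map f.toLinearMap) hu
  rw [Submodule.map_span, Submodule.map_top, LinearMap.range_eq_top.mpr hf, ← Set.range_comp] at this
  rw [← this]
  congr 2
  ext p
  simp

section Split

variable {A : Type*} [CommRing A] [Algebra k A] [FiniteDimensional k A]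

/-- The powers of M stabilize at an idempotent, finitely generated ideal, which is generated by an
idempotent e; this splits off the localization at M. -/
lemma exists_algEquiv_prod (M : Ideal A) [hM : M.IsMaximal] :
    ∃ (I J : Ideal A) (_ : IsLocalRing (A ⧸ I)), Nonempty (A ≃ₐ[k] (A ⧸ I) × (A ⧸ J)) ∧
      I ≤ M ^ 2 ∧ maximalIdeal (A ⧸ I) = M.map (Ideal.Quotient.mk I) := by
  have : IsArtinianRing A := IsArtinianRing.of_finite k A
  obtain ⟨n, hn⟩ := IsArtinian.monotone_stabilizes (R := A) (M := A)
    ⟨fun n => OrderDual.toDual (M ^ n), fun a b h => Ideal.pow_le_pow_right h⟩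
  have hn' : ∀ m, n ≤ m → M ^ n = M ^ m := fun m hm => hn m hm
  -- The shift by 2 secures M^N ≤ M², so the local factor has the tangent space of A at M.
  let N := n + 2
  have hid : IsIdempotentElem (M ^ N) := by
    change M ^ N * M ^ N = M ^ N
    rw [← pow_add, ← hn' _ (by omega), ← hn' N (by omega)]
  obtain ⟨e, he, hIe⟩ := (Ideal.isIdempotentElem_iff_of_fg _ (IsNoetherian.noetherian _)).mp hid
  have he' : e * e = e := he
  have hne : M ^ N ≠ ⊤ := fun h => hM.ne_top (top_le_iff.mp (h ▸ Ideal.pow_le_self (by omega)))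
  have hnt : Nontrivial (A ⧸ M ^ N) := Ideal.Quotient.nontrivial_iff.mpr hne
  have hle : M ^ N ≤ M := Ideal.pow_le_self (by omega)
  have hmax : (M.map (Ideal.Quotient.mk (M ^ N))).IsMaximal :=
    (Ideal.map_eq_top_or_isMaximal_of_surjective _ Ideal.Quotient.mk_surjective hM).resolve_left
      fun h => hM.ne_top (by
        have := congrArg (Ideal.comap (Ideal.Quotient.mk (M ^ N))) h
        rwa [Ideal.comap_map_of_surjective _ Ideal.Quotient.mk_surjective,
          ← RingHom.ker_eq_comap_bot, Ideal.mk_ker, sup_eq_left.mpr hle, Ideal.comap_top] at this)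
  have huniq : ∀ P : Ideal (A ⧸ M ^ N), P.IsMaximal → P = M.map (Ideal.Quotient.mk (M ^ N)) := by
    intro P hP
    refine (hmax.eq_of_le hP.ne_top (Ideal.map_le_iff_le_comap.mpr fun x hx => ?_)).symm
    refine hP.isPrime.mem_of_pow_mem N ?_
    rw [← map_pow, Ideal.Quotient.eq_zero_iff_mem.mpr (Ideal.pow_mem_pow hx N)]
    exact P.zero_mem
  have hloc : IsLocalRing (A ⧸ M ^ N) := IsLocalRing.of_unique_max_ideal ⟨_, hmax, huniq⟩
  refine ⟨M ^ N, Ideal.span {1 - e}, hloc, ⟨?_⟩, Ideal.pow_le_pow_right (by omega),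
    (huniq _ (maximalIdeal.isMaximal _)).symm ▸ rfl⟩
  refine AlgEquiv.ofBijective (AlgHom.prod (Ideal.Quotient.mkₐ k _) (Ideal.Quotient.mkₐ k _))
    ⟨?_, ?_⟩
  · rw [injective_iff_map_eq_zero]
    intro x hx
    have h1 : x ∈ M ^ N := Ideal.Quotient.eq_zero_iff_mem.mp (congrArg Prod.fst hx)
    have h2 : x ∈ Ideal.span {1 - e} := Ideal.Quotient.eq_zero_iff_mem.mp (congrArg Prod.snd hx)
    rw [hIe] at h1
    obtain ⟨y, hy⟩ := Ideal.mem_span_singleton.mp h1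
    obtain ⟨z, hz⟩ := Ideal.mem_span_singleton.mp h2
    have h3 : x * e = x := by rw [hy]; linear_combination y * he'
    rw [← h3, hz]
    linear_combination -z * he'
  · rintro ⟨x, y⟩
    obtain ⟨x, rfl⟩ := Ideal.Quotient.mk_surjective x
    obtain ⟨y, rfl⟩ := Ideal.Quotient.mk_surjective y
    refine ⟨(1 - e) * x + e * y, Prod.ext ?_ ?_⟩
    · refine Ideal.Quotient.eq.mpr ?_
      rw [hIe]
      exact Ideal.mem_span_singleton.mpr ⟨y - x, by ring⟩
    · exact Ideal.Quotient.eq.mpr (Ideal.mem_span_singleton.mpr ⟨x - y, by ring⟩)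

end Split

section Cases

variable {B C : Type*} [CommRing B] [Algebra k B] [CommRing C] [Algebra k C]

/-- With z² = q + pz and w = cz, the condition is c ≠ 0 and c²q ≠ 1. Take c = 1, or c = 2 when q =
1, since then 4 ≠ 1. This handles a two-dimensional complement of A_{2,4}. -/
lemma exists_span_pair_of_finrank_two (h2 : (2 : k) ≠ 0) (h3 : (3 : k) ≠ 0) (hC : finrank k C = 2) :
    ∃ w : C, Submodule.span k {w, 1 - w * w} = ⊤ := by
  have hnt : Nontrivial C := nontrivial_of_finrank_pos (R := k) (by omega)
  have : FiniteDimensional k C := FiniteDimensional.of_finrank_pos (by omega)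
  obtain ⟨z, hz⟩ : ∃ z : C, z ∉ Submodule.span k {(1 : C)} := by
    by_contra! h
    have h1 := finrank_span_singleton (K := k) (one_ne_zero (α := C))
    rw [(eq_top_iff.mpr fun z _ => h z : Submodule.span k {(1 : C)} = ⊤), finrank_top] at h1
    omega
  have hli : LinearIndependent k ![(1 : C), z] := by
    rw [LinearIndependent.pair_iff]
    intro s t hst
    by_cases ht : t = 0
    · refine ⟨?_, ht⟩
      rw [ht, zero_smul, add_zero] at hst
      exact (smul_eq_zero.mp hst).resolve_right one_ne_zero
    · refine absurd (Submodule.mem_span_singleton.mpr ⟨-(t⁻¹ * s), ?_⟩) hz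
      have : z = t⁻¹ • (t • z) := by rw [smul_smul, inv_mul_cancel₀ ht, one_smul]
      rw [this, (eq_neg_of_add_eq_zero_right hst : t • z = -(s • 1)), smul_neg, neg_smul, mul_smul]
  have htop := hli.span_eq_top_of_card_eq_finrank' (by simp [hC])
  rw [Matrix.range_cons, Matrix.range_cons, Matrix.range_empty, Set.union_empty,
    Set.singleton_union] at htop
  obtain ⟨q, p, hqp⟩ := Submodule.mem_span_pair.mp (htop ▸ Submodule.mem_top : z * z ∈ _)
  have key : ∀ c : k, c ≠ 0 → 1 - c * c * q ≠ 0 →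
      Submodule.span k {c • z, 1 - (c • z) * (c • z)} = ⊤ := by
    intro c hc hq
    set P := Submodule.span k {c • z, 1 - (c • z) * (c • z)}
    have hz : z ∈ P := by
      have : c⁻¹ • (c • z) ∈ P := P.smul_mem _ (Submodule.subset_span (by simp))
      rwa [smul_smul, inv_mul_cancel₀ hc, one_smul] at this
    have h1 : (1 : C) ∈ P := by
      have h1 : 1 - (c • z) * (c • z) ∈ P := Submodule.subset_span (by simp)
      have h2 : (1 - c * c * q)⁻¹ • (1 - (c • z) * (c • z) + (c * c * p) • z) ∈ P :=
        P.smul_mem _ (add_mem h1 (P.smul_mem _ hz))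
      have h3 : 1 - (c • z) * (c • z) + (c * c * p) • z = (1 - c * c * q) • (1 : C) := by
        rw [smul_mul_smul_comm, ← hqp, sub_smul, one_smul, smul_add, smul_smul, smul_smul]
        abel
      rwa [h3, smul_smul, inv_mul_cancel₀ hq, one_smul] at h2
    rw [eq_top_iff, ← htop, Submodule.span_le]
    rintro _ (rfl | rfl)
    exacts [h1, hz]
  by_cases hq : q = 1
  · exact ⟨_, key 2 h2 (by rw [hq]; intro h; exact h3 (by linear_combination -h))⟩
  · exact ⟨_, key 1 one_ne_zero (by intro h; exact hq (by linear_combination -h))⟩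

variable {s : ℕ}

lemma IsStretched.pow_mem_of {n : ℕ} {a : B} {b : Fin n → B} (h : IsStretched k n s a b)
    {P : Submodule k (B × C)} (ha : ∀ i ≤ s, (a ^ i, (0 : C)) ∈ P) (hb : ∀ i, (b i, (0 : C)) ∈ P)
    (hC : ∀ c : C, ((0 : B), c) ∈ P) : P = ⊤ := by
  refine top_le_iff.mp fun x _ => ?_
  have hB : (⊤ : Submodule k B) ≤ P.comap (LinearMap.inl k B C) := by
    rw [← h.span_eq_top, Submodule.span_le]
    rintro _ (⟨i, rfl⟩ | ⟨i, rfl⟩)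
    · exact ha i (by omega)
    · exact hb i
  have h1 : (x.1, (0 : C)) ∈ P := hB (Submodule.mem_top (x := x.1))
  have := add_mem h1 (hC x.2)
  simpa using this

/-- Here A is A_{2,6}. The products of 1, a and b + a² are 1, a, b + a², a², a³ and 2a⁴. -/
lemma IsStretched.hasSpanningProducts_one_four (h2 : (2 : k) ≠ 0) {a : B} {b : Fin 1 → B}
    (h : IsStretched k 1 4 a b) [Subsingleton C] : HasSpanningProducts k (B × C) := by
  let u : Fin 3 → B × C := ![(1, 0), (a, 0), (b 0 + a ^ 2, 0)]
  refine ⟨u, ?_⟩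
  set P := Submodule.span k (Set.range fun p : Fin 3 × Fin 3 => u p.1 * u p.2)
  have hu : ∀ i j, u i * u j ∈ P :=
    fun i j => Submodule.subset_span ⟨(i, j), rfl⟩
  have hab := h.mul_left 0
  have hbb := h.mul_mul 0 0
  have ha5 := h.pow_eq_zero
  rw [if_pos rfl] at hbb
  have h00 := hu 0 0
  have h01 := hu 0 1
  have h02 := hu 0 2
  have h11 := hu 1 1
  have h12 := hu 1 2
  have h22 := hu 2 2
  simp only [u, Matrix.cons_val_zero, Matrix.cons_val_one, Matrix.cons_val, Prod.mk_mul_mk, one_mul,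
    mul_zero] at h00 h01 h02 h11 h12 h22
  rw [show a * (b 0 + a ^ 2) = a ^ 3 by linear_combination hab] at h12
  rw [show (b 0 + a ^ 2) * (b 0 + a ^ 2) = a ^ 4 + a ^ 4 by
    linear_combination hbb + 2 * a * hab] at h22
  rw [← pow_two] at h11
  refine h.pow_mem_of (fun i hi => ?_) (fun i => ?_) (fun c => ?_)
  · interval_cases i
    · simpa using h00
    · simpa using h01
    · exact h11
    · exact h12
    · have := P.smul_mem (2 : k)⁻¹ h22
      rwa [Prod.smul_mk, smul_zero, ← two_smul k, smul_smul, inv_mul_cancel₀ h2, one_smul] at this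
  · have := sub_mem h02 h11
    rw [Subsingleton.elim i 0]
    simpa using this
  · rw [Subsingleton.elim c 0]
    exact P.zero_mem

/-- The product (a, 1)(b, 1) = (0, 1) isolates the second factor, and the other products then give a
basis of the first. -/
lemma IsStretched.hasSpanningProducts_one_three {a : B} {b : Fin 1 → B}
    (h : IsStretched k 1 3 a b) (hC : Submodule.span k {(1 : C)} = ⊤) :
    HasSpanningProducts k (B × C) := by
  let u : Fin 3 → B × C := ![(1, 1), (a, 1), (b 0, 1)]
  refine ⟨u, ?_⟩
  set P := Submodule.span k (Set.range fun p : Fin 3 × Fin 3 => u p.1 * u p.2)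
  have hu : ∀ i j, u i * u j ∈ P :=
    fun i j => Submodule.subset_span ⟨(i, j), rfl⟩
  have hab := h.mul_left 0
  have hbb := h.mul_mul 0 0
  rw [if_pos rfl] at hbb
  have h00 := hu 0 0
  have h01 := hu 0 1
  have h02 := hu 0 2
  have h11 := hu 1 1
  have h12 := hu 1 2
  have h22 := hu 2 2
  simp only [u, Matrix.cons_val_zero, Matrix.cons_val_one, Matrix.cons_val, Prod.mk_mul_mk, one_mul,
    hab, hbb] at h00 h01 h02 h11 h12 h22
  rw [← pow_two] at h11
  refine h.pow_mem_of (fun i hi => ?_) (fun i => ?_) (fun c => ?_)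
  · interval_cases i
    · simpa using sub_mem h00 h12
    · simpa using sub_mem h01 h12
    · simpa using sub_mem h11 h12
    · simpa using sub_mem h22 h12
  · rw [Subsingleton.elim i 0]
    simpa using sub_mem h02 h12
  · obtain ⟨r, rfl⟩ := Submodule.mem_span_singleton.mp (hC ▸ Submodule.mem_top : c ∈ _)
    simpa using P.smul_mem r h12

/-- Now a² = b², so (a, 1)(b, w) = (0, w) and (a, 1)² - (b, w)² = (0, 1 - w²) span the second
factor. -/
lemma IsStretched.hasSpanningProducts_one_two {a : B} {b : Fin 1 → B}
    (h : IsStretched k 1 2 a b) {w : C} (hC : Submodule.span k {w, 1 - w * w} = ⊤) :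
    HasSpanningProducts k (B × C) := by
  let u : Fin 3 → B × C := ![(1, 1), (a, 1), (b 0, w)]
  refine ⟨u, ?_⟩
  set P := Submodule.span k (Set.range fun p : Fin 3 × Fin 3 => u p.1 * u p.2)
  have hu : ∀ i j, u i * u j ∈ P :=
    fun i j => Submodule.subset_span ⟨(i, j), rfl⟩
  have hab := h.mul_left 0
  have hbb := h.mul_mul 0 0
  rw [if_pos rfl] at hbb
  have h00 := hu 0 0
  have h01 := hu 0 1
  have h02 := hu 0 2
  have h11 := hu 1 1
  have h12 := hu 1 2
  have h22 := hu 2 2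
  simp only [u, Matrix.cons_val_zero, Matrix.cons_val_one, Matrix.cons_val, Prod.mk_mul_mk, one_mul,
    hab, hbb] at h00 h01 h02 h11 h12 h22
  rw [← pow_two] at h11
  have hC' : ∀ c : C, ((0 : B), c) ∈ P := by
    intro c
    obtain ⟨r, t, rfl⟩ := Submodule.mem_span_pair.mp (hC ▸ Submodule.mem_top : c ∈ _)
    have := add_mem (P.smul_mem r h12) (P.smul_mem t (sub_mem h11 h22))
    simpa using this
  refine h.pow_mem_of (fun i hi => ?_) (fun i => ?_) hC'
  · interval_cases i
    · simpa using sub_mem h00 (hC' 1)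
    · simpa using sub_mem h01 (hC' 1)
    · simpa using sub_mem h11 (hC' 1)
  · rw [Subsingleton.elim i 0]
    simpa using sub_mem h02 (hC' w)

end Cases

/-- The algebra `A` has a basis `1, b 0, …, b 3, σ` where the `b i` are orthogonal of square `σ`
and multiply `σ` to zero. -/
def IsOrthogonalAlgebra (k A : Type*) [Field k] [CommRing A] [Algebra k A] : Prop :=
  ∃ (b : Fin 4 → A) (σ : A), (∀ i j, b i * b j = if i = j then σ else 0) ∧
    (∀ i, σ * b i = 0) ∧ Submodule.span k ({1, σ} ∪ Set.range b) = ⊤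

/-- For s = 2 the element a has the same square as the `b i`, and joins them as a fourth orthogonal
vector. -/
lemma IsStretched.isOrthogonalAlgebra {B : Type*} [CommRing B] [Algebra k B] {a : B}
    {b : Fin 3 → B} (h : IsStretched k 3 2 a b) : IsOrthogonalAlgebra k B := by
  refine ⟨Fin.cons a b, a ^ 2, fun i j => ?_, fun i => ?_, ?_⟩
  · refine Fin.cases ?_ (fun i => ?_) i <;> refine Fin.cases ?_ (fun j => ?_) j
    · simp [pow_two]
    · simp [h.mul_left, (Fin.succ_ne_zero j).symm]
    · simp [mul_comm _ a, h.mul_left, Fin.succ_ne_zero i]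
    · simp [h.mul_mul]
  · refine Fin.cases ?_ (fun i => ?_) i
    · simpa [← pow_succ] using h.pow_eq_zero
    · simp [pow_two, mul_assoc, h.mul_left]
  · rw [eq_top_iff, ← h.span_eq_top]
    refine Submodule.span_mono ?_
    rintro _ (⟨i, rfl⟩ | ⟨i, rfl⟩)
    · fin_cases i
      · left; simp
      · right; exact ⟨0, by simp⟩
      · left; simp
    · right; exact ⟨i.succ, by simp⟩

lemma IsOrthogonalAlgebra.of_algEquiv {A A' : Type*} [CommRing A] [Algebra k A] [CommRing A']
    [Algebra k A'] (h : IsOrthogonalAlgebra k A) (f : A ≃ₐ[k] A') : IsOrthogonalAlgebra k A' := by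
  obtain ⟨b, σ, h1, h2, h3⟩ := h
  refine ⟨fun i => f (b i), f σ, fun i j => ?_, fun i => ?_, ?_⟩
  · rw [← map_mul, h1, apply_ite f, map_zero]
  · rw [← map_mul, h2, map_zero]
  · have := congrArg (Submodule.map f.toLinearMap) h3
    rw [Submodule.map_span, Submodule.map_top, LinearMap.range_eq_top.mpr f.surjective,
      Set.image_union, ← Set.range_comp] at this
    rw [← this, Set.image_pair]
    simp
    rfl

variable [IsAlgClosed k]

/-- The factor `B` is either stretched, and then finitely many (n, s) fit in dimension six, or has
Hilbert function (1,2,2,1) and fills everything. -/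
theorem structure_of_isLocalRing_prod (h2 : (2 : k) ≠ 0) (h3 : (3 : k) ≠ 0) {B C : Type*}
    [CommRing B] [Algebra k B] [FiniteDimensional k B] [IsLocalRing B] [CommRing C] [Algebra k C]
    [FiniteDimensional k C] (hfr : finrank k B + finrank k C = 6) {ψ : B →ₗ[k] k}
    (hψ : ∀ a, (∀ b, ψ (a * b) = 0) → a = 0)
    (hcurv : ∀ t, maximalIdeal B ≠ Ideal.span {t} ⊔ maximalIdeal B ^ 2) :
    HasSpanningProducts k (B × C) ∨ Nonempty ((B × C) ≃ₐ[k] AlgA k 3 5 × k) ∨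
      Nonempty ((B × C) ≃ₐ[k] AlgA k 3 6) ∨ IsOrthogonalAlgebra k (B × C) := by
  have hdrop : finrank k C = 0 → Nonempty ((B × C) ≃ₐ[k] B) := by
    intro h
    have := finrank_zero_iff.mp h
    have : Unique C := uniqueOfSubsingleton 0
    exact ⟨AlgEquiv.prodUnique⟩
  by_cases hst : ∃ z, maximalIdeal B ^ 2 = Ideal.span {z} ⊔ maximalIdeal B ^ 3
  · obtain ⟨z, hz⟩ := hst
    -- If m² = 0, then m is the socle, of dimension at most one, and `B` is curvilinear.
    have h0 : maximalIdeal B ^ 2 ≠ ⊥ := by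
      intro h0
      have hsoc : ∀ s ∈ maximalIdeal B, ∀ r ∈ maximalIdeal B, r * s = 0 := by
        intro s hs r hr
        have := Ideal.mul_mem_mul hr hs
        rwa [← pow_two, h0] at this
      by_cases hbot : maximalIdeal B = ⊥
      · exact hcurv 0 (by simp [hbot])
      · obtain ⟨s, hs, hs0⟩ := Submodule.exists_mem_ne_zero_of_ne_bot hbot
        refine hcurv s (le_antisymm (fun t ht => ?_) ?_)
        · refine Ideal.mem_sup_left ?_
          rw [eq_smul_of_socle hψ (hsoc s hs) hs0 (hsoc t ht), Algebra.smul_def]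
          exact Ideal.mul_mem_left _ _ (Ideal.mem_span_singleton_self s)
        · exact sup_le ((Ideal.span_singleton_le_iff_mem _).mpr hs) (Ideal.pow_le_self two_ne_zero)
    obtain ⟨n, s, a, b, h, hn⟩ := exists_isStretched h2 hψ h0 hz
    have hn0 : n ≠ 0 := fun h' => hcurv a (by
      rw [← hn h']
      exact (sup_eq_left.mpr (Ideal.pow_le_self two_ne_zero)).symm)
    have h4 := h.finrank_eq
    have h5 := h.two_le
    obtain ⟨rfl, rfl⟩ | ⟨rfl, rfl⟩ | ⟨rfl, rfl⟩ | ⟨rfl, rfl⟩ | ⟨rfl, rfl⟩ | ⟨rfl, rfl⟩ :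
        (n = 1 ∧ s = 4) ∨ (n = 1 ∧ s = 3) ∨ (n = 1 ∧ s = 2) ∨ (n = 2 ∧ s = 2) ∨ (n = 2 ∧ s = 3) ∨
        (n = 3 ∧ s = 2) := by omega
    · have := finrank_zero_iff.mp (show finrank k C = 0 by omega)
      exact Or.inl (h.hasSpanningProducts_one_four h2)
    · have hC : finrank k C = 1 := by omega
      have := nontrivial_of_finrank_pos (R := k) (show 0 < finrank k C by omega)
      exact Or.inl (h.hasSpanningProducts_one_three
        ((finrank_eq_one_iff_of_nonzero (1 : C) one_ne_zero).mp hC))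
    · obtain ⟨w, hw⟩ := exists_span_pair_of_finrank_two h2 h3 (show finrank k C = 2 by omega)
      exact Or.inl (h.hasSpanningProducts_one_two hw)
    · have hC : finrank k C = 1 := by omega
      have := nontrivial_of_finrank_pos (R := k) (show 0 < finrank k C by omega)
      have hs := (finrank_eq_one_iff_of_nonzero (1 : C) one_ne_zero).mp hC
      obtain ⟨e⟩ := h.nonempty_algEquiv
      let f : k ≃ₐ[k] C := AlgEquiv.ofBijective (Algebra.ofId k C)
        ⟨(algebraMap k C).injective, fun c => by
          obtain ⟨r, rfl⟩ := Submodule.mem_span_singleton.mp (hs ▸ Submodule.mem_top : c ∈ _)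
          exact ⟨r, Algebra.algebraMap_eq_smul_one r⟩⟩
      exact Or.inr (Or.inl ⟨AlgEquiv.prodCongr e f.symm⟩)
    · obtain ⟨e⟩ := h.nonempty_algEquiv
      obtain ⟨f⟩ := hdrop (by omega)
      exact Or.inr (Or.inr (Or.inl ⟨f.trans e⟩))
    · obtain ⟨f⟩ := hdrop (by omega)
      exact Or.inr (Or.inr (Or.inr (h.isOrthogonalAlgebra.of_algEquiv f.symm)))
  · push Not at hst
    obtain ⟨h6, hu⟩ := exists_span_mul_eq_top_of_not_stretched h2 hψ hcurv hst (by omega)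
    obtain ⟨f⟩ := hdrop (by omega)
    exact Or.inl (HasSpanningProducts.of_surjective hu f.symm.toAlgHom f.symm.surjective)

/-- Either all points are curvilinear and A is monogenic, or a noncurvilinear local factor splits
off. ψ stays nondegenerate on that factor, because an element (a, 0) only pairs with first
components. -/
theorem structure_of_finrank_six (h2 : (2 : k) ≠ 0) (h3 : (3 : k) ≠ 0) {A : Type*} [CommRing A]
    [Algebra k A] (hA : finrank k A = 6) {ψ : A →ₗ[k] k}
    (hψ : ∀ a, (∀ b, ψ (a * b) = 0) → a = 0) :
    HasSpanningProducts k A ∨ Nonempty (A ≃ₐ[k] AlgA k 3 5 × k) ∨ Nonempty (A ≃ₐ[k] AlgA k 3 6) ∨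
      IsOrthogonalAlgebra k A := by
  have : FiniteDimensional k A := FiniteDimensional.of_finrank_pos (by omega)
  by_cases hcurv : ∀ M : Ideal A, M.IsMaximal → ∃ t, M = Ideal.span {t} ⊔ M ^ 2
  · obtain ⟨x, hx⟩ := exists_adjoin_eq_top_of_curvilinear (k := k) hcurv
    have h6 : (6 : k) ≠ 0 := by
      rw [show (6 : k) = 2 * 3 by norm_num]
      exact mul_ne_zero h2 h3
    exact Or.inl (exists_span_mul_eq_top_of_adjoin h6 hA hx)
  push Not at hcurv
  obtain ⟨M, hM, hcurv⟩ := hcurv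
  obtain ⟨I, J, hloc, ⟨e⟩, hI, hm⟩ := exists_algEquiv_prod (k := k) M
  have hcurv' : ∀ t, maximalIdeal (A ⧸ I) ≠ Ideal.span {t} ⊔ maximalIdeal (A ⧸ I) ^ 2 := by
    intro t ht
    obtain ⟨t, rfl⟩ := Ideal.Quotient.mk_surjective t
    refine hcurv t ?_
    have h1 : M.map (Ideal.Quotient.mk I) =
        (Ideal.span {t} ⊔ M ^ 2).map (Ideal.Quotient.mk I) := by
      rw [Ideal.map_sup, Ideal.map_pow, Ideal.map_span, Set.image_singleton, ← hm]
      exact ht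
    have h2 := congrArg (Ideal.comap (Ideal.Quotient.mk I)) h1
    rw [Ideal.comap_map_of_surjective _ Ideal.Quotient.mk_surjective,
      Ideal.comap_map_of_surjective _ Ideal.Quotient.mk_surjective, ← RingHom.ker_eq_comap_bot,
      Ideal.mk_ker, sup_eq_left.mpr (hI.trans (Ideal.pow_le_self two_ne_zero)),
      sup_eq_left.mpr (hI.trans le_sup_right)] at h2
    exact h2
  have hfr : finrank k (A ⧸ I) + finrank k (A ⧸ J) = 6 := by
    rw [← hA, e.toLinearEquiv.finrank_eq, finrank_prod]
  have htr := structure_of_isLocalRing_prod h2 h3 hfr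
    (ψ := ψ ∘ₗ e.symm.toLinearMap ∘ₗ LinearMap.inl k _ _) (fun a ha => ?_) hcurv'
  · rcases htr with h | ⟨⟨f⟩⟩ | ⟨⟨f⟩⟩ | h
    · exact Or.inl (h.of_surjective e.symm.toAlgHom e.symm.surjective)
    · exact Or.inr (Or.inl ⟨e.trans f⟩)
    · exact Or.inr (Or.inr (Or.inl ⟨e.trans f⟩))
    · exact Or.inr (Or.inr (Or.inr (h.of_algEquiv e.symm)))
  · have h0 : e.symm (a, 0) = 0 := by
      refine hψ _ fun b => ?_
      have := ha (e b).1
      simp only [LinearMap.comp_apply, LinearMap.inl_apply, AlgEquiv.toLinearMap_apply] at this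
      rw [← this, ← e.symm_apply_apply b, ← map_mul, e.symm_apply_apply]
      exact congrArg (fun c => ψ (e.symm c)) (Prod.ext rfl (zero_mul _))
    rw [map_eq_zero_iff _ e.symm.injective] at h0
    exact congrArg Prod.fst h0

end Structure

/-! ### Membership of 2 × 2 minors for arbitrary indices. -/

section Minors

variable {R : Type*} [CommRing R] (M : Matrix (Fin 3) (Fin 3) R)

lemma minorsIdeal_le {I : Ideal R}
    (h : ∀ i i' j j', M i j * M i' j' - M i j' * M i' j ∈ I) : minorsIdeal M ≤ I := by
  refine Ideal.span_le.mpr ?_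
  rintro _ ⟨i, i', j, j', -, -, rfl⟩
  rw [Matrix.det_fin_two]
  exact h i i' j j'

lemma mul_sub_mul_mem_minorsIdeal (i i' j j' : Fin 3) :
    M i j * M i' j' - M i j' * M i' j ∈ minorsIdeal M := by
  have key : ∀ i i' j j' : Fin 3, i < i' → j < j' →
      M i j * M i' j' - M i j' * M i' j ∈ minorsIdeal M := by
    intro i i' j j' hi hj
    refine Ideal.subset_span ⟨i, i', j, j', hi, hj, ?_⟩
    rw [Matrix.det_fin_two]
    rfl
  rcases lt_trichotomy i i' with hi | rfl | hi <;> rcases lt_trichotomy j j' with hj | rfl | hj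
  · exact key _ _ _ _ hi hj
  · simp
  · convert neg_mem (key _ _ _ _ hi hj) using 1; ring
  · convert (minorsIdeal M).zero_mem using 1; ring
  · simp
  · convert (minorsIdeal M).zero_mem using 1; ring
  · convert neg_mem (key _ _ _ _ hi hj) using 1; ring
  · simp
  · convert key _ _ _ _ hi hj using 1; ring

end Minors

/-! ### Induction on forms by splitting off a variable. -/

section HomogeneousSum

variable {k σ : Type*} [CommRing k]

/-- Homogeneous polynomials of positive degree are combinations of the variables. -/
lemma MvPolynomial.IsHomogeneous.induction_mul_X {n : ℕ} {P : MvPolynomial σ k → Prop}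
    (h0 : P 0) (hadd : ∀ f g, P f → P g → P (f + g))
    (hX : ∀ i f, f.IsHomogeneous n → P (X i * f)) {f : MvPolynomial σ k}
    (hf : f.IsHomogeneous (n + 1)) : P f := by
  classical
  rw [f.as_sum]
  refine Finset.sum_induction _ P hadd h0 fun d hd => ?_
  have hdeg := hf (mem_support_iff.mp hd)
  obtain ⟨i, hi⟩ : ∃ i, d i ≠ 0 := by
    by_contra! h
    rw [(Finsupp.ext h : d = 0)] at hdeg
    simp at hdeg
  have h1 : Finsupp.single i 1 + (d - Finsupp.single i 1) = d :=
    add_tsub_cancel_of_le (Finsupp.single_le_iff.mpr (Nat.one_le_iff_ne_zero.mpr hi))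
  have h2 : monomial d (coeff d f) = X i * monomial (d - Finsupp.single i 1) (coeff d f) := by
    rw [X, monomial_mul, h1, one_mul]
  rw [h2]
  refine hX i _ (isHomogeneous_monomial _ ?_)
  rw [Pi.one_def, ← Finsupp.degree_eq_weight_one, ← h1, map_add, Finsupp.degree_single] at hdeg
  omega

end HomogeneousSum

/-! ### The ideal of X is generated by quadrics. -/

section Presentation

open Module

variable {k A : Type*} [Field k] [CommRing A] [Algebra k A] {ι : Type*}

/-- The elements `v i` form a basis of the hyperplane `ker ψ`, and `L` is a linear lift of
elements of this hyperplane to linear forms. -/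
structure IsLinearLift (ψ : A →ₗ[k] k) (v : ι → A) (L : A →ₗ[k] MvPolynomial ι k) : Prop where
  isHomogeneous : ∀ a, (L a).IsHomogeneous 1
  aeval_lift : ∀ a, ψ a = 0 → aeval v (L a) = a
  lift_aeval : ∀ f : MvPolynomial ι k, f.IsHomogeneous 1 → L (aeval v f) = f
  apply_aeval : ∀ f : MvPolynomial ι k, f.IsHomogeneous 1 → ψ (aeval v f) = 0

lemma linear_induction {P : MvPolynomial ι k → Prop} (h0 : P 0)
    (hadd : ∀ f g, P f → P g → P (f + g)) (hX : ∀ i (c : k), P (c • X i))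
    {f : MvPolynomial ι k} (hf : f.IsHomogeneous 1) : P f := by
  refine hf.induction_mul_X (P := P) h0 hadd fun i f hf => ?_
  rw [totalDegree_eq_zero_iff_eq_C.mp ((totalDegree_zero_iff_isHomogeneous _).mpr hf), mul_comm,
    ← smul_eq_C_mul]
  exact hX _ _

/-- The assignment `v i` ↦ `X i` is defined on ker ψ; its extension to A is arbitrary. -/
lemma exists_isLinearLift {ψ : A →ₗ[k] k} {v : ι → A} (hv : LinearIndependent k v)
    (hs : Submodule.span k (Set.range v) = LinearMap.ker ψ) : ∃ L, IsLinearLift ψ v L := by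
  have hψv : ∀ i, ψ (v i) = 0 := fun i => by
    have : v i ∈ LinearMap.ker ψ := hs ▸ Submodule.subset_span ⟨i, rfl⟩
    exact this
  let b := Basis.span hv
  obtain ⟨L', hL'⟩ := LinearMap.exists_extend (b.constr k fun i =>
    (⟨X i, isHomogeneous_X k i⟩ : homogeneousSubmodule ι k 1))
  let L := (homogeneousSubmodule ι k 1).subtype ∘ₗ L'
  have hLv : ∀ i, L (v i) = X i := by
    intro i
    have := LinearMap.congr_fun hL' (b i)
    rw [Basis.constr_basis, LinearMap.comp_apply, Submodule.subtype_apply, Basis.span_apply] at this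
    change (L' (v i) : MvPolynomial ι k) = X i
    rw [this]
  refine ⟨L, fun a => (L' a).2, fun a ha => ?_, fun f hf => ?_, fun f hf => ?_⟩
  · have ha' : a ∈ Submodule.span k (Set.range v) := hs ▸ ha
    clear ha
    induction ha' using Submodule.span_induction with
    | mem x hx => obtain ⟨i, rfl⟩ := hx; rw [hLv, aeval_X]
    | zero => simp
    | add x y _ _ hx hy => rw [map_add, map_add, hx, hy]
    | smul c x _ hx => rw [map_smul, map_smul, hx]
  · refine linear_induction (P := fun f => L (aeval v f) = f) (by simp) (fun f g hf hg => ?_)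
      (fun i c => ?_) hf
    · rw [map_add, map_add, hf, hg]
    · rw [map_smul, map_smul, aeval_X, hLv]
  · refine linear_induction (P := fun f => ψ (aeval v f) = 0) (by simp) (fun f g hf hg => ?_)
      (fun i c => ?_) hf
    · rw [map_add, map_add, hf, hg, add_zero]
    · rw [map_smul, map_smul, aeval_X, hψv, smul_zero]

section Lift

variable {ψ : A →ₗ[k] k} (hψ : ∀ a, (∀ b, ψ (a * b) = 0) → a = 0) {v : ι → A}
  {L : A →ₗ[k] MvPolynomial ι k} (hL : IsLinearLift ψ v L) (h1 : ψ 1 = 0)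

include hψ

/-- Two linear conditions on y leave dimension at least 4, so y can be taken outside k · 1. If ψ(y
·) vanished on ker ψ it would be a multiple of ψ, and y would be a scalar. -/
lemma exists_isotropic_pair (hA : finrank k A = 6) (a : A) :
    ∃ y z, ψ y = 0 ∧ ψ (a * y) = 0 ∧ ψ z = 0 ∧ ψ (y * z) ≠ 0 := by
  have hnt : Nontrivial A := nontrivial_of_finrank_pos (R := k) (by omega)
  have : FiniteDimensional k A := FiniteDimensional.of_finrank_pos (by omega)
  let T : A →ₗ[k] k × k := ψ.prod (ψ ∘ₗ LinearMap.mulLeft k a)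
  obtain ⟨y, hy, hy1⟩ : ∃ y ∈ LinearMap.ker T, y ∉ Submodule.span k {(1 : A)} := by
    by_contra! h
    have h2 := Submodule.finrank_mono (show LinearMap.ker T ≤ Submodule.span k {(1 : A)} from h)
    have h3 := T.finrank_range_add_finrank_ker
    have h4 := Submodule.finrank_le (LinearMap.range T)
    rw [finrank_span_singleton one_ne_zero] at h2
    rw [finrank_prod, finrank_self] at h4
    omega
  have hy' : ψ y = 0 ∧ ψ (a * y) = 0 := by simpa [T] using hy
  obtain ⟨t, ht⟩ : ∃ t, ψ t ≠ 0 := by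
    by_contra! h
    exact one_ne_zero (hψ 1 fun b => h _)
  by_contra! h
  have hz : ∀ z, ψ z = 0 → ψ (y * z) = 0 := fun z hz => h y z hy'.1 hy'.2 hz
  refine hy1 (Submodule.mem_span_singleton.mpr ⟨ψ (y * t) / ψ t, ?_⟩)
  symm
  rw [← sub_eq_zero]
  refine hψ _ fun b => ?_
  have h2 := hz (b - (ψ b / ψ t) • t) (by
    rw [map_sub, map_smul, smul_eq_mul, div_mul_cancel₀ _ ht, sub_self])
  rw [mul_sub, mul_smul_comm, map_sub, map_smul, smul_eq_mul] at h2
  rw [sub_mul, smul_one_mul, map_sub, map_smul, smul_eq_mul]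
  linear_combination h2

include hL h1

variable {J : Ideal (MvPolynomial ι k)} (hJ : ∀ f, f.IsHomogeneous 2 → aeval v f = 0 → f ∈ J)

include hJ

/-- Modulo J a quadric depends only on its value. Write q ≡ l·m + c·y·z with l = `L 1` and y, z as
in `exists_isotropic_pair`. The choice of y puts (value of x)·y in ker ψ, so x·y is again a multiple
of l, and hence so is x·q. -/
lemma exists_mul_sub_mem (hA : finrank k A = 6) {x q : MvPolynomial ι k} (hx : x.IsHomogeneous 1)
    (hq : q.IsHomogeneous 2) : ∃ g : MvPolynomial ι k, g.IsHomogeneous 2 ∧ x * q - L 1 * g ∈ J := by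
  obtain ⟨y, z, hy, hay, hz, hyz⟩ := exists_isotropic_pair hψ hA (aeval v x)
  set c := ψ (aeval v q) / ψ (y * z)
  set m := aeval v q - c • (y * z)
  have hm : ψ m = 0 := by
    rw [map_sub, map_smul, smul_eq_mul, div_mul_cancel₀ _ hyz, sub_self]
  have hH := hL.isHomogeneous
  have hj1 : q - L 1 * L m - C c * (L y * L z) ∈ J := by
    refine hJ _ ((hq.sub ((hH _).mul (hH _))).sub (((hH _).mul (hH _)).C_mul c)) ?_
    rw [map_sub, map_sub, map_mul, map_mul, map_mul, hL.aeval_lift _ h1, hL.aeval_lift _ hm,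
      hL.aeval_lift _ hy, hL.aeval_lift _ hz, aeval_C, ← Algebra.smul_def]
    simp [m]
  have hj2 : x * L y - L 1 * L (aeval v x * y) ∈ J := by
    refine hJ _ ((hx.mul (hH _)).sub ((hH _).mul (hH _))) ?_
    rw [map_sub, map_mul, map_mul, hL.aeval_lift _ h1, hL.aeval_lift _ hy, hL.aeval_lift _ hay]
    simp
  refine ⟨x * L m + C c * (L (aeval v x * y) * L z),
    (hx.mul (hH _)).add (((hH _).mul (hH _)).C_mul c), ?_⟩
  convert add_mem (J.mul_mem_left x hj1) (J.mul_mem_left (C c * L z) hj2) using 1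
  ring

lemma exists_sub_mul_mem (hA : finrank k A = 6) (n : ℕ) {f : MvPolynomial ι k}
    (hf : f.IsHomogeneous (n + 3)) :
    ∃ g : MvPolynomial ι k, g.IsHomogeneous (n + 2) ∧ f - L 1 * g ∈ J := by
  induction n generalizing f with
  | zero =>
    refine hf.induction_mul_X (n := 2)
      (P := fun f => ∃ g : MvPolynomial ι k, g.IsHomogeneous (0 + 2) ∧ f - L 1 * g ∈ J)
      ⟨0, isHomogeneous_zero _ _ _, by simp⟩ ?_ fun i f hf => ?_
    · rintro f f' ⟨g, hg, h⟩ ⟨g', hg', h'⟩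
      exact ⟨g + g', hg.add hg', by convert add_mem h h' using 1; ring⟩
    · exact exists_mul_sub_mem hψ hL h1 hJ hA (isHomogeneous_X _ _) hf
  | succ n ih =>
    refine hf.induction_mul_X (n := n + 3)
      (P := fun f => ∃ g : MvPolynomial ι k, g.IsHomogeneous (n + 1 + 2) ∧ f - L 1 * g ∈ J)
      ⟨0, isHomogeneous_zero _ _ _, by simp⟩ ?_ fun i f hf => ?_
    · rintro f f' ⟨g, hg, h⟩ ⟨g', hg', h'⟩
      exact ⟨g + g', hg.add hg', by convert add_mem h h' using 1; ring⟩
    · obtain ⟨g, hg, h⟩ := ih hf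
      refine ⟨X i * g, ?_, ?_⟩
      · have := (isHomogeneous_X k i).mul hg
        rwa [show 1 + (n + 2) = n + 1 + 2 by omega] at this
      · convert J.mul_mem_left (X i) h using 1
        ring

/-- From degree 3 on, a form is `L 1` times a form of lower degree modulo J. As `L 1` has value 1,
that form vanishes at v as well, so the degree descends to 2. -/
theorem mem_of_aeval_eq_zero (hA : finrank k A = 6) (hJ0 : ∀ f ∈ J, aeval v f = 0) (n : ℕ)
    {f : MvPolynomial ι k} (hf : f.IsHomogeneous n) (hfv : aeval v f = 0) : f ∈ J := by
  have hnt : Nontrivial A := nontrivial_of_finrank_pos (R := k) (by omega)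
  induction n using Nat.strong_induction_on generalizing f with
  | _ n ih =>
    match n, ih with
    | 0, _ =>
      rw [totalDegree_eq_zero_iff_eq_C.mp ((totalDegree_zero_iff_isHomogeneous _).mpr hf),
        aeval_C, map_eq_zero_iff _ (algebraMap k A).injective] at hfv
      rw [totalDegree_eq_zero_iff_eq_C.mp ((totalDegree_zero_iff_isHomogeneous _).mpr hf), hfv, C_0]
      exact J.zero_mem
    | 1, _ =>
      rw [← hL.lift_aeval f hf, hfv, map_zero]
      exact J.zero_mem
    | 2, _ => exact hJ f hf hfv
    | n + 3, ih =>
      obtain ⟨g, hg, h⟩ := exists_sub_mul_mem hψ hL h1 hJ hA n hf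
      have h' := hJ0 _ h
      rw [map_sub, hfv, map_mul, hL.aeval_lift _ h1, one_mul, zero_sub, neg_eq_zero] at h'
      have := add_mem h (J.mul_mem_left (L 1) (ih (n + 2) (by omega) hg h'))
      rwa [sub_add_cancel] at this

end Lift

end Presentation

/-! ### The explicit matrix for the orthogonal algebra. -/

section OrthogonalMatrix

/-- The matrix attached to two hyperbolic pairs `p, q` and `r, t`. -/
def hyperbolicMatrix {R : Type*} [Zero R] (p q r t : R) : Matrix (Fin 3) (Fin 3) R :=
  !![p, r, q; t, q, p; r, t, 0]

section

variable {R : Type*} [CommRing R]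

lemma minorsIdeal_hyperbolicMatrix_le {p q r t : R} {I : Ideal R} (hpp : p * p ∈ I)
    (hqq : q * q ∈ I) (hrr : r * r ∈ I) (htt : t * t ∈ I) (hpr : p * r ∈ I) (hpt : p * t ∈ I)
    (hqr : q * r ∈ I) (hqt : q * t ∈ I) (hpq : p * q - r * t ∈ I) :
    minorsIdeal (hyperbolicMatrix p q r t) ≤ I := by
  have hlt : ∀ i j : Fin 3, i < j → (i = 0 ∧ j = 1) ∨ (i = 0 ∧ j = 2) ∨ (i = 1 ∧ j = 2) := by decide
  refine Ideal.span_le.mpr ?_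
  rintro _ ⟨i, i', j, j', hi, hj, rfl⟩
  rw [Matrix.det_fin_two]
  rcases hlt _ _ hi with ⟨rfl, rfl⟩ | ⟨rfl, rfl⟩ | ⟨rfl, rfl⟩ <;>
  rcases hlt _ _ hj with ⟨rfl, rfl⟩ | ⟨rfl, rfl⟩ | ⟨rfl, rfl⟩ <;>
  simp only [hyperbolicMatrix, Matrix.submatrix_apply, Matrix.of_apply, Matrix.cons_val_zero,
    Matrix.cons_val_one, Matrix.cons_val, mul_zero, zero_sub, SetLike.mem_coe]
  · exact hpq
  · convert sub_mem hpp hqt using 1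
  · convert sub_mem hpr hqq using 1; ring
  · convert sub_mem hpt hrr using 1
  · exact neg_mem hqr
  · exact neg_mem hqt
  · convert sub_mem htt hqr using 1
  · exact neg_mem hpr
  · exact neg_mem hpt

lemma mem_minorsIdeal_hyperbolicMatrix (p q r t : R) :
    p * r ∈ minorsIdeal (hyperbolicMatrix p q r t) ∧ p * t ∈ minorsIdeal (hyperbolicMatrix p q r t) ∧
    q * r ∈ minorsIdeal (hyperbolicMatrix p q r t) ∧ q * t ∈ minorsIdeal (hyperbolicMatrix p q r t) ∧
    p * p ∈ minorsIdeal (hyperbolicMatrix p q r t) ∧ q * q ∈ minorsIdeal (hyperbolicMatrix p q r t) ∧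
    r * r ∈ minorsIdeal (hyperbolicMatrix p q r t) ∧ t * t ∈ minorsIdeal (hyperbolicMatrix p q r t) ∧
    p * q - r * t ∈ minorsIdeal (hyperbolicMatrix p q r t) := by
  have h := mul_sub_mul_mem_minorsIdeal (hyperbolicMatrix p q r t)
  set J := minorsIdeal (hyperbolicMatrix p q r t)
  have h1 : p * r ∈ J := by convert neg_mem (h 1 2 0 2) using 1; simp [hyperbolicMatrix]
  have h2 : p * t ∈ J := by convert neg_mem (h 1 2 1 2) using 1; simp [hyperbolicMatrix]
  have h3 : q * r ∈ J := by convert neg_mem (h 0 2 0 2) using 1; simp [hyperbolicMatrix]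
  have h4 : q * t ∈ J := by convert neg_mem (h 0 2 1 2) using 1; simp [hyperbolicMatrix]
  refine ⟨h1, h2, h3, h4, ?_, ?_, ?_, ?_, ?_⟩
  · convert add_mem (h 0 1 0 2) h4 using 1; simp [hyperbolicMatrix]
  · convert sub_mem h1 (h 0 1 1 2) using 1; simp [hyperbolicMatrix, mul_comm]
  · convert sub_mem h2 (h 0 2 0 1) using 1; simp [hyperbolicMatrix]
  · convert add_mem (h 1 2 0 1) h3 using 1; simp [hyperbolicMatrix]
  · convert h 0 1 0 1 using 1; simp [hyperbolicMatrix]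

/-- Inverts the change from orthogonal coordinates y to the isotropic ones y₀ ± i y₁, y₂ ± i y₃; h
is 1/2 and i a square root of -1. -/
lemma mul_eq_ite_of_hyperbolic {h i : R} (hh : 2 * h = 1) (hi : i * i = -1) {y : Fin 4 → R}
    (hpr : (y 0 + i * y 1) * (y 2 + i * y 3) = 0) (hpt : (y 0 + i * y 1) * (y 2 - i * y 3) = 0)
    (hqr : (y 0 - i * y 1) * (y 2 + i * y 3) = 0) (hqt : (y 0 - i * y 1) * (y 2 - i * y 3) = 0)
    (hpp : (y 0 + i * y 1) * (y 0 + i * y 1) = 0) (hqq : (y 0 - i * y 1) * (y 0 - i * y 1) = 0)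
    (hrr : (y 2 + i * y 3) * (y 2 + i * y 3) = 0) (htt : (y 2 - i * y 3) * (y 2 - i * y 3) = 0)
    (hpq : (y 0 + i * y 1) * (y 0 - i * y 1) - (y 2 + i * y 3) * (y 2 - i * y 3) = 0) (m n : Fin 4) :
    y m * y n = if m = n then y 0 * y 0 else 0 := by
  have h4 : 4 * h ^ 2 = 1 := by linear_combination (2 * h + 1) * hh
  have h01 : y 0 * y 1 = 0 := by
    linear_combination (-i * h ^ 2) * (hpp - hqq) + 4 * h ^ 2 * y 0 * y 1 * hi - y 0 * y 1 * h4
  have h23 : y 2 * y 3 = 0 := by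
    linear_combination (-i * h ^ 2) * (hrr - htt) + 4 * h ^ 2 * y 2 * y 3 * hi - y 2 * y 3 * h4
  have h02 : y 0 * y 2 = 0 := by
    linear_combination h ^ 2 * (hpr + hpt + hqr + hqt) - y 0 * y 2 * h4
  have h12 : y 1 * y 2 = 0 := by
    linear_combination (-i * h ^ 2) * (hpr + hpt - hqr - hqt) + 4 * h ^ 2 * y 1 * y 2 * hi
      - y 1 * y 2 * h4
  have h03 : y 0 * y 3 = 0 := by
    linear_combination (-i * h ^ 2) * (hpr - hpt + hqr - hqt) + 4 * h ^ 2 * y 0 * y 3 * hi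
      - y 0 * y 3 * h4
  have h13 : y 1 * y 3 = 0 := by
    linear_combination (-h ^ 2) * (hpr - hpt - hqr + hqt) + 4 * h ^ 2 * y 1 * y 3 * hi
      - y 1 * y 3 * h4
  have h11 : y 1 * y 1 = y 0 * y 0 := by
    linear_combination -h * (hpp + hqq) + 2 * h * y 1 ^ 2 * hi + (y 0 ^ 2 - y 1 ^ 2) * hh
  have h33 : y 3 * y 3 = y 2 * y 2 := by
    linear_combination -h * (hrr + htt) + 2 * h * y 3 ^ 2 * hi + (y 2 ^ 2 - y 3 ^ 2) * hh
  have h22 : y 2 * y 2 = y 0 * y 0 := by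
    linear_combination -h * hpq - h * y 1 ^ 2 * hi + h * y 3 ^ 2 * hi
      + h * h11 - h * h33 + (y 0 ^ 2 - y 2 ^ 2) * hh
  have h33' := h33.trans h22
  fin_cases m <;> fin_cases n <;> simp [h01, h02, h03, h12, h13, h23, h11, h22, h33'] <;>
    rw [mul_comm] <;> assumption

end

end OrthogonalMatrix

/-! ### Construction of M from the structure of the algebra. -/

section ExistsMatrix

open Module

variable {k A : Type*} [Field k] [CommRing A] [Algebra k A] {ι : Type*} {ψ : A →ₗ[k] k} {v : ι → A}
  {L : A →ₗ[k] MvPolynomial ι k}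

/-- Once products of linear forms modulo J factor through the algebra, quadrics with value zero lie
in J. -/
lemma IsLinearLift.mk_eq_of_factor (hL : IsLinearLift ψ v L) {J : Ideal (MvPolynomial ι k)}
    {φ : A →ₗ[k] MvPolynomial ι k ⧸ J}
    (hφ : ∀ x y, ψ x = 0 → ψ y = 0 → Ideal.Quotient.mk J (L x * L y) = φ (x * y))
    {f : MvPolynomial ι k} (hf : f.IsHomogeneous 2) : Ideal.Quotient.mk J f = φ (aeval v f) := by
  refine hf.induction_mul_X (n := 1) (P := fun f => Ideal.Quotient.mk J f = φ (aeval v f))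
    (by simp) (fun f g hf hg => ?_) fun i g hg => ?_
  · rw [map_add, map_add, map_add, hf, hg]
  · have hi := isHomogeneous_X k i
    rw [map_mul (aeval v), ← hφ _ _ (hL.apply_aeval _ hi) (hL.apply_aeval _ hg),
      hL.lift_aeval _ hi, hL.lift_aeval _ hg]

/-- M lifts the multiplication table of U and its Gale dual W; orthogonality puts the products in
ker ψ, where the lift is exact. -/
lemma IsLinearLift.exists_matrix_of_hasSpanningProducts (hL : IsLinearLift ψ v L)
    (hA : finrank k A = 6) (hψ : ∀ a, (∀ b, ψ (a * b) = 0) → a = 0)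
    (hu : HasSpanningProducts k A) : ∃ M : Matrix (Fin 3) (Fin 3) (MvPolynomial ι k),
      (∀ i j, (M i j).IsHomogeneous 1) ∧ (∀ f ∈ minorsIdeal M, aeval v f = 0) ∧
      ∀ f, f.IsHomogeneous 2 → aeval v f = 0 → f ∈ minorsIdeal M := by
  obtain ⟨u, hu⟩ := hu
  obtain ⟨w, hw, huw, d, hd⟩ := exists_gale_dual hA hψ hu
  let M : Matrix (Fin 3) (Fin 3) (MvPolynomial ι k) := fun i j => L (u i * w j)
  have hM : ∀ i j, aeval v (M i j) = u i * w j := fun i j => hL.aeval_lift _ (huw i j)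
  refine ⟨M, fun i j => hL.isHomogeneous _, fun f hf => ?_, fun f hf hfv => ?_⟩
  · have : minorsIdeal M ≤ RingHom.ker (aeval v) := minorsIdeal_le _ fun i i' j j' => by
      rw [RingHom.mem_ker, map_sub, map_mul, map_mul, hM, hM, hM, hM]
      ring
    exact this hf
  · let L' : A →ₗ[k] MvPolynomial ι k ⧸ minorsIdeal M :=
      (Ideal.Quotient.mkₐ k (minorsIdeal M)).toLinearMap ∘ₗ L
    let β := (LinearMap.mul k (MvPolynomial ι k ⧸ minorsIdeal M)).compl₁₂ L' L'
    have hβ : ∀ x y, β x y = Ideal.Quotient.mk _ (L x * L y) := fun x y => rfl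
    obtain ⟨φ, hφ⟩ := exists_factor_mul_of_minors hA hψ hu hw huw hd β
      (fun i j i' j' => by rw [hβ, hβ, mul_comm])
      (fun i j i' j' => by
        rw [hβ, hβ, mul_comm (L (u i' * w j))]
        exact Ideal.Quotient.eq.mpr (mul_sub_mul_mem_minorsIdeal M i i' j j'))
    rw [← Ideal.Quotient.eq_zero_iff_mem,
      hL.mk_eq_of_factor (φ := φ) (fun x y hx hy => (hβ x y).symm.trans (hφ x y hx hy)) hf, hfv,
      map_zero]

/-- σ spans a line killed by all `b i` and ψ(σ) ≠ 0, so multiples of σ can be subtracted from the `b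
i` to bring them into ker ψ without changing any product. -/
lemma IsOrthogonalAlgebra.exists_isotropic (hA : finrank k A = 6)
    (hψ : ∀ a, (∀ b, ψ (a * b) = 0) → a = 0) (h : IsOrthogonalAlgebra k A) :
    ∃ (b : Fin 4 → A) (σ : A), (∀ i j, b i * b j = if i = j then σ else 0) ∧
      (∀ i, ψ (b i) = 0) ∧ ψ σ ≠ 0 ∧
      LinearIndependent k (Fin.cons 1 (Fin.cons σ b : Fin 5 → A) : Fin 6 → A) := by
  obtain ⟨b, σ, hb, hσ, hs⟩ := h
  have hσσ : σ * σ = 0 := by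
    have := hb 0 0
    rw [if_pos rfl] at this
    nth_rewrite 2 [← this]
    rw [← mul_assoc, hσ, zero_mul]
  have hli : ∀ b' : Fin 4 → A, ⊤ ≤ Submodule.span k ({1, σ} ∪ Set.range b') →
      LinearIndependent k (Fin.cons 1 (Fin.cons σ b' : Fin 5 → A) : Fin 6 → A) := by
    intro b' hb'
    refine linearIndependent_of_top_le_span_of_card_eq_finrank ?_ (by simp [hA])
    rw [Fin.range_cons, Fin.range_cons]
    convert hb' using 2
    ext x
    simp only [Set.mem_insert_iff, Set.mem_union, Set.mem_singleton_iff, or_assoc]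
  have hσ0 : σ ≠ 0 := by
    have := (hli b hs.ge).ne_zero 1
    exact this
  have hψσ : ψ σ ≠ 0 := by
    intro h0
    refine hσ0 (hψ _ fun x => ?_)
    have hx : x ∈ Submodule.span k ({1, σ} ∪ Set.range b) := hs ▸ Submodule.mem_top
    induction hx using Submodule.span_induction with
    | mem x hx =>
      rcases hx with (rfl | rfl) | ⟨i, rfl⟩
      · rwa [mul_one]
      · rw [hσσ, map_zero]
      · rw [hσ, map_zero]
    | zero => simp
    | add x y _ _ hx hy => rw [mul_add, map_add, hx, hy, add_zero]
    | smul c x _ hx => rw [mul_smul_comm, map_smul, hx, smul_zero]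
  refine ⟨fun i => b i - (ψ (b i) / ψ σ) • σ, σ, fun i j => ?_, fun i => ?_, hψσ, hli _ ?_⟩
  · rw [← hb i j]
    simp only [mul_sub, sub_mul, smul_mul_assoc, mul_smul_comm, hσσ, hσ, mul_comm _ σ, smul_zero,
      sub_zero]
  · rw [map_sub, map_smul, smul_eq_mul, div_mul_cancel₀ _ hψσ, sub_self]
  · rw [← hs, Submodule.span_le]
    have h1 : σ ∈ Submodule.span k ({1, σ} ∪ Set.range fun i => b i - (ψ (b i) / ψ σ) • σ) :=
      Submodule.subset_span (by simp)
    rintro x ((rfl | rfl) | ⟨i, rfl⟩)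
    · exact Submodule.subset_span (by simp)
    · exact h1
    · have h2 : b i - (ψ (b i) / ψ σ) • σ ∈
          Submodule.span k ({1, σ} ∪ Set.range fun i => b i - (ψ (b i) / ψ σ) • σ) :=
        Submodule.subset_span (Or.inr ⟨i, rfl⟩)
      simpa using add_mem h2 (Submodule.smul_mem _ (ψ (b i) / ψ σ) h1)

lemma IsLinearLift.exists_matrix_of_isOrthogonalAlgebra [IsAlgClosed k] (h2 : (2 : k) ≠ 0)
    (hL : IsLinearLift ψ v L)
    (hA : finrank k A = 6) (hψ : ∀ a, (∀ b, ψ (a * b) = 0) → a = 0) (h1 : ψ 1 = 0)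
    (h : IsOrthogonalAlgebra k A) : ∃ M : Matrix (Fin 3) (Fin 3) (MvPolynomial ι k),
      (∀ i j, (M i j).IsHomogeneous 1) ∧ (∀ f ∈ minorsIdeal M, aeval v f = 0) ∧
      ∀ f, f.IsHomogeneous 2 → aeval v f = 0 → f ∈ minorsIdeal M := by
  obtain ⟨b, σ, hb, hψb, hψσ, hli⟩ := h.exists_isotropic hA hψ
  obtain ⟨i, hi⟩ := IsAlgClosed.exists_eq_mul_self (-1 : k)
  let e := basisOfLinearIndependentOfCardEqFinrank hli (by simp [hA])
  have he0 : e 0 = 1 := by simp [e]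
  have he1 : e 1 = σ := by simp [e]
  have heb : ∀ j : Fin 4, e j.succ.succ = b j := fun j => by simp [e]
  have hH := hL.isHomogeneous
  have hb' : ∀ j, aeval v (L (b j)) = b j := fun j => hL.aeval_lift _ (hψb j)
  let p := L (b 0 + i • b 1)
  let q := L (b 0 - i • b 1)
  let r := L (b 2 + i • b 3)
  let t := L (b 2 - i • b 3)
  have hi' : algebraMap k A i * algebraMap k A i = -1 := by
    rw [← map_mul, ← hi, map_neg, map_one]
  have hv : ∀ x, ψ x = 0 → ∀ y, ψ y = 0 → aeval v (L x * L y) = x * y := fun x hx y hy => by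
    rw [map_mul, hL.aeval_lift _ hx, hL.aeval_lift _ hy]
  have hp : ψ (b 0 + i • b 1) = 0 := by simp [hψb]
  have hq : ψ (b 0 - i • b 1) = 0 := by simp [hψb]
  have hr : ψ (b 2 + i • b 3) = 0 := by simp [hψb]
  have ht : ψ (b 2 - i • b 3) = 0 := by simp [hψb]
  refine ⟨hyperbolicMatrix p q r t, fun m n => ?_, fun f hf => ?_, fun f hf hfv => ?_⟩
  · fin_cases m <;> fin_cases n <;>
      first | exact hH _ | exact isHomogeneous_zero _ _ _
  · have h00 : b 0 * b 0 = σ := hb 0 0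
    have h11 : b 1 * b 1 = σ := hb 1 1
    have h22 : b 2 * b 2 = σ := hb 2 2
    have h33 : b 3 * b 3 = σ := hb 3 3
    have h01 : b 0 * b 1 = 0 := hb 0 1
    have h23 : b 2 * b 3 = 0 := hb 2 3
    have : minorsIdeal (hyperbolicMatrix p q r t) ≤ RingHom.ker (aeval v) := by
      refine minorsIdeal_hyperbolicMatrix_le ?_ ?_ ?_ ?_ ?_ ?_ ?_ ?_ ?_ <;>
      rw [RingHom.mem_ker]
      · rw [hv _ hp _ hp, Algebra.smul_def]
        linear_combination h00 + hi' * b 1 * b 1 + 2 * algebraMap k A i * h01 - h11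
      · rw [hv _ hq _ hq, Algebra.smul_def]
        linear_combination h00 + hi' * b 1 * b 1 - 2 * algebraMap k A i * h01 - h11
      · rw [hv _ hr _ hr, Algebra.smul_def]
        linear_combination h22 + hi' * b 3 * b 3 + 2 * algebraMap k A i * h23 - h33
      · rw [hv _ ht _ ht, Algebra.smul_def]
        linear_combination h22 + hi' * b 3 * b 3 - 2 * algebraMap k A i * h23 - h33
      · rw [hv _ hp _ hr]
        simp [mul_add, add_mul, hb]
      · rw [hv _ hp _ ht]
        simp [mul_sub, add_mul, hb]
      · rw [hv _ hq _ hr]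
        simp [mul_add, sub_mul, hb]
      · rw [hv _ hq _ ht]
        simp [mul_sub, sub_mul, hb]
      · rw [map_sub, hv _ hp _ hq, hv _ hr _ ht, Algebra.smul_def, Algebra.smul_def]
        linear_combination h00 - hi' * b 1 * b 1 + h11 - h22 + hi' * b 3 * b 3 - h33
    exact this hf
  · set J := minorsIdeal (hyperbolicMatrix p q r t)
    let L' : A →ₗ[k] MvPolynomial ι k ⧸ J := (Ideal.Quotient.mkₐ k J).toLinearMap ∘ₗ L
    have hL' : ∀ x, L' x = Ideal.Quotient.mk J (L x) := fun x => rfl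
    have hLL : ∀ x y, L x * L y ∈ J → L' x * L' y = 0 := fun x y hxy => by
      rw [hL', hL', ← map_mul]
      exact Ideal.Quotient.eq_zero_iff_mem.mpr hxy
    obtain ⟨m1, m2, m3, m4, m5, m6, m7, m8, m9⟩ := mem_minorsIdeal_hyperbolicMatrix p q r t
    have hy : ∀ m n, L' (b m) * L' (b n) = if m = n then L' (b 0) * L' (b 0) else 0 := by
      have hadd : ∀ x y, L' (x + i • y) = L' x + algebraMap k _ i * L' y := fun x y => by
        rw [map_add, map_smul, Algebra.smul_def]
      have hsub : ∀ x y, L' (x - i • y) = L' x - algebraMap k _ i * L' y := fun x y => by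
        rw [map_sub, map_smul, Algebra.smul_def]
      refine mul_eq_ite_of_hyperbolic (h := algebraMap k _ 2⁻¹) (i := algebraMap k _ i)
        (y := fun m => L' (b m)) ?_ ?_ ?_ ?_ ?_ ?_ ?_ ?_ ?_ ?_ ?_
      · rw [← map_ofNat (algebraMap k (MvPolynomial ι k ⧸ J)) 2, ← map_mul, mul_inv_cancel₀ h2,
          map_one]
      · rw [← map_mul, ← hi, map_neg, map_one]
      · simpa only [hadd, hsub] using hLL _ _ m1
      · simpa only [hadd, hsub] using hLL _ _ m2
      · simpa only [hadd, hsub] using hLL _ _ m3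
      · simpa only [hadd, hsub] using hLL _ _ m4
      · simpa only [hadd, hsub] using hLL _ _ m5
      · simpa only [hadd, hsub] using hLL _ _ m6
      · simpa only [hadd, hsub] using hLL _ _ m7
      · simpa only [hadd, hsub] using hLL _ _ m8
      · have : Ideal.Quotient.mk J (p * q - r * t) = 0 := Ideal.Quotient.eq_zero_iff_mem.mpr m9
        rw [map_sub, map_mul, map_mul] at this
        change L' _ * L' _ - L' _ * L' _ = 0 at this
        simpa only [hadd, hsub] using this
    -- Since ker ψ is spanned by 1 and the `b j`, these values on the basis 1, σ, `b j` are the only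
    -- possible ones; the relations `hy` make them consistent.
    let φ : A →ₗ[k] MvPolynomial ι k ⧸ J := e.constr k
      (Fin.cons (L' 1 * L' 1) (Fin.cons (L' (b 0) * L' (b 0)) fun j => L' 1 * L' (b j) : Fin 5 → _))
    have hφ0 : φ 1 = L' 1 * L' 1 := by
      rw [← he0, Basis.constr_basis, Fin.cons_zero, he0]
    have hφ1 : φ σ = L' (b 0) * L' (b 0) := by
      rw [← he1, Basis.constr_basis]
      rfl
    have hφb : ∀ j, φ (b j) = L' 1 * L' (b j) := fun j => by
      rw [← heb, Basis.constr_basis, Fin.cons_succ, Fin.cons_succ, heb]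
    have hspan : ∀ x, ψ x = 0 → x ∈ Submodule.span k ({1} ∪ Set.range b) := by
      intro x hx
      have h := e.sum_repr x
      rw [Fin.sum_univ_succ, Fin.sum_univ_succ, he0] at h
      simp only [heb] at h
      have h' : e (Fin.succ 0) = σ := he1
      rw [h'] at h
      have hc : e.repr x (Fin.succ 0) = 0 := by
        have := congrArg ψ h
        simp only [map_add, map_sum, map_smul, h1, hψb, hx, smul_eq_mul, mul_zero,
          Finset.sum_const_zero, add_zero, zero_add] at this
        exact (mul_eq_zero.mp this).resolve_right hψσ
      rw [← h, hc, zero_smul, zero_add]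
      refine add_mem (Submodule.smul_mem _ _ (Submodule.subset_span (by simp)))
        (Submodule.sum_mem _ fun j _ => Submodule.smul_mem _ _ (Submodule.subset_span (by simp)))
    rw [← Ideal.Quotient.eq_zero_iff_mem, hL.mk_eq_of_factor (φ := φ) (fun x y hx hy' => ?_) hf,
      hfv, map_zero]
    rw [map_mul]
    change L' x * L' y = φ (x * y)
    refine Submodule.span_induction₂ (p := fun x y _ _ => L' x * L' y = φ (x * y)) ?_ ?_ ?_ ?_ ?_ ?_
      ?_ (hspan x hx) (hspan y hy')
    · rintro x y (rfl | ⟨m, rfl⟩) (rfl | ⟨n, rfl⟩)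
      · rw [mul_one, hφ0]
      · rw [one_mul, hφb]
      · rw [mul_one, hφb, mul_comm]
      · rw [hy, hb, apply_ite φ, hφ1, map_zero]
    · intros; simp
    · intros; simp
    · intro x y z _ _ _ h h'; rw [map_add, add_mul, add_mul, map_add, h, h']
    · intro x y z _ _ _ h h'; rw [map_add, mul_add, mul_add, map_add, h, h']
    · intro c x y _ _ h; rw [map_smul, smul_mul_assoc, smul_mul_assoc, map_smul, h]
    · intro c x y _ _ h; rw [map_smul, mul_smul_comm, mul_smul_comm, map_smul, h]

theorem exists_matrix_of_isEmpty_algEquiv [IsAlgClosed k] (h2 : (2 : k) ≠ 0) (h3 : (3 : k) ≠ 0)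
    (hA : finrank k A = 6) (hψ : ∀ a, (∀ b, ψ (a * b) = 0) → a = 0) (h1 : ψ 1 = 0)
    (hv : LinearIndependent k v) (hs : Submodule.span k (Set.range v) = LinearMap.ker ψ)
    (he : IsEmpty (A ≃ₐ[k] AlgA k 3 5 × k)) (he' : IsEmpty (A ≃ₐ[k] AlgA k 3 6)) :
    ∃ M : Matrix (Fin 3) (Fin 3) (MvPolynomial ι k),
      (∀ i j, (M i j).IsHomogeneous 1) ∧ (∀ f ∈ minorsIdeal M, aeval v f = 0) ∧
      ∀ n f, f.IsHomogeneous n → aeval v f = 0 → f ∈ minorsIdeal M := by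
  obtain ⟨L, hL⟩ := exists_isLinearLift hv hs
  have : ∃ M : Matrix (Fin 3) (Fin 3) (MvPolynomial ι k),
      (∀ i j, (M i j).IsHomogeneous 1) ∧ (∀ f ∈ minorsIdeal M, aeval v f = 0) ∧
      ∀ f, f.IsHomogeneous 2 → aeval v f = 0 → f ∈ minorsIdeal M := by
    rcases structure_of_finrank_six h2 h3 hA hψ with h | h | h | h
    · exact hL.exists_matrix_of_hasSpanningProducts hA hψ h
    · exact (not_nonempty_iff.mpr he h).elim
    · exact (not_nonempty_iff.mpr he' h).elim
    · exact hL.exists_matrix_of_isOrthogonalAlgebra h2 hA hψ h1 h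
  obtain ⟨M, hM, hM0, hM2⟩ := this
  exact ⟨M, hM, hM0, fun n f hf hfv => mem_of_aeval_eq_zero hψ hL h1 hM2 hA hM0 n hf hfv⟩

end ExistsMatrix

/-! ### Finite injective dimension forces a simple socle modulo a nonzerodivisor. -/

section Gorenstein

open CategoryTheory.Abelian IsLocalRing

variable {R : Type u} [CommRing R]

/-- A short exact sequence of modules, as a short exact sequence in the module category. -/
lemma exists_shortExact_moduleCat {M₁ M₂ M₃ : Type u} [AddCommGroup M₁] [AddCommGroup M₂]
    [AddCommGroup M₃] [Module R M₁] [Module R M₂] [Module R M₃] (f : M₁ →ₗ[R] M₂)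
    (g : M₂ →ₗ[R] M₃) (hf : Function.Injective f) (hg : Function.Surjective g)
    (hfg : Function.Exact f g) :
    ∃ h : ModuleCat.ofHom f ≫ ModuleCat.ofHom g = 0,
      (ShortComplex.mk (ModuleCat.ofHom f) (ModuleCat.ofHom g) h).ShortExact := by
  have h : ModuleCat.ofHom f ≫ ModuleCat.ofHom g = 0 := by
    ext x
    exact (hfg (f x)).mpr ⟨x, rfl⟩
  exact ⟨h, ModuleCat.shortComplex_shortExact _ hfg hf hg⟩

/-- For a nonzerodivisor `l`, the sequence `0 → R → R → R/l → 0`. -/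
lemma exact_mul_mk (l : R) :
    Function.Exact (LinearMap.mulLeft R l) (Submodule.mkQ (Ideal.span {l})) := by
  intro x
  simp only [Submodule.mkQ_apply, Submodule.Quotient.mk_eq_zero, Ideal.mem_span_singleton]
  exact ⟨fun ⟨y, hy⟩ => ⟨y, hy.symm⟩, fun ⟨y, hy⟩ => ⟨y, hy.symm⟩⟩

lemma ext_eq_zero_of_projective {P Y : ModuleCat.{u} R} [Projective P] {i : ℕ} (hi : 1 ≤ i)
    (e : Ext P Y i) : e = 0 := by
  obtain ⟨j, rfl⟩ : ∃ j, i = j + 1 := ⟨i - 1, by omega⟩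
  exact Ext.eq_zero_of_projective e

/-- Multiplication by l can be moved to the source R/l, where it is zero. -/
lemma ext_comp_mulLeft_eq_zero (l : R) {i : ℕ}
    (x : Ext (ModuleCat.of R (R ⧸ Ideal.span {l})) (ModuleCat.of R R) i) :
    x.comp (Ext.mk₀ (ModuleCat.ofHom (LinearMap.mulLeft R l))) (add_zero i) = 0 := by
  have e1 : ModuleCat.ofHom (LinearMap.mulLeft R l) = l • 𝟙 (ModuleCat.of R R) := by
    ext; simp
  have e2 : l • 𝟙 (ModuleCat.of R (R ⧸ Ideal.span {l})) = 0 := by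
    ext
    change (Submodule.Quotient.mk (l * 1) : R ⧸ Ideal.span {l}) = 0
    rw [Submodule.Quotient.mk_eq_zero, mul_one]
    exact Ideal.mem_span_singleton_self l
  rw [e1, Ext.mk₀_smul, Ext.comp_smul, Ext.comp_mk₀_id, ← Ext.mk₀_id_comp x, ← Ext.smul_comp,
    ← Ext.mk₀_smul, e2, Ext.mk₀_zero, Ext.zero_comp]

/-- R/l has projective dimension at most one. -/
lemma ext_quotient_span_eq_zero {l : R} (hl : l ∈ nonZeroDivisors R) {i : ℕ} (hi : 2 ≤ i)
    (e : Ext (ModuleCat.of R (R ⧸ Ideal.span {l})) (ModuleCat.of R R) i) : e = 0 := by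
  obtain ⟨h, hS⟩ := exists_shortExact_moduleCat (LinearMap.mulLeft R l)
    (Submodule.mkQ (Ideal.span {l})) (fun a b hab => (mul_cancel_left_mem_nonZeroDivisors hl).mp hab)
    (Submodule.mkQ_surjective _) (exact_mul_mk l)
  obtain ⟨j, rfl⟩ : ∃ j, i = 1 + (j + 1) := ⟨i - 2, by omega⟩
  have : Projective (ModuleCat.of R R) := ModuleCat.projective_of_free (Module.Basis.singleton Unit R)
  obtain ⟨x, hx⟩ := Ext.contravariant_sequence_exact₃ hS _ e
    (ext_eq_zero_of_projective (by omega) _) rfl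
  rw [← hx, Ext.eq_zero_of_projective (n := j) x, Ext.comp_zero]

variable [IsLocalRing R]

/-- A module over a local ring with a socle element `s` modulo `J` gives an extension. -/
lemma exists_shortExact_of_socle {J : Ideal R} {s : R} (hs : s ∉ J)
    (hms : ∀ r ∈ maximalIdeal R, r * s ∈ J) :
    ∃ f : (R ⧸ maximalIdeal R) →ₗ[R] (R ⧸ J), f (Submodule.Quotient.mk 1) = Submodule.Quotient.mk s ∧
      ∃ h : ModuleCat.ofHom f ≫ ModuleCat.ofHom (Submodule.factor (le_sup_left : J ≤ J ⊔ Ideal.span {s}))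
        = 0, (ShortComplex.mk _ _ h).ShortExact := by
  let f : (R ⧸ maximalIdeal R) →ₗ[R] (R ⧸ J) :=
    Submodule.liftQ _ ((Submodule.mkQ J).comp (LinearMap.mulRight R s)) (by
      intro r hr
      simpa using (Submodule.Quotient.mk_eq_zero J).mpr (hms r hr))
  have hf : ∀ r, f (Submodule.Quotient.mk r) = Submodule.Quotient.mk (r * s) := fun r => rfl
  refine ⟨f, by rw [hf, one_mul], exists_shortExact_moduleCat _ _ ?_ ?_ ?_⟩
  · rw [injective_iff_map_eq_zero]
    intro x hx
    obtain ⟨r, rfl⟩ := Submodule.Quotient.mk_surjective _ x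
    rw [hf, Submodule.Quotient.mk_eq_zero] at hx
    rw [Submodule.Quotient.mk_eq_zero]
    by_contra hr
    rw [mem_maximalIdeal, mem_nonunits_iff, not_not] at hr
    exact hs ((Ideal.unit_mul_mem_iff_mem J hr).mp hx)
  · exact Submodule.factor_surjective _
  · intro x
    obtain ⟨r, rfl⟩ := Submodule.Quotient.mk_surjective _ x
    rw [show Submodule.factor (le_sup_left : J ≤ J ⊔ Ideal.span {s}) (Submodule.Quotient.mk r) =
      Submodule.Quotient.mk r from rfl, Submodule.Quotient.mk_eq_zero]
    constructor
    · intro h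
      obtain ⟨j, hj, y, hy, rfl⟩ := Submodule.mem_sup.mp h
      obtain ⟨t, rfl⟩ := Ideal.mem_span_singleton'.mp hy
      refine ⟨Submodule.Quotient.mk t, ?_⟩
      rw [hf, Submodule.Quotient.eq]
      simpa using hj
    · rintro ⟨y, hy⟩
      obtain ⟨t, rfl⟩ := Submodule.Quotient.mk_surjective _ y
      rw [hf, Submodule.Quotient.eq] at hy
      have : r = -(t * s - r) + t * s := by ring
      rw [this]
      exact Ideal.add_mem _ (neg_mem (Ideal.mem_sup_left hy))
        (Ideal.mem_sup_right (Ideal.mem_span_singleton'.mpr ⟨t, rfl⟩))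

/-- Take s in the last power of the maximal ideal not contained in J. -/
lemma exists_socle {J : Ideal R} (hJ : J ≠ ⊤) {N : ℕ} (hN : maximalIdeal R ^ N ≤ J) :
    ∃ s ∉ J, ∀ r ∈ maximalIdeal R, r * s ∈ J := by
  classical
  have hex : ∃ N, maximalIdeal R ^ N ≤ J := ⟨N, hN⟩
  obtain ⟨M, hM⟩ : ∃ M, Nat.find hex = M + 1 := by
    refine Nat.exists_eq_succ_of_ne_zero fun h0 => hJ ?_
    have := Nat.find_spec hex
    rw [h0, pow_zero, Ideal.one_eq_top] at this
    exact top_le_iff.mp this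
  have h1 := Nat.find_min hex (m := M) (by omega)
  obtain ⟨s, hs, hsJ⟩ := SetLike.not_le_iff_exists.mp h1
  refine ⟨s, hsJ, fun r hr => ?_⟩
  have h2 := Nat.find_spec hex
  rw [hM, pow_succ'] at h2
  exact h2 (Ideal.mul_mem_mul hr hs)

variable [IsNoetherianRing R]

/-- Descending induction on i, with d bounding n - i. The residue field embeds in R/l with cokernel
some R/J, so its Ext^i sits between Ext^i(R/l, R) = 0 and an Ext^(i+1) that vanishes by induction.
Noetherian induction then passes from the residue field to every R/J. -/
lemma ext_quotient_eq_zero {l : R} (hl : l ∈ nonZeroDivisors R) {N : ℕ} (hlm : l ∈ maximalIdeal R)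
    (hN : maximalIdeal R ^ N ≤ Ideal.span {l}) {n : ℕ}
    (hn : HasInjectiveDimensionLT (ModuleCat.of R R) n) :
    ∀ (d i : ℕ), 2 ≤ i → n ≤ i + d → ∀ J : Ideal R, maximalIdeal R ^ N ≤ J →
      ∀ e : Ext (ModuleCat.of R (R ⧸ J)) (ModuleCat.of R R) i, e = 0 := by
  intro d
  induction d with
  | zero => exact fun i _ hi J _ e => Ext.eq_zero_of_hasInjectiveDimensionLT e n hi
  | succ d ih =>
    intro i hi hid
    have hk : ∀ e : Ext (ModuleCat.of R (R ⧸ maximalIdeal R)) (ModuleCat.of R R) i, e = 0 := by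
      intro e
      obtain ⟨s, hs, hms⟩ := exists_socle (J := Ideal.span {l})
        (fun h => (Ideal.span_singleton_eq_top.not.mpr hlm) h) hN
      obtain ⟨f, -, h, hS⟩ := exists_shortExact_of_socle hs hms
      obtain ⟨x, hx⟩ := Ext.contravariant_sequence_exact₁ hS _ e rfl
        (ih (1 + i) (by omega) (by omega) _ (hN.trans le_sup_left) _)
      rw [← hx, ext_quotient_span_eq_zero hl hi x, Ext.comp_zero]
    intro J
    induction J using IsNoetherian.induction with
    | hgt J hJ =>
      intro hNJ e
      by_cases htop : J = ⊤
      · have : Subsingleton (R ⧸ J) := Ideal.Quotient.subsingleton_iff.mpr htop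
        have hz : Limits.IsZero (ModuleCat.of R (R ⧸ J)) := ModuleCat.isZero_of_subsingleton _
        rw [← e.mk₀_id_comp, hz.eq_zero_of_src (𝟙 _), Ext.mk₀_zero, Ext.zero_comp]
      · obtain ⟨s, hs, hms⟩ := exists_socle htop hNJ
        obtain ⟨f, -, h, hS⟩ := exists_shortExact_of_socle hs hms
        obtain ⟨x, hx⟩ := Ext.contravariant_sequence_exact₂ hS _ e (hk _)
        rw [← hx, hJ _ (lt_of_le_of_ne le_sup_left fun h => hs ?_) (hNJ.trans le_sup_left) x,
          Ext.comp_zero]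
        rw [h]
        exact Ideal.mem_sup_right (Ideal.mem_span_singleton_self s)

/-- Over a local ring of finite self-injective dimension whose quotient by a nonzerodivisor `l` has
finite length, the socle of that quotient is simple. -/
theorem socle_simple_of_hasInjectiveDimensionLT {l : R} (hl : l ∈ nonZeroDivisors R) {N : ℕ}
    (hlm : l ∈ maximalIdeal R)
    (hN : maximalIdeal R ^ N ≤ Ideal.span {l}) {n : ℕ}
    (hn : HasInjectiveDimensionLT (ModuleCat.of R R) n) {s₁ s₂ : R} (hs : s₁ ∉ Ideal.span {l})
    (h₁ : ∀ r ∈ maximalIdeal R, r * s₁ ∈ Ideal.span {l})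
    (h₂ : ∀ r ∈ maximalIdeal R, r * s₂ ∈ Ideal.span {l}) :
    ∃ c, s₂ - c * s₁ ∈ Ideal.span {l} := by
  by_cases hs₂ : s₂ ∈ Ideal.span {l}
  · exact ⟨0, by simpa using hs₂⟩
  obtain ⟨h, hS⟩ := exists_shortExact_moduleCat (LinearMap.mulLeft R l)
    (Submodule.mkQ (Ideal.span {l})) (fun a b hab => (mul_cancel_left_mem_nonZeroDivisors hl).mp hab)
    (Submodule.mkQ_surjective _) (exact_mul_mk l)
  obtain ⟨f, hf, hh, hQ⟩ := exists_shortExact_of_socle hs h₁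
  obtain ⟨φ, hφ, -⟩ := exists_shortExact_of_socle hs₂ h₂
  -- The extension class pulled back along φ extends over f, the obstruction being in a vanishing
  -- Ext².
  obtain ⟨x₂, hx₂⟩ := Ext.contravariant_sequence_exact₁ hQ _
    ((Ext.mk₀ (ModuleCat.ofHom φ)).comp hS.extClass (zero_add 1)) rfl
    (ext_quotient_eq_zero hl hlm hN hn n 2 le_rfl (by omega) _ (hN.trans le_sup_left) _)
  -- l acts as zero on Ext¹(R/l, R), so the class comes from an endomorphism g of R/l. Below, φ
  -- equals f followed by g, because Hom from the residue field to R is zero; the scalar c is g(1).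
  obtain ⟨x₃, hx₃⟩ := Ext.covariant_sequence_exact₁ _ hS x₂ (ext_comp_mulLeft_eq_zero l x₂) rfl
  obtain ⟨g, rfl⟩ := Ext.homEquiv₀.symm.surjective x₃
  obtain ⟨y, hy⟩ := Ext.covariant_sequence_exact₃ _ hS
    (Ext.mk₀ (ModuleCat.ofHom φ) + -Ext.mk₀ (ModuleCat.ofHom f ≫ g)) (zero_add 1) (by
      rw [Ext.add_comp, Ext.neg_comp, ← hx₂, ← hx₃, ← sub_eq_add_neg, sub_eq_zero,
        Ext.homEquiv₀_symm_apply, Ext.mk₀_comp_mk₀_assoc])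
  obtain ⟨t, rfl⟩ := Ext.homEquiv₀.symm.surjective y
  have ht : t = 0 := by
    refine ModuleCat.hom_ext (LinearMap.ext fun x => ?_)
    obtain ⟨r, rfl⟩ := Submodule.Quotient.mk_surjective _ x
    have e3 : l * t.hom (Submodule.Quotient.mk r) = 0 := by
      rw [← smul_eq_mul, ← map_smul, ← Submodule.Quotient.mk_smul, smul_eq_mul]
      rw [(Submodule.Quotient.mk_eq_zero _).mpr (Ideal.mul_mem_right r _ hlm), map_zero]
    exact (mul_right_mem_nonZeroDivisors_eq_zero_iff hl).mp (by rw [mul_comm]; exact e3)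
  have e4 : ModuleCat.ofHom φ = ModuleCat.ofHom f ≫ g := by
    apply Ext.homEquiv₀.symm.injective
    rw [ht] at hy
    simp only [Ext.homEquiv₀_symm_apply, Ext.mk₀_zero, Ext.zero_comp] at hy ⊢
    exact (add_neg_eq_zero.mp hy.symm)
  have e5 : φ (Submodule.Quotient.mk 1) = g.hom (f (Submodule.Quotient.mk 1)) := by
    exact congrArg (fun q => q.hom (Submodule.Quotient.mk 1)) e4
  obtain ⟨c, hc⟩ := Submodule.Quotient.mk_surjective _ (g.hom (Submodule.Quotient.mk 1))
  refine ⟨c, ?_⟩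
  rw [hf, hφ] at e5
  have e6 : (Submodule.Quotient.mk s₁ : R ⧸ Ideal.span {l}) = s₁ • Submodule.Quotient.mk 1 := by
    rw [← Submodule.Quotient.mk_smul]; simp
  rw [e6, map_smul, ← hc, ← Submodule.Quotient.mk_smul, Submodule.Quotient.eq] at e5
  rwa [mul_comm, ← smul_eq_mul]

/-- The socle modulo a nonzerodivisor of a ring which is Gorenstein at a maximal ideal. -/
theorem socle_simple_of_isGorensteinLocal {B : Type u} [CommRing B] {m : Ideal B}
    [m.IsMaximal] (hG : IsGorensteinLocal (Localization.AtPrime m)) {l : B}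
    (hl : l ∈ nonZeroDivisors B) (hlm : l ∈ m) {N : ℕ} (hN : m ^ N ≤ Ideal.span {l}) {s₁ s₂ : B}
    (hs : s₁ ∉ Ideal.span {l}) (h₁ : ∀ r ∈ m, r * s₁ ∈ Ideal.span {l})
    (h₂ : ∀ r ∈ m, r * s₂ ∈ Ideal.span {l}) : ∃ c, s₂ - c * s₁ ∈ Ideal.span {l} := by
  set R := Localization.AtPrime m
  obtain ⟨⟨hnoeth, -⟩, n, hn⟩ := hG
  -- Elements outside m act invertibly on socle elements, so denominators from the localization can
  -- be removed.
  have hinv : ∀ t ∉ m, ∃ v, v * t - 1 ∈ m := fun t ht => by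
    obtain ⟨v, hv⟩ := Ideal.IsMaximal.exists_inv ‹m.IsMaximal› ht
    obtain ⟨μ, hμ, h⟩ := hv
    exact ⟨v, by rw [← h]; simpa using hμ⟩
  have hmap : (Ideal.span {l}).map (algebraMap B R) = Ideal.span {algebraMap B R l} := by
    rw [Ideal.map_span, Set.image_singleton]
  have hdesc : ∀ x : B, algebraMap B R x ∈ Ideal.span {algebraMap B R l} →
      ∃ t ∉ m, t * x ∈ Ideal.span {l} := by
    intro x hx
    rw [← hmap, IsLocalization.algebraMap_mem_map_algebraMap_iff m.primeCompl] at hx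
    exact hx
  have hmax : maximalIdeal R = m.map (algebraMap B R) :=
    (Localization.AtPrime.map_eq_maximalIdeal (I := m)).symm
  have hsoc : ∀ s : B, (∀ r ∈ m, r * s ∈ Ideal.span {l}) →
      ∀ r ∈ maximalIdeal R, r * algebraMap B R s ∈ Ideal.span {algebraMap B R l} := by
    intro s h r hr
    have : m * Ideal.span {s} ≤ Ideal.span {l} := by
      rw [Ideal.mul_le]
      intro r hr x hx
      obtain ⟨y, rfl⟩ := Ideal.mem_span_singleton'.mp hx
      rw [mul_left_comm]
      exact Ideal.mul_mem_left _ _ (h r hr)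
    rw [← hmap]
    refine Ideal.map_mono this ?_
    rw [Ideal.map_mul, Ideal.map_span, Set.image_singleton, ← hmax]
    exact Ideal.mul_mem_mul hr (Ideal.mem_span_singleton_self _)
  obtain ⟨c, hc⟩ := socle_simple_of_hasInjectiveDimensionLT (R := R) (l := algebraMap B R l)
    (N := N) (s₁ := algebraMap B R s₁) (s₂ := algebraMap B R s₂)
    (IsLocalization.map_nonZeroDivisors_le m.primeCompl R ⟨l, hl, rfl⟩)
    (hmax ▸ Ideal.mem_map_of_mem _ hlm)
    (by rw [hmax, ← Ideal.map_pow, ← hmap]; exact Ideal.map_mono hN) hn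
    (fun h => by
      obtain ⟨t, ht, hts⟩ := hdesc _ h
      obtain ⟨v, hv⟩ := hinv t ht
      have : s₁ = v * (t * s₁) - (v * t - 1) * s₁ := by ring
      exact hs (this ▸ sub_mem (Ideal.mul_mem_left _ _ hts) (h₁ _ hv))) (hsoc _ h₁) (hsoc _ h₂)
  obtain ⟨a, t, rfl⟩ := IsLocalization.exists_mk'_eq m.primeCompl c
  obtain ⟨u, hu, hus⟩ := hdesc (t * s₂ - a * s₁) (by
    have : algebraMap B R (t * s₂ - a * s₁) = algebraMap B R t *
        (algebraMap B R s₂ - IsLocalization.mk' R a t * algebraMap B R s₁) := by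
      rw [mul_sub, ← mul_assoc, IsLocalization.mk'_spec', map_sub, map_mul, map_mul]
    rw [this]
    exact Ideal.mul_mem_left _ _ hc)
  obtain ⟨v, hv⟩ := hinv (u * t) (fun h =>
    (Ideal.IsPrime.mem_or_mem inferInstance h).elim hu t.2)
  refine ⟨v * u * a, ?_⟩
  have : s₂ - v * u * a * s₁ = v * (u * (t * s₂ - a * s₁)) - (v * (u * t) - 1) * s₂ := by ring
  rw [this]
  exact sub_mem (Ideal.mul_mem_left _ _ hus) (h₂ _ hv)

end Gorenstein

/-! ### Homogeneous components of products. -/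

section HomogeneousComponent

variable {k σ : Type*} [CommRing k]

lemma MvPolynomial.coe_decompose_eq (f : MvPolynomial σ k) (n : ℕ) :
    (DirectSum.decompose (homogeneousSubmodule σ k) f n : MvPolynomial σ k) =
      homogeneousComponent n f :=
  decomposition.decompose'_apply f n

lemma MvPolynomial.IsHomogeneous.homogeneousComponent_add_mul {d : ℕ} {g : MvPolynomial σ k}
    (hg : g.IsHomogeneous d) (f : MvPolynomial σ k) (n : ℕ) :
    homogeneousComponent (d + n) (g * f) = g * homogeneousComponent n f := by
  rw [← coe_decompose_eq, ← coe_decompose_eq]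
  exact DirectSum.coe_decompose_mul_add_of_left_mem _ hg

lemma MvPolynomial.IsHomogeneous.homogeneousComponent_mul_of_lt {d n : ℕ} {g : MvPolynomial σ k}
    (hg : g.IsHomogeneous d) (f : MvPolynomial σ k) (h : n < d) :
    homogeneousComponent n (g * f) = 0 := by
  rw [← coe_decompose_eq]
  exact DirectSum.coe_decompose_mul_of_left_mem_of_not_le _ hg (by omega)

lemma MvPolynomial.IsHomogeneous.homogeneousComponent_eq_self {d : ℕ} {g : MvPolynomial σ k}
    (hg : g.IsHomogeneous d) : homogeneousComponent d g = g := by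
  rw [homogeneousComponent_of_mem hg, if_pos rfl]

end HomogeneousComponent

/-! ### Affine charts and the Hilbert function. -/

section Chart

open Module

variable {k : Type*} [Field k] {ι : Type*}

/-- The elements `v i` of `K` are the values of the coordinates on an affine chart containing the
projective subscheme defined by `I`, whose ring of functions is `K`. -/
structure IsChart (I : Ideal (MvPolynomial ι k)) {K : Type*} [CommRing K] [Algebra k K]
    (v : ι → K) : Prop where
  aeval_eq_zero_iff : ∀ n (f : MvPolynomial ι k), f.IsHomogeneous n → (aeval v f = 0 ↔ f ∈ I)
  exists_aeval_eq : ∀ x, ∃ n, ∃ f : MvPolynomial ι k, f.IsHomogeneous n ∧ aeval v f = x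
  exists_aeval_eq_one : ∃ f : MvPolynomial ι k, f.IsHomogeneous 1 ∧ aeval v f = 1

variable {K : Type*} [CommRing K] [Algebra k K]

/-- The values of the forms of degree `n`. -/
noncomputable def chartPiece (v : ι → K) (n : ℕ) : Submodule k K :=
  (homogeneousSubmodule ι k n).map (aeval v).toLinearMap

lemma mem_chartPiece {v : ι → K} {n : ℕ} {x : K} :
    x ∈ chartPiece (k := k) v n ↔ ∃ f : MvPolynomial ι k, f.IsHomogeneous n ∧ aeval v f = x := Iff.rfl

lemma chartPiece_one (v : ι → K) : chartPiece (k := k) v 1 = Submodule.span k (Set.range v) := by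
  refine le_antisymm ?_ (Submodule.span_le.mpr ?_)
  · rintro _ ⟨f, hf, rfl⟩
    refine linear_induction (P := fun f => (aeval v).toLinearMap f ∈ Submodule.span k (Set.range v))
      (by simp) (fun f g hf hg => ?_) (fun i c => ?_) hf
    · rw [map_add]; exact add_mem hf hg
    · rw [map_smul]
      exact Submodule.smul_mem _ _ (Submodule.subset_span ⟨i, by simp⟩)
  · rintro _ ⟨i, rfl⟩
    exact mem_chartPiece.mpr ⟨X i, isHomogeneous_X _ _, aeval_X _ _⟩

/-- Once the filtration by degree fails to grow, it is constant. -/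
lemma chartPiece_le_of_two_le {v : ι → K} (h2 : chartPiece (k := k) v 2 ≤ chartPiece v 1) (n : ℕ) :
    chartPiece (k := k) v (n + 1) ≤ chartPiece v 1 := by
  induction n with
  | zero => exact le_rfl
  | succ n ih =>
    intro x hx
    obtain ⟨f, hf, rfl⟩ := mem_chartPiece.mp hx
    refine hf.induction_mul_X (n := n + 1) (P := fun f => aeval v f ∈ chartPiece (k := k) v 1)
      (by simp) (fun f g hf hg => by rw [map_add]; exact add_mem hf hg) fun i f hf => ?_
    obtain ⟨g, hg, hgf⟩ := mem_chartPiece.mp (ih (mem_chartPiece.mpr ⟨f, hf, rfl⟩))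
    refine h2 (mem_chartPiece.mpr ⟨X i * g, (isHomogeneous_X _ _).mul hg, ?_⟩)
    rw [map_mul, map_mul, hgf]

variable {I : Ideal (MvPolynomial ι k)} {v : ι → K} (h : IsChart I v)

include h

namespace IsChart

lemma chartPiece_le_succ (n : ℕ) : chartPiece (k := k) v n ≤ chartPiece v (n + 1) := by
  obtain ⟨l, hl, hl1⟩ := h.exists_aeval_eq_one
  intro x hx
  obtain ⟨f, hf, rfl⟩ := mem_chartPiece.mp hx
  exact mem_chartPiece.mpr ⟨f * l, hf.mul hl, by rw [map_mul, hl1, mul_one]⟩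

lemma chartPiece_mono : Monotone (chartPiece (k := k) v) :=
  monotone_nat_of_le_succ h.chartPiece_le_succ

/-- The Hilbert function of the coordinate ring is the dimension of the pieces. -/
lemma finrank_chartPiece (n : ℕ) : finrank k (chartPiece (k := k) v n) =
    finrank k (quotientGrading (homogeneousSubmodule ι k) I n) := by
  let f : homogeneousSubmodule ι k n →ₗ[k] K :=
    (aeval v).toLinearMap ∘ₗ (homogeneousSubmodule ι k n).subtype
  let g : homogeneousSubmodule ι k n →ₗ[k] MvPolynomial ι k ⧸ I :=
    (Ideal.Quotient.mkₐ k I).toLinearMap ∘ₗ (homogeneousSubmodule ι k n).subtype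
  have hf : chartPiece v n = LinearMap.range f := by
    rw [LinearMap.range_comp, Submodule.range_subtype]; rfl
  have hg : quotientGrading (homogeneousSubmodule ι k) I n = LinearMap.range g := by
    rw [LinearMap.range_comp, Submodule.range_subtype]; rfl
  have hfg : LinearMap.ker f = LinearMap.ker g := by
    ext x
    exact (h.aeval_eq_zero_iff n x x.2).trans Ideal.Quotient.eq_zero_iff_mem.symm
  rw [hf, hg]
  exact (f.quotKerEquivRange.symm ≪≫ₗ Submodule.quotEquivOfEq _ _ hfg ≪≫ₗ
    g.quotKerEquivRange).finrank_eq

/-- The pieces increase with union K and have dimension d in large degree, so one of them is already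
K. -/
lemma finrank_eq {d : ℕ} (hd : 0 < d) (hP : ∀ᶠ t : ℕ in Filter.atTop,
      finrank k (quotientGrading (homogeneousSubmodule ι k) I t) = d) :
    finrank k K = d := by
  obtain ⟨T, hT⟩ := Filter.eventually_atTop.mp hP
  simp only [← h.finrank_chartPiece] at hT
  have htop : chartPiece (k := k) v T = ⊤ := by
    refine top_le_iff.mp fun x _ => ?_
    obtain ⟨n, f, hf, rfl⟩ := h.exists_aeval_eq x
    have hm : aeval v f ∈ chartPiece (k := k) v n := mem_chartPiece.mpr ⟨f, hf, rfl⟩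
    rcases le_total n T with hn | hn
    · exact h.chartPiece_mono hn hm
    · have : FiniteDimensional k (chartPiece (k := k) v n) :=
        FiniteDimensional.of_finrank_pos (by rw [hT n hn]; exact hd)
      rwa [Submodule.eq_of_le_of_finrank_eq (h.chartPiece_mono hn) (by
        rw [hT n hn, hT T le_rfl])]
  rw [← hT T le_rfl, htop, finrank_top]

lemma linearIndependent [Finite ι]
    (h0 : finrank k (I.restrictScalars k ⊓ homogeneousSubmodule ι k 1 : Submodule k _) = 0) :
    LinearIndependent k v := by
  -- Needed because `finrank` is also 0 on infinite-dimensional spaces.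
  have hfd : FiniteDimensional k
      (I.restrictScalars k ⊓ homogeneousSubmodule ι k 1 : Submodule k _) := by
    have : FiniteDimensional k (Submodule.span k (Set.range (X : ι → MvPolynomial ι k))) :=
      FiniteDimensional.span_of_finite k (Set.finite_range _)
    refine Submodule.finiteDimensional_of_le
      (S₂ := Submodule.span k (Set.range (X : ι → MvPolynomial ι k))) ?_
    rintro f ⟨-, hf⟩
    refine linear_induction (by simp) (fun f g hf hg => add_mem hf hg) (fun i c => ?_) hf
    exact Submodule.smul_mem _ _ (Submodule.subset_span ⟨i, rfl⟩)
  have hbot := Submodule.finrank_eq_zero.mp h0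
  have := Fintype.ofFinite ι
  rw [Fintype.linearIndependent_iff]
  intro c hc i
  have hhom : (∑ i, c i • X i : MvPolynomial ι k).IsHomogeneous 1 :=
    IsHomogeneous.sum _ _ _ fun i _ => by
      rw [smul_eq_C_mul]; exact (isHomogeneous_X _ _).C_mul _
  have hmem : (∑ i, c i • X i : MvPolynomial ι k) ∈
      (I.restrictScalars k ⊓ homogeneousSubmodule ι k 1 : Submodule k _) := by
    refine ⟨(h.aeval_eq_zero_iff 1 _ hhom).mp ?_, hhom⟩
    simpa only [map_sum, map_smul, aeval_X] using hc
  rw [hbot, Submodule.mem_bot] at hmem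
  have := congrArg (coeff (Finsupp.single i 1)) hmem
  classical
  simpa [coeff_sum, coeff_smul, coeff_X, Finsupp.single_left_inj] using this

/-- l has value 1 on the chart, so it is a nonzerodivisor modulo I, degree by degree. -/
lemma mem_of_mul_mem (hI : I.IsHomogeneous (homogeneousSubmodule ι k)) {l : MvPolynomial ι k}
    (hl : l.IsHomogeneous 1) (hl1 : aeval v l = 1) {f : MvPolynomial ι k} (hf : l * f ∈ I) :
    f ∈ I := by
  rw [mem_iff_homogeneousComponent_mem hI] at hf ⊢
  intro n
  have h1 := hf (1 + n)
  rw [hl.homogeneousComponent_add_mul] at h1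
  have hc : (homogeneousComponent n f).IsHomogeneous n := homogeneousComponent_isHomogeneous n f
  rw [← h.aeval_eq_zero_iff _ _ (hl.mul hc), map_mul, hl1, one_mul] at h1
  exact (h.aeval_eq_zero_iff _ _ hc).mp h1

lemma constantCoeff_eq_zero [Nontrivial K] (hI : I.IsHomogeneous (homogeneousSubmodule ι k))
    {f : MvPolynomial ι k} (hf : f ∈ I) : constantCoeff f = 0 := by
  have h1 := homogeneousComponent_mem_of_mem hI hf 0
  rw [← h.aeval_eq_zero_iff _ _ (homogeneousComponent_isHomogeneous 0 f), homogeneousComponent_zero,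
    aeval_C, map_eq_zero_iff _ (algebraMap k K).injective] at h1
  exact h1

end IsChart

end Chart

/-! ### From the Gorenstein coordinate ring to a nondegenerate ψ. -/

section Gorenstein

open Module

variable {k : Type u} [Field k] {ι : Type} {K : Type*} [CommRing K] [Algebra k K]
  {I : Ideal (MvPolynomial ι k)} {v : ι → K}

/-- The functional vanishing on the linear forms is nondegenerate when the coordinate ring is
Gorenstein and all forms of degree at least two fill the ring of the chart. -/
lemma IsChart.nondegenerate_of_isGorenstein (h : IsChart I v) [Nontrivial K]
    (hI : I.IsHomogeneous (homogeneousSubmodule ι k)) (hG : IsGorenstein (MvPolynomial ι k ⧸ I))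
    (htop : ∀ n, chartPiece (k := k) v (n + 2) = ⊤) {ψ : K →ₗ[k] k} (hψ0 : ψ ≠ 0)
    (hψ : LinearMap.ker ψ = chartPiece (k := k) v 1) (a : K) (ha : ∀ b, ψ (a * b) = 0) :
    a = 0 := by
  obtain ⟨l, hl, hl1⟩ := h.exists_aeval_eq_one
  let q := Ideal.Quotient.mk I
  -- Its kernel is the irrelevant maximal ideal, the only point where the Gorenstein hypothesis is
  -- used.
  let ε : MvPolynomial ι k ⧸ I →+* k :=
    Ideal.Quotient.lift I constantCoeff fun f hf => h.constantCoeff_eq_zero hI hf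
  let m := RingHom.ker ε
  have hm : m.IsMaximal := RingHom.ker_isMaximal_of_surjective ε fun c => ⟨q (C c), by simp [ε, q]⟩
  have hmq : m = (idealOfVars ι k).map q := by
    ext x
    obtain ⟨f, rfl⟩ := Ideal.Quotient.mk_surjective x
    constructor
    · intro hf
      have hf' : constantCoeff f = 0 := by simpa [m, ε, RingHom.mem_ker] using hf
      refine Ideal.mem_map_of_mem q ?_
      rw [← pow_one (idealOfVars ι k), mem_pow_idealOfVars_iff']
      intro d hd
      rw [(Finsupp.degree_eq_zero_iff d).mp (by omega)]
      exact hf'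
    · intro hf
      refine (Ideal.map_le_iff_le_comap.mpr (Ideal.span_le.mpr ?_) : _ ≤ m) hf
      rintro _ ⟨i, rfl⟩
      change ε (q (X i)) = 0
      simp [ε, q]
  -- Degree at least two already fills K, so every form of degree at least three is divisible by l
  -- modulo I.
  have hsub : ∀ n (f : MvPolynomial ι k), f.IsHomogeneous (n + 3) →
      ∃ g : MvPolynomial ι k, f - l * g ∈ I := by
    intro n f hf
    obtain ⟨g, hg, hgf⟩ := mem_chartPiece.mp
      (htop n ▸ Submodule.mem_top : aeval v f ∈ chartPiece (k := k) v (n + 2))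
    refine ⟨g, (h.aeval_eq_zero_iff (n + 3) _ (hf.sub ?_)).mp ?_⟩
    · have := hl.mul hg
      rwa [show 1 + (n + 2) = n + 3 by omega] at this
    · rw [map_sub, map_mul, hl1, one_mul, hgf, sub_self]
  have hspan : ∀ f g : MvPolynomial ι k, f - l * g ∈ I → q f ∈ Ideal.span {q l} := by
    intro f g hfg
    rw [Ideal.Quotient.eq.mpr hfg]
    exact Ideal.mem_span_singleton.mpr ⟨q g, map_mul q l g⟩
  have hspan' : ∀ f : MvPolynomial ι k, q f ∈ Ideal.span {q l} → ∃ g, f - l * g ∈ I := by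
    intro f hf
    obtain ⟨x, hx⟩ := Ideal.mem_span_singleton.mp hf
    obtain ⟨g, rfl⟩ := Ideal.Quotient.mk_surjective x
    exact ⟨g, Ideal.Quotient.eq.mp (hx.trans (map_mul q l g).symm)⟩
  have hsoc : ∀ s, (∀ i, ∃ g, X i * s - l * g ∈ I) →
      ∀ r ∈ m, r * q s ∈ Ideal.span {q l} := by
    intro s hs r hr
    have hle : m ≤ Submodule.comap (LinearMap.toSpanSingleton _ _ (q s)) (Ideal.span {q l}) := by
      rw [hmq, Ideal.map_le_iff_le_comap, Ideal.span_le]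
      rintro _ ⟨i, rfl⟩
      obtain ⟨g, hg⟩ := hs i
      change q (X i) * q s ∈ Ideal.span {q l}
      rw [← map_mul]
      exact hspan _ g hg
    exact hle hr
  have hψa : a ∈ chartPiece (k := k) v 1 := by
    rw [← hψ, LinearMap.mem_ker, ← mul_one a]
    exact ha 1
  obtain ⟨α, hα, rfl⟩ := mem_chartPiece.mp hψa
  obtain ⟨b, hb⟩ : ∃ b, b ∉ LinearMap.ker ψ := by
    by_contra! hb
    exact hψ0 (LinearMap.ext fun b => hb b)
  -- A quadric with ψ ≠ 0 on its value: modulo l it is a nonzero socle element of degree 2.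
  obtain ⟨s, hs, rfl⟩ := mem_chartPiece.mp
    (htop 0 ▸ Submodule.mem_top : b ∈ chartPiece (k := k) v (0 + 2))
  -- ψ(a ·) = 0 puts every X_i α in l times the linear forms, so α is also a socle element modulo l,
  -- and the simple socle makes it a multiple of s.
  have hex : ∃ c, q α - c * q s ∈ Ideal.span {q l} := by
    refine socle_simple_of_isGorensteinLocal (N := 3) (m := m) (hG m) ?_ ?_ ?_ ?_ ?_ ?_
    · refine mem_nonZeroDivisors_iff_right.mpr fun x hx => ?_
      obtain ⟨f, rfl⟩ := Ideal.Quotient.mk_surjective x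
      refine Ideal.Quotient.eq_zero_iff_mem.mpr (h.mem_of_mul_mem hI hl hl1 ?_)
      rw [mul_comm]
      exact Ideal.Quotient.eq_zero_iff_mem.mp ((map_mul q f l).trans hx)
    · change ε (q l) = 0
      have : constantCoeff l = 0 := hl.coeff_eq_zero (by simp)
      simpa [ε, q] using this
    · rw [hmq, ← Ideal.map_pow, Ideal.map_le_iff_le_comap]
      intro f hf
      rw [mem_pow_idealOfVars_iff'] at hf
      rw [Ideal.mem_comap, ← sum_homogeneousComponent f, map_sum]
      refine Ideal.sum_mem _ fun n _ => ?_
      by_cases hn : n < 3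
      · have : homogeneousComponent n f = 0 := by
          refine homogeneousComponent_eq_zero' _ _ fun d hd hd' => ?_
          exact mem_support_iff.mp hd (hf d (by omega))
        rw [this, map_zero]
        exact zero_mem _
      · obtain ⟨t, rfl⟩ : ∃ t, n = t + 3 := ⟨n - 3, by omega⟩
        obtain ⟨g, hg⟩ := hsub t _ (homogeneousComponent_isHomogeneous (t + 3) f)
        exact hspan _ g hg
    · intro hmem
      obtain ⟨g, hg⟩ := hspan' _ hmem
      have h1 := homogeneousComponent_mem_of_mem hI hg 2
      have hg0 := hl.homogeneousComponent_add_mul g 1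
      rw [map_sub, hs.homogeneousComponent_eq_self, show (2 : ℕ) = 1 + 1 from rfl, hg0] at h1
      have hg1 : (homogeneousComponent 1 g).IsHomogeneous 1 := homogeneousComponent_isHomogeneous 1 g
      have h2 := (h.aeval_eq_zero_iff 2 _ (hs.sub (hl.mul hg1))).mpr h1
      rw [map_sub, map_mul, hl1, one_mul, sub_eq_zero] at h2
      rw [h2, hψ] at hb
      exact hb (mem_chartPiece.mpr ⟨_, hg1, rfl⟩)
    · exact hsoc s fun i => hsub 0 (X i * s) ((isHomogeneous_X k i).mul hs)
    · refine hsoc α fun i => ?_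
      have hker : aeval (R := k) v (X i) * aeval v α ∈ LinearMap.ker ψ := by
        rw [LinearMap.mem_ker, mul_comm]; exact ha _
      rw [hψ] at hker
      obtain ⟨g, hg, hgf⟩ := mem_chartPiece.mp hker
      refine ⟨g, (h.aeval_eq_zero_iff 2 _ (((isHomogeneous_X k i).mul hα).sub (hl.mul hg))).mp ?_⟩
      rw [map_sub, map_mul, map_mul, hl1, one_mul, hgf, sub_self]
  obtain ⟨c, hc⟩ := hex
  obtain ⟨c, rfl⟩ := Ideal.Quotient.mk_surjective c
  rw [← map_mul, ← map_sub] at hc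
  obtain ⟨g, hg⟩ := hspan' _ hc
  -- In degree 1 the multiple of s disappears: α is a constant times l, so a is a scalar, and ψ ≠ 0
  -- makes it zero.
  have h1 := homogeneousComponent_mem_of_mem hI hg 1
  have hg0 := hl.homogeneousComponent_add_mul g 0
  rw [map_sub, map_sub, mul_comm c, hs.homogeneousComponent_mul_of_lt _ (by omega), sub_zero,
    hα.homogeneousComponent_eq_self, show (1 : ℕ) = 1 + 0 from rfl, hg0,
    homogeneousComponent_zero] at h1
  have h2 := (h.aeval_eq_zero_iff 1 _ (hα.sub (by
    have := hl.mul (isHomogeneous_C ι (coeff 0 g))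
    exact this))).mpr h1
  rw [map_sub, map_mul, hl1, one_mul, aeval_C, sub_eq_zero] at h2
  rw [h2]
  by_contra hne
  refine hψ0 (LinearMap.ext fun b => ?_)
  have h3 := ha b
  rw [h2, ← Algebra.smul_def, map_smul, smul_eq_mul] at h3
  refine (mul_eq_zero.mp h3).resolve_left fun h0 => hne ?_
  rw [h0, map_zero]

/-- Nondegeneracy gives linear forms a space of values of dimension 5. Quadrics must give more, or
the filtration would stop short of K, hence they give all six dimensions. -/
theorem IsChart.exists_nondegenerate {X : ProjSubscheme k 4} (hX : X ∈ hilbAG k 4 6 0)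
    {v : Fin 5 → K} (h : IsChart X.ideal v) : finrank k K = 6 ∧ LinearIndependent k v ∧
      ∃ ψ : K →ₗ[k] k, Submodule.span k (Set.range v) = LinearMap.ker ψ ∧ ψ 1 = 0 ∧
        ∀ a, (∀ b, ψ (a * b) = 0) → a = 0 := by
  obtain ⟨hP, hG, hr⟩ := hX
  have h6 : finrank k K = 6 := h.finrank_eq (by omega) (by
    filter_upwards [hP] with t ht
    rw [Polynomial.eval_C] at ht
    exact_mod_cast ht)
  have hnt : Nontrivial K := nontrivial_of_finrank_pos (R := k) (by omega)
  have : FiniteDimensional k K := FiniteDimensional.of_finrank_pos (by omega)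
  have hli : LinearIndependent k v := h.linearIndependent hr
  have h5 : finrank k (chartPiece (k := k) v 1) = 5 := by
    rw [chartPiece_one, finrank_span_eq_card hli, Fintype.card_fin]
  have h2 : chartPiece (k := k) v 2 = ⊤ := by
    refine Submodule.eq_top_of_finrank_eq ?_
    rw [h6]
    have hle := Submodule.finrank_le (chartPiece (k := k) v 2)
    by_contra hne
    have heq := Submodule.eq_of_le_of_finrank_le (h.chartPiece_le_succ 1)
      (show finrank k (chartPiece (k := k) v 2) ≤ _ by omega)
    have : chartPiece (k := k) v 1 = ⊤ := by
      refine top_le_iff.mp fun x _ => ?_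
      obtain ⟨n, f, hf, rfl⟩ := h.exists_aeval_eq x
      exact chartPiece_le_of_two_le heq.ge n
        (h.chartPiece_le_succ n (mem_chartPiece.mpr ⟨f, hf, rfl⟩))
    rw [this, finrank_top] at h5
    omega
  have htop : ∀ n, chartPiece (k := k) v (n + 2) = ⊤ := fun n =>
    top_le_iff.mp (h2 ▸ h.chartPiece_mono (by omega))
  obtain ⟨ψ, hψ0, hψ⟩ := Submodule.exists_le_ker_of_lt_top (chartPiece (k := k) v 1)
    (lt_top_iff_ne_top.mpr fun h' => by rw [h', finrank_top] at h5; omega)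
  have hker : chartPiece (k := k) v 1 = LinearMap.ker ψ := by
    refine Submodule.eq_of_le_of_finrank_le hψ ?_
    have := Submodule.finrank_lt (s := LinearMap.ker ψ) (fun h' => hψ0 (LinearMap.ker_eq_top.mp h'))
    omega
  refine ⟨h6, hli, ψ, by rw [← chartPiece_one, hker], ?_, fun a ha =>
    h.nondegenerate_of_isGorenstein X.isHomogeneous hG htop hψ0 hker.symm a ha⟩
  obtain ⟨l, hl, hl1⟩ := h.exists_aeval_eq_one
  exact hψ (mem_chartPiece.mpr ⟨l, hl, hl1⟩)

end Gorenstein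

/-! ### Isomorphisms of affine schemes over k. -/

section SpecIso

open CategoryTheory.Limits

variable {k : Type u} [Field k]

lemma nonempty_over_iso_spec_iff (K B : Type u) [CommRing K] [Algebra k K] [CommRing B]
    [Algebra k B] : Nonempty (Over.mk (Spec.map (CommRingCat.ofHom (algebraMap k K))) ≅
      Over.mk (Spec.map (CommRingCat.ofHom (algebraMap k B)))) ↔ Nonempty (K ≃ₐ[k] B) := by
  constructor
  · rintro ⟨i⟩
    let f : CommRingCat.of B ⟶ CommRingCat.of K := Spec.preimage i.hom.left
    let g : CommRingCat.of K ⟶ CommRingCat.of B := Spec.preimage i.inv.left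
    have hf : CommRingCat.ofHom (algebraMap k B) ≫ f = CommRingCat.ofHom (algebraMap k K) :=
      Spec.map_injective (by rw [Spec.map_comp, Spec.map_preimage]; exact Over.w i.hom)
    have hg : CommRingCat.ofHom (algebraMap k K) ≫ g = CommRingCat.ofHom (algebraMap k B) :=
      Spec.map_injective (by rw [Spec.map_comp, Spec.map_preimage]; exact Over.w i.inv)
    have hfg : f ≫ g = 𝟙 _ := Spec.map_injective (by
      rw [Spec.map_comp, Spec.map_preimage, Spec.map_preimage, Spec.map_id]
      exact congrArg CommaMorphism.left i.inv_hom_id)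
    have hgf : g ≫ f = 𝟙 _ := Spec.map_injective (by
      rw [Spec.map_comp, Spec.map_preimage, Spec.map_preimage, Spec.map_id]
      exact congrArg CommaMorphism.left i.hom_inv_id)
    refine ⟨AlgEquiv.ofRingEquiv (f := RingEquiv.ofRingHom g.hom f.hom ?_ ?_) fun c => ?_⟩
    · rw [← CommRingCat.hom_comp, hfg]; rfl
    · rw [← CommRingCat.hom_comp, hgf]; rfl
    · exact congrArg (fun φ => φ.hom c) hg
  · rintro ⟨e⟩
    refine ⟨Over.isoMk (Scheme.Spec.mapIso (e.toRingEquiv.toCommRingCatIso).symm.op) ?_⟩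
    change Spec.map _ ≫ Spec.map _ = Spec.map _
    rw [← Spec.map_comp]
    congr 1
    ext c
    exact e.symm.commutes c

end SpecIso

/-! ### A linear nonzerodivisor on the coordinate ring. -/

section LinearForm

variable {k : Type u} [Field k] {n : ℕ} (X : ProjSubscheme k n)

/-- A projective subscheme has a linear form which is a nonzerodivisor on its coordinate ring. -/
lemma ProjSubscheme.exists_linear_mem_nonZeroDivisors [Infinite k] :
    ∃ l : MvPolynomial (Fin (n + 1)) k, l.IsHomogeneous 1 ∧
      Ideal.Quotient.mk X.ideal l ∈ nonZeroDivisors X.CoordRing := by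
  let q := Ideal.Quotient.mk X.ideal
  have hfin := associatedPrimes.finite X.CoordRing X.CoordRing
  let L : (Fin (n + 1) → k) →ₗ[k] MvPolynomial (Fin (n + 1)) k :=
    Fintype.linearCombination k (MvPolynomial.X)
  let W : Ideal X.CoordRing → Submodule k (Fin (n + 1) → k) := fun p =>
    (p.restrictScalars k).comap ((Ideal.Quotient.mkₐ k X.ideal).toLinearMap ∘ₗ L)
  classical
  -- An associated prime containing all variables would be the annihilator of a class that
  -- saturation makes zero. Over an infinite field finitely many proper subspaces do not cover the
  -- linear forms.
  have hW : ⊤ ∉ hfin.toFinset.image W := by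
    intro h
    obtain ⟨p, hp, hpt⟩ := Finset.mem_image.mp h
    rw [Set.Finite.mem_toFinset] at hp
    obtain ⟨hprime, x, hx⟩ := isAssociatedPrime_iff.mp hp
    have hX : ∀ i, q (MvPolynomial.X i) ∈ p := by
      intro i
      have : Pi.single i 1 ∈ W p := hpt ▸ Submodule.mem_top
      change q (L (Pi.single i 1)) ∈ p at this
      rwa [Fintype.linearCombination_apply_single, one_smul] at this
    obtain ⟨f, rfl⟩ := Ideal.Quotient.mk_surjective x
    have hf : q f = 0 := by
      refine Ideal.Quotient.eq_zero_iff_mem.mpr (X.saturated f fun i => ?_)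
      have h1 := hX i
      rw [hx, Submodule.mem_colon_singleton, Submodule.mem_bot] at h1
      exact Ideal.Quotient.eq_zero_iff_mem.mp ((map_mul q _ _).trans h1)
    refine hprime.ne_top ((Ideal.eq_top_iff_one _).mpr ?_)
    rw [hx, Submodule.mem_colon_singleton, Submodule.mem_bot]
    exact (one_smul _ _).trans hf
  obtain ⟨c, hc⟩ : ∃ c, ∀ p ∈ associatedPrimes X.CoordRing X.CoordRing, q (L c) ∉ p := by
    have := Subspace.biUnion_ne_univ_of_top_notMem hW
    obtain ⟨c, hc⟩ := (Set.ne_univ_iff_exists_notMem _).mp this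
    refine ⟨c, fun p hp hcp => hc ?_⟩
    exact Set.mem_iUnion₂.mpr ⟨W p, Finset.mem_image_of_mem _ (hfin.mem_toFinset.mpr hp), hcp⟩
  refine ⟨L c, ?_, ?_⟩
  · rw [Fintype.linearCombination_apply]
    exact IsHomogeneous.sum _ _ _ fun i _ => by
      rw [smul_eq_C_mul]; exact (isHomogeneous_X _ _).C_mul _
  · by_contra h
    have h' : q (L c) ∈ (nonZeroDivisors X.CoordRing : Set X.CoordRing)ᶜ := h
    rw [← biUnion_associatedPrimes_eq_compl_nonZeroDivisors] at h'
    obtain ⟨p, hp, hcp⟩ := Set.mem_iUnion₂.mp h'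
    exact hc p hp hcp

end LinearForm

/-! ### The chart D₊(l). -/

section AwayChart

open HomogeneousLocalization

variable {k : Type u} [Field k] {n : ℕ} (X : ProjSubscheme k n)

/-- The structure of `k`-algebra on the ring of functions on `D₊(l)`. -/
@[reducible]
noncomputable def awayAlgebra (l : X.CoordRing) : Algebra k (Away X.grading l) :=
  ((fromZeroRingHom X.grading (Submonoid.powers l)).comp (algebraMap k (X.grading 0))).toAlgebra

lemma ProjSubscheme.mk_mem_grading {d : ℕ} {f : MvPolynomial (Fin (n + 1)) k}
    (hf : f.IsHomogeneous d) : Ideal.Quotient.mk X.ideal f ∈ X.grading d := ⟨f, hf, rfl⟩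

variable {l : MvPolynomial (Fin (n + 1)) k} (hl : l.IsHomogeneous 1)

/-- The coordinates on the chart `D₊(l)`. -/
noncomputable def awayCoord (i : Fin (n + 1)) : Away X.grading (Ideal.Quotient.mk X.ideal l) :=
  Away.mk X.grading (X.mk_mem_grading hl) 1 (Ideal.Quotient.mk X.ideal (MvPolynomial.X i))
    (X.mk_mem_grading (isHomogeneous_X k i))

attribute [local instance] awayAlgebra

lemma val_aeval_awayCoord (d : ℕ) {f : MvPolynomial (Fin (n + 1)) k} (hf : f.IsHomogeneous d) :
    (aeval (awayCoord X hl) f).val = Localization.mk (Ideal.Quotient.mk X.ideal f)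
      (⟨_, Submonoid.mem_powers _⟩ ^ d : Submonoid.powers (Ideal.Quotient.mk X.ideal l)) := by
  induction d generalizing f with
  | zero =>
    rw [totalDegree_eq_zero_iff_eq_C.mp ((totalDegree_zero_iff_isHomogeneous _).mpr hf), aeval_C]
    rw [pow_zero]
    rfl
  | succ d ih =>
    refine hf.induction_mul_X (n := d) (P := fun f => (aeval (awayCoord X hl) f).val =
      Localization.mk (Ideal.Quotient.mk X.ideal f) (⟨_, Submonoid.mem_powers _⟩ ^ (d + 1) :
        Submonoid.powers (Ideal.Quotient.mk X.ideal l))) ?_ (fun f g hf hg => ?_) fun i f hf => ?_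
    · rw [map_zero, map_zero, val_zero, Localization.mk_zero]
    · rw [map_add, map_add, val_add, hf, hg, Localization.add_mk_self]
    · rw [map_mul, map_mul, val_mul, ih hf, aeval_X, awayCoord, Away.val_mk, Localization.mk_mul]
      rw [pow_succ' (⟨_, Submonoid.mem_powers _⟩ : Submonoid.powers (Ideal.Quotient.mk X.ideal l))]
      congr 2
      exact Subtype.ext (pow_one _)

lemma aeval_awayCoord_self : aeval (awayCoord X hl) l = 1 := by
  rw [HomogeneousLocalization.ext_iff_val, val_aeval_awayCoord X hl 1 hl, val_one, pow_one]
  exact Localization.mk_self (⟨_, Submonoid.mem_powers _⟩ : Submonoid.powers _)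

lemma isChart_awayCoord
    (hnz : Ideal.Quotient.mk X.ideal l ∈ nonZeroDivisors X.CoordRing) :
    IsChart X.ideal (awayCoord X hl) where
  aeval_eq_zero_iff d f hf := by
    rw [HomogeneousLocalization.ext_iff_val, val_aeval_awayCoord X hl d hf, val_zero,
      Localization.mk_eq_mk', IsLocalization.mk'_eq_zero_iff, ← Ideal.Quotient.eq_zero_iff_mem]
    constructor
    · rintro ⟨⟨_, m, rfl⟩, h⟩
      exact (mem_nonZeroDivisors_iff.mp (pow_mem hnz m)).1 _ h
    · intro h
      exact ⟨1, by rw [h, mul_zero]⟩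
  exists_aeval_eq x := by
    obtain ⟨d, _, ⟨f, hf, rfl⟩, rfl⟩ := Away.mk_surjective X.grading (X.mk_mem_grading hl) x
    have hf : f.IsHomogeneous d := by simpa using hf
    refine ⟨d, f, hf, ?_⟩
    rw [HomogeneousLocalization.ext_iff_val, val_aeval_awayCoord X hl d hf]
    rfl
  exists_aeval_eq_one := ⟨l, hl, aeval_awayCoord_self X hl⟩

/-- Powers of all the variables are divisible by l, so every D₊(x_i) is contained in D₊(l). -/
lemma basicOpen_eq_top {N : ℕ}
    (hN : ∀ i, ∃ g, MvPolynomial.X i ^ (N + 1) - l * g ∈ X.ideal) :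
    Proj.basicOpen X.grading (Ideal.Quotient.mk X.ideal l) = ⊤ := by
  have hcover := Proj.iSup_basicOpen_eq_top' X.grading
    (fun i => Ideal.Quotient.mk X.ideal (MvPolynomial.X i))
    (fun i => ⟨1, X.mk_mem_grading (isHomogeneous_X k i)⟩) (by
      refine top_le_iff.mp fun x _ => ?_
      obtain ⟨f, rfl⟩ := Ideal.Quotient.mk_surjective x
      induction f using MvPolynomial.induction_on with
      | C c =>
        exact Subalgebra.algebraMap_mem _ (⟨_, X.mk_mem_grading (isHomogeneous_C _ c)⟩ : X.grading 0)
      | add f g hf hg => rw [map_add]; exact add_mem (hf trivial) (hg trivial)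
      | mul_X f i hf =>
        rw [map_mul]; exact mul_mem (hf trivial) (Algebra.subset_adjoin ⟨i, rfl⟩))
  rw [eq_top_iff, ← hcover, iSup_le_iff]
  intro i
  rw [← Proj.basicOpen_pow X.grading _ (N + 1) (by omega)]
  refine Proj.basicOpen_mono _ _ _ ?_
  obtain ⟨g, hg⟩ := hN i
  refine ⟨Ideal.Quotient.mk X.ideal g, ?_⟩
  rw [← map_pow, ← map_mul]
  exact Ideal.Quotient.eq.mpr hg

include hl in
lemma isIsoSpec_iff_of_basicOpen_eq_top
    (h : Proj.basicOpen X.grading (Ideal.Quotient.mk X.ideal l) = ⊤) (B : Type u) [CommRing B]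
    [Algebra k B] : X.IsIsoSpec B ↔
      Nonempty (Away X.grading (Ideal.Quotient.mk X.ideal l) ≃ₐ[k] B) := by
  rw [← nonempty_over_iso_spec_iff]
  let j : Spec (.of (Away X.grading (Ideal.Quotient.mk X.ideal l))) ⟶ X.toScheme :=
    Proj.awayι X.grading _ (X.mk_mem_grading hl) one_pos
  have hj : IsIso j := isIso_of_isOpenImmersion_of_opensRange_eq_top
    (Proj.awayι X.grading _ (X.mk_mem_grading hl) one_pos) ((Proj.opensRange_awayι _ _ _ _).trans h)
  have hw : j ≫ X.structureMorphism = Spec.map (CommRingCat.ofHom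
      (algebraMap k (Away X.grading (Ideal.Quotient.mk X.ideal l)))) := by
    change Proj.awayι X.grading _ (X.mk_mem_grading hl) one_pos ≫ Proj.toSpecZero X.grading ≫
      Spec.map (CommRingCat.ofHom (algebraMap k (X.grading 0))) = _
    rw [Proj.awayι_toSpecZero_assoc, ← Spec.map_comp]
    rfl
  let e : Over.mk (Spec.map (CommRingCat.ofHom
      (algebraMap k (Away X.grading (Ideal.Quotient.mk X.ideal l))))) ≅
      Over.mk X.structureMorphism := Over.isoMk (asIso j) hw
  exact ⟨fun ⟨i⟩ => ⟨e ≪≫ i⟩, fun ⟨i⟩ => ⟨e.symm ≪≫ i⟩⟩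

end AwayChart

/-! ### X is the spectrum of a finite algebra. -/

section ExistsChart

open Module

variable {k : Type u} [Field k]

lemma IsChart.exists_chartPiece_eq_top {ι : Type*} {I : Ideal (MvPolynomial ι k)} {K : Type*}
    [CommRing K] [Algebra k K] [FiniteDimensional k K] {v : ι → K} (h : IsChart I v) :
    ∃ T, chartPiece (k := k) v T = ⊤ := by
  obtain ⟨T, hT⟩ := monotone_stabilizes_iff_noetherian.mpr (inferInstance : IsNoetherian k K)
    ⟨_, h.chartPiece_mono⟩
  refine ⟨T, top_le_iff.mp fun x _ => ?_⟩
  obtain ⟨n, f, hf, rfl⟩ := h.exists_aeval_eq x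
  have h1 : aeval v f ∈ chartPiece (k := k) v n := mem_chartPiece.mpr ⟨f, hf, rfl⟩
  have h2 := h.chartPiece_mono (le_max_left n T) h1
  have h3 : chartPiece (k := k) v T = chartPiece (k := k) v (max n T) := hT _ (le_max_right n T)
  rwa [h3]

/-- Forms of some degree T already fill the finite-dimensional K. Thus x_i^(T+1) has the same value
as a form of degree T, hence as l times that form, and X misses the hyperplane l = 0. -/
theorem exists_chart [Infinite k] {X : ProjSubscheme k 4} (hX : X ∈ hilbAG k 4 6 0) :
    ∃ (K : Type u) (_ : CommRing K) (_ : Algebra k K) (v : Fin 5 → K), IsChart X.ideal v ∧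
      ∀ (B : Type u) [CommRing B] [Algebra k B], X.IsIsoSpec B ↔ Nonempty (K ≃ₐ[k] B) := by
  obtain ⟨l, hl, hnz⟩ := X.exists_linear_mem_nonZeroDivisors
  let := awayAlgebra X (Ideal.Quotient.mk X.ideal l)
  have h := isChart_awayCoord X hl hnz
  refine ⟨_, inferInstance, awayAlgebra X (Ideal.Quotient.mk X.ideal l), awayCoord X hl, h,
    fun B _ _ => isIsoSpec_iff_of_basicOpen_eq_top X hl ?_ B⟩
  have h6 := (h.exists_nondegenerate hX).1
  have : FiniteDimensional k (HomogeneousLocalization.Away X.grading (Ideal.Quotient.mk X.ideal l)) :=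
    FiniteDimensional.of_finrank_pos (by omega)
  have hl1 : aeval (R := k) (awayCoord X hl) l = 1 := aeval_awayCoord_self X hl
  obtain ⟨T, hT⟩ := h.exists_chartPiece_eq_top
  refine basicOpen_eq_top X (N := T) fun i => ?_
  obtain ⟨g, hg, hgf⟩ := mem_chartPiece.mp (hT ▸ Submodule.mem_top :
    aeval (R := k) (awayCoord X hl) (MvPolynomial.X i ^ (T + 1)) ∈ chartPiece (k := k) _ T)
  refine ⟨g, (h.aeval_eq_zero_iff (T + 1) _ ((isHomogeneous_X_pow i _).sub ?_)).mp ?_⟩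
  · rw [Nat.add_comm T 1]
    exact hl.mul hg
  · rw [map_sub, map_mul, hl1, one_mul, hgf, sub_self]

end ExistsChart

/-! ### Regular sequences, monic polynomials and Krull dimension. -/

section RegularSequence

open RingTheory.Sequence

variable {R R' : Type*} [CommRing R] [CommRing R']

lemma RingEquiv.isWeaklyRegular_map_iff (e : R ≃+* R') (rs : List R) :
    IsWeaklyRegular R rs ↔ IsWeaklyRegular R' (rs.map e) :=
  AddEquiv.isWeaklyRegular_congr (e := e.toAddEquiv) <| List.forall₂_map_right_iff.mpr <|
    List.forall₂_same.mpr fun r _ x => map_mul e r x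

lemma Polynomial.Monic.mem_map_C_of_mul_mem {J : Ideal R} {f g : Polynomial R} (hf : f.Monic)
    (h : f * g ∈ J.map Polynomial.C) : g ∈ J.map Polynomial.C := by
  have hker : J.map Polynomial.C =
      RingHom.ker (Polynomial.mapRingHom (Ideal.Quotient.mk J)) := by
    rw [Polynomial.ker_mapRingHom, Ideal.mk_ker]
  rw [hker, RingHom.mem_ker] at h ⊢
  rw [map_mul] at h
  exact ((hf.map (Ideal.Quotient.mk J)).mul_right_eq_zero_iff).mp h

lemma RingTheory.Sequence.IsWeaklyRegular.append_monic {rs : List R} (h : IsWeaklyRegular R rs)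
    {f : Polynomial R} (hf : f.Monic) :
    IsWeaklyRegular (Polynomial R) (rs.map Polynomial.C ++ [f]) := by
  rw [isWeaklyRegular_append_iff, isWeaklyRegular_singleton_iff]
  refine ⟨h.of_flat, ?_⟩
  rw [isSMulRegular_quotient_iff_mem_of_smul_mem]
  intro g hg
  rw [smul_eq_mul, Ideal.mul_top, ← Ideal.map_ofList] at hg ⊢
  exact hf.mem_map_C_of_mul_mem hg

/-- Each further element is a nonzerodivisor on the preceding quotient and lowers its dimension by
at least one. -/
lemma RingTheory.Sequence.IsWeaklyRegular.ringKrullDim_add_length_le {rs : List R}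
    (h : IsWeaklyRegular R rs) : ringKrullDim (R ⧸ Ideal.ofList rs) + rs.length ≤ ringKrullDim R := by
  have key : ∀ i ≤ rs.length,
      ringKrullDim (R ⧸ Ideal.ofList (rs.take i)) + i ≤ ringKrullDim R := by
    intro i
    induction i with
    | zero =>
      intro _
      rw [Nat.cast_zero, add_zero]
      exact ringKrullDim_quotient_le _
    | succ i ih =>
      intro hi
      refine le_trans ?_ (ih (by omega))
      have hle : Ideal.ofList (rs.take i) ≤ Ideal.ofList (rs.take (i + 1)) := by
        rw [List.take_add_one, Ideal.ofList_append]
        exact le_sup_left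
      have hreg := h.regular_mod_prev i (by omega)
      rw [isSMulRegular_quotient_iff_mem_of_smul_mem, smul_eq_mul, Ideal.mul_top] at hreg
      have h1 := ringKrullDim_succ_le_of_surjective (Ideal.Quotient.factor hle)
        (Ideal.Quotient.factor_surjective hle)
        (r := Ideal.Quotient.mk _ rs[i]) (by
          refine mem_nonZeroDivisors_iff_right.mpr fun x hx => ?_
          obtain ⟨x, rfl⟩ := Ideal.Quotient.mk_surjective x
          rw [← map_mul, Ideal.Quotient.eq_zero_iff_mem, mul_comm] at hx
          exact Ideal.Quotient.eq_zero_iff_mem.mpr (hreg x hx)) (by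
          rw [Ideal.Quotient.factor_mk, Ideal.Quotient.eq_zero_iff_mem]
          refine Ideal.subset_span ?_
          change rs[i] ∈ rs.take (i + 1)
          exact List.mem_take_iff_getElem.mpr ⟨i, by omega, rfl⟩)
      rw [Nat.cast_add, Nat.cast_one, add_comm (i : WithBot ℕ∞), ← add_assoc]
      gcongr
  have := key _ le_rfl
  rwa [List.take_length] at this

end RegularSequence

/-! ### Regular sequences of binary forms. -/

section HomogenizedEval

variable {k R R' : Type*} [Field k] [CommRing R] [Algebra k R] [CommRing R'] [Algebra k R']

/-- The value at `(x, y)` of the binary form obtained by homogenizing `g`. -/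
noncomputable def homogenizedEval (g : Polynomial k) (x y : R) : R :=
  ∑ j ∈ Finset.range (g.natDegree + 1), g.coeff j • (x ^ j * y ^ (g.natDegree - j))

lemma map_homogenizedEval (φ : R →ₐ[k] R') (g : Polynomial k) (x y : R) :
    φ (homogenizedEval g x y) = homogenizedEval g (φ x) (φ y) := by
  simp [homogenizedEval]

lemma homogenizedEval_one (g : Polynomial k) (x : R) :
    homogenizedEval g x 1 = Polynomial.aeval x g := by
  rw [Polynomial.aeval_eq_sum_range]
  simp [homogenizedEval]

lemma monic_homogenizedEval {g : Polynomial k} (hg : g.Monic) (y : R) :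
    (homogenizedEval g Polynomial.X (Polynomial.C y)).Monic := by
  rw [homogenizedEval, Finset.sum_range_succ, hg.coeff_natDegree, Nat.sub_self, pow_zero, mul_one,
    one_smul, add_comm]
  refine Polynomial.monic_X_pow_add (Polynomial.mem_degreeLT.mp (Submodule.sum_mem _ fun j hj => ?_))
  rw [Polynomial.mem_degreeLT, ← Polynomial.C_pow, mul_comm, ← algebraMap_smul R (g.coeff j),
    Polynomial.smul_eq_C_mul, ← mul_assoc, ← Polynomial.C_mul]
  refine (Polynomial.degree_C_mul_X_pow_le _ _).trans_lt ?_
  exact_mod_cast Finset.mem_range.mp hj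

lemma isHomogeneous_homogenizedEval {ι : Type*} (g : Polynomial k) {x y : MvPolynomial ι k}
    (hx : x.IsHomogeneous 1) (hy : y.IsHomogeneous 1) :
    (homogenizedEval g x y).IsHomogeneous g.natDegree := by
  refine IsHomogeneous.sum _ _ _ fun j hj => ?_
  rw [smul_eq_C_mul]
  refine IsHomogeneous.C_mul ?_ _
  have := (hx.pow j).mul (hy.pow (g.natDegree - j))
  rwa [one_mul, one_mul, Nat.add_sub_cancel' (by have := Finset.mem_range.mp hj; omega)] at this

open RingTheory.Sequence

/-- The form attached to variable i is monic in that variable and otherwise involves only the last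
one, so it is regular modulo forms in the remaining variables. -/
lemma exists_isWeaklyRegular_homogenizedEval (n : ℕ) (g : Fin n → Polynomial k)
    (hg : ∀ i, (g i).Monic) :
    ∃ rs : List (MvPolynomial (Fin (n + 1)) k), rs.length = n ∧
      IsWeaklyRegular (MvPolynomial (Fin (n + 1)) k) rs ∧
      ∀ r ∈ rs, ∃ i, r = homogenizedEval (g i) (X i.castSucc) (X (Fin.last n)) := by
  induction n with
  | zero => exact ⟨[], rfl, .nil _ _, by simp⟩
  | succ n ih =>
    obtain ⟨rs, hlen, hreg, hmem⟩ := ih (fun i => g i.succ) fun i => hg _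
    refine ⟨rs.map (rename Fin.succ) ++ [homogenizedEval (g 0) (X 0) (X (Fin.last (n + 1)))],
      by simp [hlen], ?_, ?_⟩
    · rw [RingEquiv.isWeaklyRegular_map_iff (finSuccEquiv k (n + 1)).toRingEquiv]
      convert hreg.append_monic (monic_homogenizedEval (hg 0) (X (Fin.last n))) using 1
      rw [List.map_append, List.map_map, List.map_singleton]
      congr 2
      · funext p
        change finSuccEquiv k (n + 1) (rename Fin.succ p) = Polynomial.C p
        induction p using MvPolynomial.induction_on with
        | C a => rw [rename_C, finSuccEquiv_apply, eval₂Hom_C]; rfl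
        | add p q hp hq => rw [map_add, map_add, map_add, hp, hq]
        | mul_X p j hp => rw [map_mul, map_mul, map_mul, hp, rename_X, finSuccEquiv_X_succ]
      · change (finSuccEquiv k (n + 1)).toAlgHom _ = _
        rw [map_homogenizedEval]
        congr 1
        · exact finSuccEquiv_X_zero
        · exact finSuccEquiv_X_succ (j := Fin.last n)
    · intro r hr
      rcases List.mem_append.mp hr with hr | hr
      · obtain ⟨p, hp, rfl⟩ := List.mem_map.mp hr
        obtain ⟨i, rfl⟩ := hmem p hp
        refine ⟨i.succ, ?_⟩
        rw [map_homogenizedEval, rename_X, rename_X]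
        rfl
      · exact ⟨0, List.mem_singleton.mp hr⟩

end HomogenizedEval

/-! ### The ideal of a finite subscheme of ℙⁿ has depth n. -/

section Depth

open RingTheory.Sequence

variable {k : Type*} [Field k] {n : ℕ} {K : Type*} [CommRing K] [Algebra k K]
  {I : Ideal (MvPolynomial (Fin (n + 1)) k)} {v : Fin (n + 1) → K}

/-- The kernels of the iterates stabilize. -/
lemma RingHom.injective_of_surjective_of_isNoetherianRing {R : Type*} [CommRing R]
    [IsNoetherianRing R] (f : R →+* R) (hf : Function.Surjective f) : Function.Injective f := by
  let c : ℕ →o Ideal R := ⟨fun n => RingHom.ker (f ^ n), monotone_nat_of_le_succ fun n x hx => by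
    rw [RingHom.mem_ker] at hx ⊢
    rw [pow_succ', RingHom.mul_def, RingHom.comp_apply, hx, map_zero]⟩
  obtain ⟨N, hN⟩ := monotone_stabilizes_iff_noetherian.mpr ‹IsNoetherianRing R› c
  rw [injective_iff_map_eq_zero]
  intro x hx
  have hs : Function.Surjective (f ^ N) := by
    rw [RingHom.coe_pow]
    exact hf.iterate N
  obtain ⟨y, rfl⟩ := hs x
  have h1 : y ∈ c (N + 1) := by
    change (f ^ (N + 1)) y = 0
    rw [pow_succ', RingHom.mul_def, RingHom.comp_apply, hx]
  rw [← hN (N + 1) (Nat.le_succ N)] at h1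
  exact h1

lemma exists_ringEquiv_of_linear_ne_zero {l : MvPolynomial (Fin (n + 1)) k} (hl : l.IsHomogeneous 1)
    (hl0 : l ≠ 0) : ∃ (τ : MvPolynomial (Fin (n + 1)) k ≃ₐ[k] MvPolynomial (Fin (n + 1)) k)
      (s : Fin n → Fin (n + 1)), τ (X (Fin.last n)) = l ∧ ∀ i, τ (X i.castSucc) = X (s i) := by
  obtain ⟨c, rfl⟩ : ∃ c : Fin (n + 1) → k, l = ∑ i, c i • X i := by
    refine linear_induction (P := fun l => ∃ c : Fin (n + 1) → k, l = ∑ i, c i • X i)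
      ⟨0, by simp⟩ ?_ ?_ hl
    · rintro _ _ ⟨c, rfl⟩ ⟨d, rfl⟩
      exact ⟨c + d, by simp [add_smul, Finset.sum_add_distrib]⟩
    · intro i a
      exact ⟨Pi.single i a, by simp [Pi.single_apply, ite_smul]⟩
  obtain ⟨p, hp⟩ : ∃ p, c p ≠ 0 := by
    by_contra! h
    exact hl0 (by simp [h])
  obtain ⟨l, hldef⟩ : ∃ l : MvPolynomial (Fin (n + 1)) k, l = ∑ i, c i • X i := ⟨_, rfl⟩
  rw [← hldef]
  let σ := Equiv.swap p (Fin.last n)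
  let t : MvPolynomial (Fin (n + 1)) k →ₐ[k] MvPolynomial (Fin (n + 1)) k :=
    aeval fun i => if i = Fin.last n then l else X (σ i)
  have ht : ∀ i, i ≠ Fin.last n → t (X i) = X (σ i) := fun i hi => by simp [t, hi]
  have htl : t (X (Fin.last n)) = l := by simp [t]
  have hX : ∀ i, i ≠ p → X i ∈ t.range := by
    intro i hi
    refine ⟨X (σ i), ?_⟩
    change t _ = _
    rw [ht, Equiv.swap_apply_self]
    intro h
    rw [← Equiv.swap_apply_left p (Fin.last n)] at h
    exact hi ((Equiv.swap p (Fin.last n)).injective h)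
  have hXp : X p ∈ t.range := by
    have h1 : X p = (c p)⁻¹ • (l - ∑ i ∈ Finset.univ.erase p, c i • X i : MvPolynomial _ k) := by
      rw [hldef, ← Finset.add_sum_erase _ _ (Finset.mem_univ p), add_sub_cancel_right, smul_smul,
        inv_mul_cancel₀ hp, one_smul]
    rw [h1]
    have hlmem : l ∈ t.range := ⟨_, htl⟩
    refine Subalgebra.smul_mem _ (sub_mem hlmem (sum_mem fun i hi => ?_)) _
    exact Subalgebra.smul_mem _ (hX i (Finset.ne_of_mem_erase hi)) _
  have hsurj : Function.Surjective t := by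
    rw [← AlgHom.range_eq_top, eq_top_iff, ← adjoin_range_X, Algebra.adjoin_le_iff]
    rintro _ ⟨i, rfl⟩
    by_cases hi : i = p
    · rw [hi]; exact hXp
    · exact hX i hi
  have hinj : Function.Injective t := t.toRingHom.injective_of_surjective_of_isNoetherianRing hsurj
  refine ⟨AlgEquiv.ofBijective t ⟨hinj, hsurj⟩, fun i => σ i.castSucc, htl, fun i => ht _ ?_⟩
  exact (Fin.castSucc_lt_last i).ne

/-- A regular sequence in I lowers the dimension n + 1 by its length, and l, regular modulo I, takes
one more: this is the upper bound. For the lower bound, homogenize with l the minimal polynomials of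
n of the coordinates, those completing l to a coordinate system. -/
theorem IsChart.idealDepth_eq (h : IsChart I v) [Nontrivial K] [FiniteDimensional k K]
    (hI : I.IsHomogeneous (homogeneousSubmodule (Fin (n + 1)) k)) : idealDepth I = n := by
  obtain ⟨l, hl, hl1⟩ := h.exists_aeval_eq_one
  have hItop : I ≠ ⊤ := fun hI => by
    have := (h.aeval_eq_zero_iff 0 1 (isHomogeneous_one _ _)).mpr (hI ▸ Submodule.mem_top)
    rw [map_one] at this
    exact one_ne_zero this
  refine le_antisymm ?_ ?_
  · refine iSup₂_le fun rs hrs => iSup_le fun hmem => ?_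
    have h1 := hrs.toIsWeaklyRegular.ringKrullDim_add_length_le
    have hle : Ideal.ofList rs ≤ I := Ideal.span_le.mpr hmem
    have h2 := ringKrullDim_le_of_surjective (Ideal.Quotient.factor hle)
      (Ideal.Quotient.factor_surjective hle)
    have hle' : I ≤ I ⊔ Ideal.span {l} := le_sup_left
    have h3 := ringKrullDim_succ_le_of_surjective (Ideal.Quotient.factor hle')
      (Ideal.Quotient.factor_surjective hle') (r := Ideal.Quotient.mk I l) (by
        refine mem_nonZeroDivisors_iff_right.mpr fun x hx => ?_
        obtain ⟨x, rfl⟩ := Ideal.Quotient.mk_surjective x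
        rw [← map_mul, Ideal.Quotient.eq_zero_iff_mem, mul_comm] at hx
        exact Ideal.Quotient.eq_zero_iff_mem.mpr (h.mem_of_mul_mem hI hl hl1 hx)) (by
        rw [Ideal.Quotient.factor_mk, Ideal.Quotient.eq_zero_iff_mem]
        exact Ideal.mem_sup_right (Ideal.mem_span_singleton_self l))
    have hnt : Nontrivial (MvPolynomial (Fin (n + 1)) k ⧸ I ⊔ Ideal.span {l}) := by
      refine Ideal.Quotient.nontrivial_iff.mpr fun htop => ?_
      have hker : I ⊔ Ideal.span {l} ≤ RingHom.ker (constantCoeff (R := k) (σ := Fin (n + 1))) := by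
        refine sup_le (fun f hf => h.constantCoeff_eq_zero hI hf) ?_
        rw [Ideal.span_singleton_le_iff_mem]
        exact hl.coeff_eq_zero (by simp)
      rw [htop, top_le_iff] at hker
      exact RingHom.ker_ne_top _ hker
    have h4 : 0 ≤ ringKrullDim (MvPolynomial (Fin (n + 1)) k ⧸ I ⊔ Ideal.span {l}) :=
      ringKrullDim_nonneg_of_nontrivial
    rw [MvPolynomial.ringKrullDim_of_isNoetherianRing, ringKrullDim_eq_zero_of_field, zero_add,
      Nat.card_eq_fintype_card, Fintype.card_fin] at h1
    have h5 : ((1 + rs.length : ℕ) : WithBot ℕ∞) ≤ ((n + 1 : ℕ) : WithBot ℕ∞) := by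
      refine le_trans ?_ h1
      rw [Nat.cast_add, Nat.cast_one]
      gcongr
      refine le_trans ?_ (h3.trans h2)
      exact le_add_of_nonneg_left h4
    have h6 : 1 + rs.length ≤ n + 1 := by exact_mod_cast h5
    exact_mod_cast (by omega : rs.length ≤ n)
  · have hl0 : l ≠ 0 := by
      rintro rfl
      rw [map_zero] at hl1
      exact zero_ne_one hl1
    obtain ⟨τ, s, hτl, hτ⟩ := exists_ringEquiv_of_linear_ne_zero hl hl0
    obtain ⟨rs, hlen, hreg, hmem⟩ := exists_isWeaklyRegular_homogenizedEval n
      (fun i => minpoly k (v (s i))) fun i => minpoly.monic (Algebra.IsIntegral.isIntegral _)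
    rw [RingEquiv.isWeaklyRegular_map_iff τ.toRingEquiv] at hreg
    have hrsI : ∀ r ∈ rs.map τ.toRingEquiv, r ∈ I := by
      intro r hr
      obtain ⟨p, hp, rfl⟩ := List.mem_map.mp hr
      obtain ⟨i, rfl⟩ := hmem p hp
      change τ.toAlgHom _ ∈ I
      rw [map_homogenizedEval]
      change homogenizedEval _ (τ _) (τ _) ∈ I
      rw [hτl, hτ]
      refine (h.aeval_eq_zero_iff _ _
        (isHomogeneous_homogenizedEval _ (isHomogeneous_X k _) hl)).mp ?_
      rw [map_homogenizedEval, hl1, homogenizedEval_one, aeval_X, minpoly.aeval]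
    have hle : Ideal.ofList (rs.map τ.toRingEquiv) ≤ I := Ideal.span_le.mpr hrsI
    refine le_iSup₂_of_le (rs.map τ.toRingEquiv) ⟨hreg, ?_⟩ (le_iSup_of_le hrsI ?_)
    · rw [smul_eq_mul, Ideal.mul_top]
      exact fun htop => hItop (top_le_iff.mp (htop ▸ hle))
    · rw [List.length_map, hlen]

end Depth

/-! ### The square of the maximal ideal of A_{n,d}. -/

section TangentSpaceAlgA

open Module

variable (k : Type*) [Field k]

/-- The maximal ideal is spanned by the positive powers of x₁ and the other variables, whose
products are zero or powers of x₁ of exponent at least two. -/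
lemma exists_algHom_algA (n s : ℕ) (hs : 2 ≤ s) : ∃ e : AlgA k (n + 1) (n + 1 + s) →ₐ[k] k,
    e (Ideal.Quotient.mk _ (X 0)) = 0 ∧ ∀ a b, e a = 0 → e b = 0 →
      a * b ∈ Submodule.span k (Set.range fun i : Fin (s - 1) =>
        (Ideal.Quotient.mk (idealA k (n + 1) (n + 1 + s)) (X 0)) ^ ((i : ℕ) + 2)) := by
  set q := Ideal.Quotient.mk (idealA k (n + 1) (n + 1 + s))
  set x := q (X 0) with hx
  have hker : idealA k (n + 1) (n + 1 + s) ≤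
      RingHom.ker (aeval (R := k) (0 : Fin (n + 1) → k)) := by
    rw [idealA, Ideal.span_le]
    have hs' : n + 1 + s - (n + 1) = s := by omega
    rintro p (⟨i, j, -, -, rfl⟩ | rfl)
    · simp only [SetLike.mem_coe, RingHom.mem_ker, map_sub, map_mul, apply_ite (aeval _), map_pow,
        aeval_X, Pi.zero_apply, map_zero, hs', zero_pow (by omega : s ≠ 0), mul_zero, ite_self,
        sub_zero]
    · simp
  let e : AlgA k (n + 1) (n + 1 + s) →ₐ[k] k := Ideal.Quotient.liftₐ _ _ hker
  have he : ∀ i, e (q (X i)) = 0 := fun i => aeval_X _ _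
  refine ⟨e, he 0, ?_⟩
  set Q := Submodule.span k (Set.range fun i : Fin (s - 1) => x ^ ((i : ℕ) + 2))
  have hQ : ∀ i, 2 ≤ i → x ^ i ∈ Q := by
    intro i hi
    by_cases h : i < s + 1
    · refine Submodule.subset_span ⟨⟨i - 2, by omega⟩, ?_⟩
      simp only
      congr 1
      omega
    · rw [show i = s + 1 + (i - (s + 1)) by omega, pow_add, algA_pow_eq_zero, zero_mul]
      exact Q.zero_mem
  let S : Set (AlgA k (n + 1) (n + 1 + s)) :=
    {y | (∃ i, 1 ≤ i ∧ y = x ^ i) ∨ ∃ j : Fin n, y = q (X j.succ)}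
  have hS : ∀ a, a - algebraMap k _ (e a) ∈ Submodule.span k S := by
    intro a
    have ha : a ∈ (⊤ : Submodule k (AlgA k (n + 1) (n + 1 + s))) := trivial
    rw [← span_algA_eq_top k n s] at ha
    induction ha using Submodule.span_induction with
    | mem y hy =>
      rcases hy with ⟨i, rfl⟩ | ⟨i, rfl⟩
      · rcases Nat.eq_zero_or_pos i with h | h
        · simp only [h, pow_zero, map_one, sub_self]
          exact Submodule.zero_mem _
        · have h0 : e (x ^ (i : ℕ)) = 0 := by
            rw [map_pow, hx, he, zero_pow (by omega)]
          change x ^ (i : ℕ) - algebraMap k _ (e (x ^ (i : ℕ))) ∈ _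
          rw [h0, map_zero, sub_zero]
          exact Submodule.subset_span (Or.inl ⟨_, h, rfl⟩)
      · change q (X i.succ) - algebraMap k _ (e (q (X i.succ))) ∈ _
        rw [he, map_zero, sub_zero]
        exact Submodule.subset_span (Or.inr ⟨_, rfl⟩)
    | zero => simp
    | add a b _ _ ha hb =>
      rw [map_add, map_add, add_sub_add_comm]
      exact add_mem ha hb
    | smul c a _ ha =>
      rw [map_smul, smul_eq_mul, map_mul, ← Algebra.smul_def, ← smul_sub]
      exact Submodule.smul_mem _ _ ha
  intro a b ha hb
  have ha' := hS a
  have hb' := hS b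
  rw [ha, map_zero, sub_zero] at ha'
  rw [hb, map_zero, sub_zero] at hb'
  have hab := Submodule.mul_mem_mul ha' hb'
  rw [Submodule.span_mul_span] at hab
  refine Submodule.span_le.mpr ?_ hab
  rintro _ ⟨y, hy, z, hz, rfl⟩
  have hxX : ∀ i (j : Fin n), 1 ≤ i → x ^ i * q (X j.succ) = 0 := by
    intro i j hi
    obtain ⟨t, rfl⟩ : ∃ t, i = t + 1 := ⟨i - 1, by omega⟩
    rw [pow_succ, mul_assoc, algA_mul_eq k n s _ _ (by simp [Fin.succ_ne_zero]),
      if_neg (Fin.succ_ne_zero j).symm, mul_zero]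
  change y * z ∈ Q
  rcases hy with ⟨i, hi, rfl⟩ | ⟨i, rfl⟩ <;> rcases hz with ⟨j, hj, rfl⟩ | ⟨j, rfl⟩
  · rw [← pow_add]
    exact hQ _ (by omega)
  · rw [hxX _ _ hi]
    exact Q.zero_mem
  · rw [mul_comm, hxX _ _ hj]
    exact Q.zero_mem
  · rw [algA_mul_eq k n s _ _ (by simp [Fin.succ_ne_zero])]
    split_ifs
    · exact hQ _ hs
    · exact Q.zero_mem

lemma finite_algA (n s : ℕ) : Module.Finite k (AlgA k (n + 1) (n + 1 + s)) :=
  ⟨⟨((Set.finite_range _).union (Set.finite_range _)).toFinset, by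
    rw [Set.Finite.coe_toFinset]; exact span_algA_eq_top k n s⟩⟩

lemma exists_finrank_ker_sq_algA (n s : ℕ) (hs : 2 ≤ s)
    (hfin : finrank k (AlgA k (n + 1) (n + 1 + s)) = s + 1 + n) :
    ∃ e : AlgA k (n + 1) (n + 1 + s) →ₐ[k] k,
      finrank k (((RingHom.ker e) ^ 2).restrictScalars k) = s - 1 := by
  obtain ⟨e, he, hmul⟩ := exists_algHom_algA k n s hs
  refine ⟨e, ?_⟩
  have hli := linearIndependent_of_top_le_span_of_card_eq_finrank
    (b := Sum.elim (fun i : Fin (s + 1) =>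
        (Ideal.Quotient.mk (idealA k (n + 1) (n + 1 + s)) (X 0)) ^ (i : ℕ))
      fun j : Fin n => Ideal.Quotient.mk (idealA k (n + 1) (n + 1 + s)) (X j.succ))
    (by rw [Set.Sum.elim_range, span_algA_eq_top]) (by simp [hfin])
  have hli' := hli.comp (fun i : Fin (s - 1) => Sum.inl ⟨(i : ℕ) + 2, by omega⟩) (by
    intro i j hij
    simpa [Fin.ext_iff] using hij)
  have heq : ((RingHom.ker e) ^ 2).restrictScalars k =
      Submodule.span k (Set.range fun i : Fin (s - 1) =>
        (Ideal.Quotient.mk (idealA k (n + 1) (n + 1 + s)) (X 0)) ^ ((i : ℕ) + 2)) := by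
    refine le_antisymm (fun a ha => ?_) (Submodule.span_le.mpr ?_)
    · rw [Submodule.restrictScalars_mem, pow_two] at ha
      induction ha using Submodule.mul_induction_on' with
      | mem_mul_mem a ha b hb => exact hmul a b ha hb
      | add a _ b _ ha hb => exact add_mem ha hb
    · rintro _ ⟨i, rfl⟩
      refine Ideal.pow_le_pow_right (Nat.le_add_left 2 i) (Ideal.pow_mem_pow ?_ _)
      exact he
  rw [heq]
  exact (finrank_span_eq_card hli').trans (Fintype.card_fin _)

/-- The idempotent (0, 1) lies in the kernel, so the whole second factor lies in its square. -/
lemma finrank_ker_sq_prod {B : Type*} [CommRing B] [Algebra k B] [Module.Finite k B]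
    (e : B →ₐ[k] k) : finrank k (((RingHom.ker (e.comp (AlgHom.fst k B k))) ^ 2).restrictScalars k) =
      finrank k (((RingHom.ker e) ^ 2).restrictScalars k) + 1 := by
  have h : ∀ a, a ∈ (RingHom.ker (e.comp (AlgHom.fst k B k))) ^ 2 ↔ a.1 ∈ (RingHom.ker e) ^ 2 := by
    intro a
    constructor
    · intro ha
      rw [pow_two] at ha ⊢
      induction ha using Submodule.mul_induction_on' with
      | mem_mul_mem a ha b hb => exact Ideal.mul_mem_mul ha hb
      | add a _ b _ ha hb => exact add_mem ha hb
    · intro ha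
      have h1 : ∀ b ∈ RingHom.ker e ^ 2, (b, (0 : k)) ∈
          (RingHom.ker (e.comp (AlgHom.fst k B k))) ^ 2 := by
        intro b hb
        rw [pow_two] at hb ⊢
        induction hb using Submodule.mul_induction_on' with
        | mem_mul_mem a ha b hb =>
          have : ((a * b, 0) : B × k) = (a, 0) * (b, 0) := by simp
          rw [this]
          exact Ideal.mul_mem_mul ha hb
        | add a _ b _ ha hb =>
          have : ((a + b, 0) : B × k) = (a, 0) + (b, 0) := by simp
          rw [this]
          exact add_mem ha hb
      have h2 : ((0 : B), a.2) ∈ (RingHom.ker (e.comp (AlgHom.fst k B k))) ^ 2 := by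
        have : ((0, a.2) : B × k) = (0, a.2) * (0, 1) := by simp
        rw [this, pow_two]
        exact Ideal.mul_mem_mul (map_zero e) (map_zero e)
      have : a = (a.1, 0) + (0, a.2) := by simp
      rw [this]
      exact add_mem (h1 _ ha) h2
  let f : ((RingHom.ker (e.comp (AlgHom.fst k B k)) ^ 2).restrictScalars k) ≃ₗ[k]
      ((RingHom.ker e ^ 2).restrictScalars k) × k :=
    { toFun := fun a => (⟨a.1.1, (h _).mp a.2⟩, a.1.2)
      invFun := fun a => ⟨(a.1.1, a.2), (h _).mpr a.1.2⟩
      map_add' := fun _ _ => rfl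
      map_smul' := fun _ _ => rfl
      left_inv := fun _ => rfl
      right_inv := fun _ => rfl }
  rw [f.finrank_eq, finrank_prod, finrank_self]

end TangentSpaceAlgA

/-! ### Singular points and linear forms in m². -/

section TangentSpace

open Module

variable {k : Type*} [Field k] {n : ℕ} {K : Type*} [CommRing K] [Algebra k K]
  {I : Ideal (MvPolynomial (Fin (n + 1)) k)} {v : Fin (n + 1) → K}

/-- If every element of `I` is singular at the point `e`, then `m²` contains no nonzero value of a
linear form. -/
lemma IsChart.eq_zero_of_mem_ker_sq [Infinite k] (h : IsChart I v) (e : K →ₐ[k] k)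
    (hI : ∀ Φ : MvPolynomial (Fin (n + 1)) k →ₐ[k] DualNumber k,
      (∀ f, (Φ f).fst = e (aeval v f)) → I ≤ RingHom.ker Φ)
    {c : K} (hc : c ∈ (RingHom.ker e) ^ 2) (hc1 : c ∈ Submodule.span k (Set.range v)) : c = 0 := by
  rw [← chartPiece_one] at hc1
  obtain ⟨L, hL, rfl⟩ := mem_chartPiece.mp hc1
  obtain ⟨l, hl, hl1⟩ := h.exists_aeval_eq_one
  suffices hLq : ∀ q : Fin (n + 1) → k, eval q L = 0 by
    have : L = 0 := MvPolynomial.funext fun q => by rw [hLq, map_zero]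
    rw [this, map_zero]
  intro q
  -- Evaluation along the tangent vector q at the point e: value and derivative together, as a dual
  -- number.
  let Φ : MvPolynomial (Fin (n + 1)) k →ₐ[k] DualNumber k :=
    aeval fun i => TrivSqZeroExt.inl (e (v i)) + TrivSqZeroExt.inr (q i)
  have hΦ : ∀ f, (Φ f).fst = e (aeval v f) := by
    have : (TrivSqZeroExt.fstHom k k k).comp Φ = e.comp (aeval v) := by
      ext i
      simp [Φ]
    exact fun f => DFunLike.congr_fun this f
  have hIΦ := hI Φ hΦ
  have hΦ1 : ∀ f : MvPolynomial (Fin (n + 1)) k, f.IsHomogeneous 1 → (Φ f).snd = eval q f := by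
    intro f hf
    refine linear_induction (P := fun f => (Φ f).snd = eval q f) ?_ ?_ ?_ hf
    · simp
    · intro f g hf hg
      rw [map_add, TrivSqZeroExt.snd_add, hf, hg, map_add]
    · intro i a
      simp [Φ]
  have hmul : ∀ a b : DualNumber k, a.fst = 0 → b.fst = 0 → a * b = 0 := by
    intro a b ha hb
    ext <;> simp [ha, hb]
  -- Elements of m² are values of forms vanishing to second order at the point; powers of l equalize
  -- the degrees of the summands.
  have key : ∀ c ∈ (RingHom.ker e) ^ 2, ∃ m, ∃ f : MvPolynomial (Fin (n + 1)) k,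
      f.IsHomogeneous m ∧ aeval v f = c ∧ Φ f = 0 := by
    intro c hc
    rw [pow_two] at hc
    induction hc using Submodule.mul_induction_on' with
    | mem_mul_mem a ha b hb =>
      obtain ⟨i, f, hf, rfl⟩ := h.exists_aeval_eq a
      obtain ⟨j, g, hg, rfl⟩ := h.exists_aeval_eq b
      refine ⟨_, f * g, hf.mul hg, map_mul _ _ _, ?_⟩
      rw [map_mul]
      exact hmul _ _ ((hΦ f).trans ha) ((hΦ g).trans hb)
    | add a _ b _ ha hb =>
      obtain ⟨i, f, hf, rfl, hf0⟩ := ha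
      obtain ⟨j, g, hg, rfl, hg0⟩ := hb
      refine ⟨i + j, f * l ^ j + g * l ^ i, ?_, ?_, ?_⟩
      · have h1 := hf.mul (hl.pow j)
        have h2 := hg.mul (hl.pow i)
        rw [one_mul] at h1 h2
        exact h1.add (Nat.add_comm j i ▸ h2)
      · simp [hl1]
      · simp [hf0, hg0]
  obtain ⟨m, f, hf, hfL, hf0⟩ := key _ hc
  -- Differentiating this element of I along q leaves only the derivative of L, which is L(q).
  have hmem : f * l - L * l ^ m ∈ I := by
    refine (h.aeval_eq_zero_iff (m + 1) _ ((hf.mul hl).sub ?_)).mp ?_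
    · have := hL.mul (hl.pow m)
      rw [one_mul] at this
      exact Nat.add_comm 1 m ▸ this
    · simp [hl1, hfL]
  have h0 := hIΦ hmem
  rw [RingHom.mem_ker, map_sub, map_mul, hf0, zero_mul, zero_sub, neg_eq_zero, map_mul] at h0
  have h1 := congrArg TrivSqZeroExt.snd h0
  have hLe : e (aeval v L) = 0 := Ideal.pow_le_self two_ne_zero hc
  rw [TrivSqZeroExt.snd_mul, hΦ L, hLe, hΦ, hΦ1 L hL] at h1
  simpa [hl1] using h1

lemma exists_surjective_of_finrank_add_two_le [FiniteDimensional k K] (U : Submodule k K)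
    (hU : finrank k U + 2 ≤ finrank k K) :
    ∃ γ : K →ₗ[k] Fin 2 → k, Function.Surjective γ ∧ U ≤ LinearMap.ker γ := by
  have h1 := U.finrank_quotient_add_finrank
  let b := finBasis k (K ⧸ U)
  have h2 : 2 ≤ finrank k (K ⧸ U) := by omega
  let γ' : (K ⧸ U) →ₗ[k] Fin 2 → k := LinearMap.pi fun j => b.coord (Fin.castLE h2 j)
  have hγ' : Function.Surjective γ' := by
    intro c
    refine ⟨∑ j, c j • b (Fin.castLE h2 j), ?_⟩
    ext i
    fin_cases i <;> simp [γ', (Fin.castLE_injective h2).eq_iff]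
  refine ⟨γ'.comp U.mkQ, hγ'.comp U.mkQ_surjective, fun x hx => ?_⟩
  rw [LinearMap.mem_ker, LinearMap.comp_apply, Submodule.mkQ_apply,
    (Submodule.Quotient.mk_eq_zero U).mpr hx, map_zero]

end TangentSpace

/-! ### A determinantal X has no point with dim m² = 2. -/

section Scandinavian

open Module

variable {k : Type*} [Field k] {K : Type*} [CommRing K] [Algebra k K]
  {n : ℕ} {v : Fin (n + 1) → K} {M : Matrix (Fin 3) (Fin 3) (MvPolynomial (Fin (n + 1)) k)}

/-- The values of a `3 × 3` matrix of linear forms with vanishing minors and nonzero entry at `e`: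
modulo `m²` and two further elements, its rows are proportional. -/
lemma exists_submodule_rows_proportional (e : K →ₐ[k] k) [FiniteDimensional k K]
    {z : Matrix (Fin 3) (Fin 3) K} (hz : ∀ i i' j j', z i j * z i' j' = z i j' * z i' j)
    {i₀ j₀ : Fin 3} (h0 : e (z i₀ j₀) ≠ 0) :
    ∃ (U : Submodule k K) (α : Fin 3 → k),
      finrank k U ≤ finrank k (((RingHom.ker e) ^ 2).restrictScalars k) + 2 ∧
      ((RingHom.ker e) ^ 2).restrictScalars k ≤ U ∧ ∀ i j, z i j - α i • z i₀ j ∈ U := by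
  set J := RingHom.ker e ^ 2
  set u := z i₀ j₀
  let α : Fin 3 → k := fun i => e (z i j₀) / e u
  let β : Fin 3 → k := fun j => e (z i₀ j) / e u
  have hα : ∀ i, α i * e u = e (z i j₀) := fun i => div_mul_cancel₀ _ h0
  have hβ : ∀ j, β j * e u = e (z i₀ j) := fun i => div_mul_cancel₀ _ h0
  let r : Fin 3 → K := fun i => z i j₀ - α i • u
  have hr0 : r i₀ = 0 := by
    change u - (e u / e u) • u = 0
    rw [div_self h0, one_smul, sub_self]
  -- u is a unit at the point e, so it can be cancelled modulo m².
  have hcancel : ∀ w, u * w ∈ J → w ∈ J := by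
    intro w hw
    have hw0 : e w = 0 := by
      have : e (u * w) = 0 := Ideal.pow_le_self two_ne_zero hw
      rw [map_mul] at this
      exact (mul_eq_zero.mp this).resolve_left h0
    have h1 : (u - algebraMap k K (e u)) * w ∈ J := by
      change _ ∈ RingHom.ker e ^ 2
      rw [pow_two]
      refine Ideal.mul_mem_mul ?_ hw0
      rw [RingHom.mem_ker, map_sub, AlgHom.commutes, Algebra.algebraMap_self, RingHom.id_apply,
        sub_self]
    have h2 := J.mul_mem_left (algebraMap k K (e u)⁻¹) (sub_mem hw h1)
    have h3 : algebraMap k K (e u)⁻¹ * algebraMap k K (e u) = 1 := by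
      rw [← map_mul, inv_mul_cancel₀ h0, map_one]
    convert h2 using 1
    linear_combination -(w * h3)
  have hw : ∀ i j, z i j - α i • z i₀ j - β j • r i ∈ J := by
    intro i j
    refine hcancel _ ?_
    have h1 : (z i j₀ - α i • u) * (z i₀ j - β j • u) ∈ J := by
      change _ ∈ RingHom.ker e ^ 2
      rw [pow_two]
      refine Ideal.mul_mem_mul ?_ ?_
      · rw [RingHom.mem_ker, map_sub, map_smul, smul_eq_mul, hα, sub_self]
      · rw [RingHom.mem_ker, map_sub, map_smul, smul_eq_mul, hβ, sub_self]
    convert h1 using 1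
    have := hz i i₀ j j₀
    simp only [r, Algebra.smul_def]
    change z i j * u = _ at this
    linear_combination this
  -- The remainders of the rows in column j₀; the one of row i₀ is zero, so at most two dimensions
  -- are added to m².
  let R := Submodule.span k (Set.range fun i : {i // i ≠ i₀} => r i)
  have hR : finrank k R ≤ 2 := (finrank_range_le_card _).trans (by
    rw [Fintype.card_subtype_compl, Fintype.card_subtype_eq, Fintype.card_fin])
  have hrR : ∀ i, r i ∈ R := by
    intro i
    by_cases hi : i = i₀
    · rw [hi, hr0]
      exact R.zero_mem
    · exact Submodule.subset_span ⟨⟨i, hi⟩, rfl⟩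
  refine ⟨J.restrictScalars k ⊔ R, α, ?_, le_sup_left, fun i j => ?_⟩
  · exact (Submodule.finrank_add_le_finrank_add_finrank _ _).trans (by omega)
  · have h1 : z i j - α i • z i₀ j = (z i j - α i • z i₀ j - β j • r i) + β j • r i := by abel
    rw [h1]
    exact add_mem (Submodule.mem_sup_left (hw i j))
      (Submodule.mem_sup_right (R.smul_mem _ (hrR i)))

/-- If M vanishes at e, all minors are singular there, although the plane m² meets ker ψ. If not, M
has proportional rows along a line of ℙ⁴, which would lie in the finite scheme. -/
theorem IsChart.minorsIdeal_finrank_ker_sq_ne_two [Infinite k] {ψ : K →ₗ[k] k}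
    (h : IsChart (minorsIdeal M) v) (hM : ∀ i j, (M i j).IsHomogeneous 1) (hK : finrank k K = 6)
    (hψ : ∀ a, (∀ b, ψ (a * b) = 0) → a = 0)
    (hs : Submodule.span k (Set.range v) = LinearMap.ker ψ) (e : K →ₐ[k] k) :
    finrank k (((RingHom.ker e) ^ 2).restrictScalars k) ≠ 2 := by
  intro hJ
  have : FiniteDimensional k K := FiniteDimensional.of_finrank_pos (by omega)
  set J := RingHom.ker e ^ 2 with hJdef
  have hminors : ∀ i i' j j', aeval v (M i j) * aeval v (M i' j') =
      aeval v (M i j') * aeval v (M i' j) := by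
    intro i i' j j'
    have := (h.aeval_eq_zero_iff _ _ (((hM i j).mul (hM i' j')).sub ((hM i j').mul (hM i' j)))).mpr
      (mul_sub_mul_mem_minorsIdeal M i i' j j')
    rwa [map_sub, map_mul, map_mul, sub_eq_zero] at this
  obtain ⟨i₀, j₀, h0⟩ : ∃ i j, e (aeval v (M i j)) ≠ 0 := by
    by_contra! h0
    have h1 : LinearMap.ker (ψ.domRestrict (J.restrictScalars k)) ≠ ⊥ :=
      LinearMap.ker_ne_bot_of_finrank_lt (by rw [hJ, finrank_self]; omega)
    obtain ⟨⟨c, hcJ⟩, hc, hc0⟩ := (Submodule.ne_bot_iff _).mp h1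
    refine hc0 (Subtype.ext ?_)
    refine h.eq_zero_of_mem_ker_sq e (fun Φ hΦ => minorsIdeal_le M fun i i' j j' => ?_) hcJ
      (hs ▸ hc)
    have hmul : ∀ a b : DualNumber k, a.fst = 0 → b.fst = 0 → a * b = 0 := by
      intro a b ha hb
      ext <;> simp [ha, hb]
    have hM0 : ∀ i j, (Φ (M i j)).fst = 0 := fun i j => (hΦ _).trans (h0 i j)
    rw [RingHom.mem_ker, map_sub, map_mul, map_mul, hmul _ _ (hM0 _ _) (hM0 _ _),
      hmul _ _ (hM0 _ _) (hM0 _ _), sub_zero]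
  obtain ⟨U, α, hU, hJU, hrow⟩ := exists_submodule_rows_proportional e
    (z := fun i j => aeval v (M i j)) hminors h0
  -- U has dimension at most 2 + 2, so two independent functionals kill it.
  obtain ⟨γ, hγ, hγU⟩ := exists_surjective_of_finrank_add_two_le U (by
    have : finrank k U ≤ finrank k (J.restrictScalars k) + 2 := hU
    omega)
  -- m² is a nonzero ideal, so ψ does not vanish on it; c, which γ kills, corrects any element into
  -- a value of a linear form. Hence γ is still surjective on linear forms.
  obtain ⟨c, hcJ, hcψ⟩ : ∃ c ∈ J, ψ c ≠ 0 := by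
    by_contra! hc
    have : J.restrictScalars k = ⊥ := (Submodule.eq_bot_iff _).mpr fun a ha =>
      hψ a fun b => hc _ (J.mul_mem_right b ha)
    rw [this, finrank_bot] at hJ
    omega
  have hlin : ∀ t, ∃ f : MvPolynomial (Fin (n + 1)) k, f.IsHomogeneous 1 ∧ γ (aeval v f) = t := by
    intro t
    obtain ⟨a, rfl⟩ := hγ t
    have ha : a - (ψ a / ψ c) • c ∈ chartPiece (k := k) v 1 := by
      rw [chartPiece_one, hs, LinearMap.mem_ker, map_sub, map_smul, smul_eq_mul,
        div_mul_cancel₀ _ hcψ, sub_self]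
    obtain ⟨f, hf, hfa⟩ := mem_chartPiece.mp ha
    refine ⟨f, hf, ?_⟩
    have hγc : γ c = 0 := hγU (hJU hcJ)
    rw [hfa, map_sub, map_smul, hγc, smul_zero, sub_zero]
  -- Parametrizes the line spanned by the two components of γ; `ρ` restricts forms to it.
  let θ : K →ₗ[k] Polynomial k :=
    (LinearMap.toSpanSingleton k (Polynomial k) 1).comp ((LinearMap.proj 0).comp γ) +
      (LinearMap.toSpanSingleton k (Polynomial k) Polynomial.X).comp ((LinearMap.proj 1).comp γ)
  have hθ : ∀ a, θ a = γ a 0 • (1 : Polynomial k) + γ a 1 • Polynomial.X := fun a => rfl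
  let ρ : MvPolynomial (Fin (n + 1)) k →ₐ[k] Polynomial k := aeval fun i => θ (v i)
  have hρ : ∀ f : MvPolynomial (Fin (n + 1)) k, f.IsHomogeneous 1 → ρ f = θ (aeval v f) := by
    intro f hf
    refine linear_induction (P := fun f => ρ f = θ (aeval v f)) ?_ ?_ ?_ hf
    · simp
    · intro f g hf hg
      rw [map_add, map_add, map_add, hf, hg]
    · intro i a
      rw [map_smul, map_smul, map_smul, aeval_X, aeval_X]
  have hρrow : ∀ i j, ρ (M i j) = α i • ρ (M i₀ j) := by
    intro i j
    rw [hρ _ (hM i j), hρ _ (hM i₀ j), ← map_smul, ← sub_eq_zero, ← map_sub, hθ, hγU (hrow i j)]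
    simp
  have hρI : minorsIdeal M ≤ RingHom.ker ρ := by
    refine minorsIdeal_le M fun i i' j j' => ?_
    rw [RingHom.mem_ker, map_sub, map_mul, map_mul, hρrow i j, hρrow i' j', hρrow i j',
      hρrow i' j]
    simp only [Algebra.smul_def]
    ring
  obtain ⟨l₀, hl₀, hl₀γ⟩ := hlin ![1, 0]
  obtain ⟨l₁, hl₁, hl₁γ⟩ := hlin ![0, 1]
  have hρ₀ : ρ l₀ = 1 := by rw [hρ _ hl₀, hθ, hl₀γ]; simp
  have hρ₁ : ρ l₁ = Polynomial.X := by rw [hρ _ hl₁, hθ, hl₁γ]; simp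
  -- Seven monomials of degree 6 in a six-dimensional algebra give a form in the ideal that
  -- restricts to a nonzero polynomial on the line.
  have hdep : ¬ LinearIndependent k fun i : Fin 7 =>
      aeval v (l₁ ^ (i : ℕ) * l₀ ^ (6 - (i : ℕ)) : MvPolynomial (Fin (n + 1)) k) := fun hli => by
    have := hli.fintype_card_le_finrank
    rw [Fintype.card_fin, hK] at this
    omega
  obtain ⟨g, hg, i, hi⟩ := Fintype.not_linearIndependent_iff.mp hdep
  have hmem : ∑ i : Fin 7, g i • (l₁ ^ (i : ℕ) * l₀ ^ (6 - (i : ℕ))) ∈ minorsIdeal M := by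
    refine (h.aeval_eq_zero_iff 6 _ (IsHomogeneous.sum _ _ _ fun i _ => ?_)).mp ?_
    · rw [smul_eq_C_mul]
      refine IsHomogeneous.C_mul ?_ _
      have := (hl₁.pow (i : ℕ)).mul (hl₀.pow (6 - (i : ℕ)))
      rwa [one_mul, one_mul, Nat.add_sub_cancel' (by omega)] at this
    · rw [map_sum]
      simpa only [map_smul] using hg
  have h1 := hρI hmem
  rw [RingHom.mem_ker, map_sum] at h1
  simp only [map_smul, map_mul, map_pow, hρ₀, hρ₁, one_pow, mul_one] at h1
  have h2 := congrArg (Polynomial.coeff · (i : ℕ)) h1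
  simp only [Polynomial.finsetSum_coeff, Polynomial.coeff_smul, Polynomial.coeff_X_pow,
    smul_eq_mul, Polynomial.coeff_zero] at h2
  rw [Finset.sum_eq_single i (fun j _ hj => by
    rw [if_neg (fun hij => hj (Fin.ext hij.symm)), mul_zero]) (by simp)] at h2
  simp at h2
  exact hi h2

end Scandinavian

/-! ### Transport of charts under coordinate changes and isomorphisms. -/

section ProjectiveEquivalence

open ProjSubscheme

variable {k : Type*} [Field k] {n : ℕ}

lemma linearSubst_linearSubst (g h : Matrix (Fin (n + 1)) (Fin (n + 1)) k)
    (f : MvPolynomial (Fin (n + 1)) k) :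
    linearSubst g (linearSubst h f) = linearSubst (h * g) f := by
  have : (linearSubst g).comp (linearSubst h) = linearSubst (h * g) := by
    refine MvPolynomial.algHom_ext fun i => ?_
    simp only [AlgHom.comp_apply, linearSubst, aeval_X, map_sum, map_mul, algHom_C,
      Matrix.mul_apply, Finset.sum_mul, Finset.mul_sum]
    rw [Finset.sum_comm]
    simp [mul_assoc]
  exact DFunLike.congr_fun this f

lemma linearSubst_one : linearSubst (1 : Matrix (Fin (n + 1)) (Fin (n + 1)) k) = AlgHom.id k _ := by
  refine MvPolynomial.algHom_ext fun i => ?_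
  simp [linearSubst, Matrix.one_apply]

lemma MvPolynomial.IsHomogeneous.linearSubst (g : Matrix (Fin (n + 1)) (Fin (n + 1)) k) {m : ℕ}
    {f : MvPolynomial (Fin (n + 1)) k} (hf : f.IsHomogeneous m) :
    (linearSubst g f).IsHomogeneous m := by
  have := hf.aeval (fun i => ∑ j, C (g i j) * X j) (n := 1) fun i =>
    IsHomogeneous.sum _ _ _ fun j _ => (isHomogeneous_X k j).C_mul _
  rwa [one_mul] at this

variable {K : Type*} [CommRing K] [Algebra k K] {I : Ideal (MvPolynomial (Fin (n + 1)) k)}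
  {v : Fin (n + 1) → K}

lemma IsChart.map_linearSubst (h : IsChart I v) (g : GL (Fin (n + 1)) k) :
    IsChart (I.map (ProjSubscheme.linearSubst (g : Matrix (Fin (n + 1)) (Fin (n + 1)) k))) fun i =>
      aeval v (ProjSubscheme.linearSubst ((g⁻¹ : GL (Fin (n + 1)) k) : Matrix (Fin (n + 1)) (Fin (n + 1)) k) (X i)) := by
  set L := ProjSubscheme.linearSubst (g : Matrix (Fin (n + 1)) (Fin (n + 1)) k)
  set L' := ProjSubscheme.linearSubst ((g⁻¹ : GL (Fin (n + 1)) k) : Matrix (Fin (n + 1)) (Fin (n + 1)) k)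
  have h1 : ∀ f, L (L' f) = f := fun f => by
    rw [linearSubst_linearSubst, ← Units.val_mul, inv_mul_cancel, Units.val_one, linearSubst_one,
      AlgHom.id_apply]
  have h2 : ∀ f, L' (L f) = f := fun f => by
    rw [linearSubst_linearSubst, ← Units.val_mul, mul_inv_cancel, Units.val_one, linearSubst_one,
      AlgHom.id_apply]
  have hev : ∀ f, aeval (fun i => aeval v (L' (X i))) f = aeval v (L' f) := by
    have : aeval (fun i => aeval v (L' (X i))) = (aeval (R := k) v).comp L' :=
      MvPolynomial.algHom_ext fun i => by simp
    exact fun f => DFunLike.congr_fun this f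
  have hmem : ∀ f, f ∈ I.map L ↔ L' f ∈ I := by
    refine fun f => ⟨fun hf => ?_, fun hf => ?_⟩
    · have : I.map L ≤ I.comap L' := by
        refine Ideal.map_le_iff_le_comap.mpr fun f hf => ?_
        rw [Ideal.mem_comap, Ideal.mem_comap, h2]
        exact hf
      exact this hf
    · rw [← h1 f]
      exact Ideal.mem_map_of_mem _ hf
  refine ⟨fun m f hf => ?_, fun x => ?_, ?_⟩
  · rw [hev, hmem]
    exact h.aeval_eq_zero_iff m _ (hf.linearSubst _)
  · obtain ⟨m, f, hf, hfx⟩ := h.exists_aeval_eq x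
    exact ⟨m, L f, hf.linearSubst _, by rw [hev, h2, hfx]⟩
  · obtain ⟨f, hf, hfx⟩ := h.exists_aeval_eq_one
    exact ⟨L f, hf.linearSubst _, by rw [hev, h2, hfx]⟩

lemma IsChart.comp_algEquiv {B : Type*} [CommRing B] [Algebra k B] (h : IsChart I v)
    (φ : K ≃ₐ[k] B) : IsChart I fun i => φ (v i) := by
  have hev : ∀ f : MvPolynomial (Fin (n + 1)) k, aeval (fun i => φ (v i)) f = φ (aeval v f) := by
    have : aeval (fun i => φ (v i)) = φ.toAlgHom.comp (aeval (R := k) v) :=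
      MvPolynomial.algHom_ext fun i => by simp
    exact fun f => DFunLike.congr_fun this f
  refine ⟨fun m f hf => ?_, fun x => ?_, ?_⟩
  · rw [hev, map_eq_zero_iff _ φ.injective]
    exact h.aeval_eq_zero_iff m f hf
  · obtain ⟨m, f, hf, hfx⟩ := h.exists_aeval_eq (φ.symm x)
    exact ⟨m, f, hf, by rw [hev, hfx, φ.apply_symm_apply]⟩
  · obtain ⟨f, hf, hfx⟩ := h.exists_aeval_eq_one
    exact ⟨f, hf, by rw [hev, hfx, map_one]⟩

end ProjectiveEquivalence

/-! ### Orbits detect the abstract algebra of X. -/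

section Orbits

open ProjSubscheme Module

variable {k : Type u} [Field k] {X : ProjSubscheme k 4}

lemma mem_orbitO_of_isIsoSpec (hX : X ∈ hilbAG k 4 6 0) {A : Type u} [CommRing A] [Algebra k A]
    (h : X.IsIsoSpec A) : X ∈ orbitO 4 6 A :=
  ⟨X, hX, h, 1, by rw [Units.val_one, linearSubst_one]; exact (Ideal.map_id _).symm⟩

variable [IsAlgClosed k]

lemma exists_chart_of_mem_orbitO {A : Type u} [CommRing A] [Algebra k A]
    (hXA : X ∈ orbitO 4 6 A) : ∃ v : Fin 5 → A, IsChart X.ideal v := by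
  obtain ⟨Y, hY, hYA, g, hg⟩ := hXA
  obtain ⟨K, _, _, v, hv, hiso⟩ := exists_chart hY
  obtain ⟨φ⟩ := (hiso A).mp hYA
  rw [hg]
  exact ⟨_, (hv.comp_algEquiv φ).map_linearSubst g⟩

lemma not_mem_orbitO_of_isScandinavian (hX : X ∈ hilbAG k 4 6 0) (h : X.IsScandinavian) {A : Type u}
    [CommRing A] [Algebra k A] (hA : finrank k A = 6 → ∃ e : A →ₐ[k] k,
      finrank k (((RingHom.ker e) ^ 2).restrictScalars k) = 2) : X ∉ orbitO 4 6 A := by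
  intro hXA
  obtain ⟨v, hv⟩ := exists_chart_of_mem_orbitO hXA
  obtain ⟨hfin, hli, ψ, hs, -, hψ⟩ := hv.exists_nondegenerate hX
  obtain ⟨M, hM, -, hXM⟩ := h
  obtain ⟨e, he⟩ := hA hfin
  rw [hXM] at hv
  exact hv.minorsIdeal_finrank_ker_sq_ne_two hM hfin hψ hs e he

end Orbits
-- The equivalence.
theorem proposition6p2p2 {k : Type*} [Field k] [IsAlgClosed k]
    (h2 : ringChar k ≠ 2) (h3 : ringChar k ≠ 3)
    (X : ProjSubscheme k 4) (hX : X ∈ hilbAG k 4 6 0) :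
    X.IsScandinavian ↔
      X ∉ (orbitO 4 6 (AlgA k 3 5 × k) ∪ orbitO 4 6 (AlgA k 3 6) : Set (ProjSubscheme k 4)) := by
  constructor
  · rintro h (hXA | hXA)
    · refine not_mem_orbitO_of_isScandinavian hX h (fun hfin => ?_) hXA
      -- A_{3,5} has n = 2 and s = 2, so m² is a line there, and the factor k adds one dimension. In
      -- A_{3,6}, with s = 3, m² is already a plane.
      have := finite_algA k 2 2
      have hfin' : Module.finrank k (AlgA k 3 5) + 1 = 6 := by
        rw [← hfin, Module.finrank_prod, Module.finrank_self]
      obtain ⟨e, he⟩ := exists_finrank_ker_sq_algA k 2 2 le_rfl (Nat.succ_injective hfin')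
      exact ⟨_, (finrank_ker_sq_prod k e).trans (congrArg (· + 1) he)⟩
    · exact not_mem_orbitO_of_isScandinavian hX h
        (exists_finrank_ker_sq_algA k 2 3 (by norm_num)) hXA
  · intro hXA
    rw [Set.mem_union, not_or] at hXA
    obtain ⟨K, _, _, v, hv, hiso⟩ := exists_chart hX
    obtain ⟨hfin, hli, ψ, hs, h1, hψ⟩ := hv.exists_nondegenerate hX
    have : FiniteDimensional k K := FiniteDimensional.of_finrank_pos (by omega)
    have : Nontrivial K := Module.nontrivial_of_finrank_pos (R := k) (by omega)
    have hchar : ∀ p : ℕ, p.Prime → ringChar k ≠ p → (p : k) ≠ 0 := fun p hp hk h0 => by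
      rcases (Nat.dvd_prime hp).mp ((ringChar.spec k p).mp h0) with h | h
      · exact CharP.ringChar_ne_one h
      · exact hk h
    obtain ⟨M, hM, hMI, hIM⟩ := exists_matrix_of_isEmpty_algEquiv
      (by exact_mod_cast hchar 2 Nat.prime_two h2) (by exact_mod_cast hchar 3 Nat.prime_three h3)
      hfin hψ h1 hli hs
      (not_nonempty_iff.mp fun h => hXA.1 (mem_orbitO_of_isIsoSpec hX ((hiso _).mpr h)))
      (not_nonempty_iff.mp fun h => hXA.2 (mem_orbitO_of_isIsoSpec hX ((hiso _).mpr h)))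
    have hideal : X.ideal = minorsIdeal M := by
      refine le_antisymm (fun f hf => ?_) (minorsIdeal_le M fun i i' j j' => ?_)
      · rw [← sum_homogeneousComponent f]
        refine sum_mem fun m _ => hIM m _ (homogeneousComponent_isHomogeneous m f) ?_
        refine (hv.aeval_eq_zero_iff m _ (homogeneousComponent_isHomogeneous m f)).mpr ?_
        have := X.isHomogeneous m hf
        rwa [← decomposition.decompose'_apply]
      · exact (hv.aeval_eq_zero_iff _ _ (((hM i j).mul (hM i' j')).sub
          ((hM i j').mul (hM i' j)))).mp (hMI _ (mul_sub_mul_mem_minorsIdeal M i i' j j'))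
    exact ⟨M, hM, hideal ▸ hv.idealDepth_eq X.isHomogeneous, hideal⟩
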